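/- Let $\mu$ be a positive (locally finite Borel) measure on $\mathbf{C}$ whose support $K=\operatorname{supp}(\mu)$ is a compact set of two-dimensional Lebesgue measure zero, and let $$\hat\mu(z)=\int\frac{d\mu(\zeta)}{z-\zeta}$$ be its Cauchy transform. Suppose that there are $k\ge 1$ and polynomials $p_0,\dots,p_k\in\mathbf{C}[z]$, not all identically zero, such that $$p_k(z)\,\hat\mu(z)^k+\dots+p_1(z)\,\hat\mu(z)+p_0(z)=0\qquad\text{for all } z\in\mathbf{C}\setminus K.$$ Then $K$ is a real analytic set of dimension at most one, in the sense that real analytic arcs are allowed to have end points: $K$ is closed, and for every $p\in K$ there are finitely many (possibly no) half-arcs $\gamma_1,\dots,\gamma_m$ issuing from $p$, pairwise meeting only at $p$, such that in some neighbourhood of $p$ the set $K$ coincides with $\{p\}\cup\gamma_1([0,1])\cup\dots\cup\gamma_m([0,1])$. Here a half-arc issuing from $p$ is an injective map $\gamma\colon[0,1]\to\mathbf{C}$ with $\gamma(0)=p$ that extends real analytically to a neighbourhood of $[0,1]$ and satisfies $\gamma'(t)\neq 0$ for $0<t\le 1$. -/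

import Mathlib

open MeasureTheory Set Filter Topology

/-- The Cauchy transform `z ↦ ∫ dμ(ζ) / (z - ζ)` of a measure on the complex plane.
For a locally finite measure with compact support the integrand is bounded
whenever `z` lies off the support. -/
noncomputable def cauchyTransform (μ : Measure ℂ) (z : ℂ) : ℂ :=
  ∫ ζ, 1 / (z - ζ) ∂μ

/-- The Cauchy transform of `μ` satisfies a (nontrivial) algebraic equation
`p_k(z) w ^ k + ⋯ + p_1(z) w + p_0(z) = 0`, with `w` the Cauchy transform at `z`,
for all `z` off the support of `μ`. -/
def HasAlgebraicCauchyTransform (μ : Measure ℂ) : Prop :=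
  ∃ k : ℕ, 1 ≤ k ∧ ∃ p : Fin (k + 1) → Polynomial ℂ, (∃ i, p i ≠ 0) ∧
    ∀ z : ℂ, z ∉ μ.support →
      ∑ i : Fin (k + 1), (p i).eval z * cauchyTransform μ z ^ (i : ℕ) = 0

/-- `γ`, restricted to `[0, 1]`, is a simple real analytic half-arc issuing from `p`:
it is real analytic in a neighbourhood of `[0, 1]` (its starting point included), injective on
`[0, 1]`, and regular except possibly at the starting point (where it may have a cusp-like
parametrization such as `t ↦ (t ^ 2, t ^ 3)`). -/
structure IsAnalyticHalfArc (p : ℂ) (γ : ℝ → ℂ) : Prop where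
  analytic : AnalyticOnNhd ℝ γ (Icc 0 1)
  start : γ 0 = p
  injOn : InjOn γ (Icc 0 1)
  regular : ∀ t ∈ Ioc (0 : ℝ) 1, deriv γ t ≠ 0

/-- `K` is a real analytic set of dimension at most one in the plane, where analytic arcs are
allowed to end (a compact segment is such a set): `K` is closed, and near each of its points `p`
it consists of `p` together with finitely many simple real analytic half-arcs issuing from `p`
and pairwise meeting only at `p`. No half-arc at all means that `p` is an isolated point. -/
def IsRealAnalyticSetOfDimLEOne (K : Set ℂ) : Prop :=
  IsClosed K ∧ ∀ p ∈ K, ∃ (m : ℕ) (γ : Fin m → ℝ → ℂ),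
    (∀ i, IsAnalyticHalfArc p (γ i)) ∧
    (∀ i j, i ≠ j → γ i '' Icc 0 1 ∩ γ j '' Icc 0 1 = {p}) ∧
    ∀ᶠ z in 𝓝 p, z ∈ K ↔ z = p ∨ ∃ i, z ∈ γ i '' Icc 0 1

/-! The logarithmic potential U(z) = ∫ log|z - ζ| dμ(ζ) is subharmonic and is, up to a real part, a
primitive of the Cauchy transform: for each v and almost every z, U(z + v) - U(z) is the integral of
Re(μ̂ v) over the segment (`ae_logPotential_add_sub`). Since K has area zero, almost every segment
meets K in a set of length zero, so almost everywhere on it μ̂ is one of finitely many algebraic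
branches.

Suppose μ̂ equals the branch α_m, with primitive F_m, on a disc off K, and let the disc move in a
direction e with Re((α_m - α_l) e) ≥ 0 for every competing branch α_l. Then U - Re F_m, constant on
the disc, cannot grow along e; the strong maximum principle
(`measure_ball_eq_zero_of_logPotential_le`) expels all mass from the moved disc, and α_m persists
there. This is `propagate_ball`, extended to curves by `propagate_path`.

Near p, Puiseux's theorem (`exists_puiseux`) makes the branches meromorphic in s, with z = p + s^N.
A branch occurring arbitrarily near p along a direction satisfies (z - p) α → μ({p}): otherwise a
dominating branch would spread over discs of radius proportional to |z - p|, where (z - p) μ̂ does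
tend to μ({p}) (`LogRoots.tendsto_of_frequently`). All relevant branches thus share the same polar
term, and the remaining primitives F_l are analytic in s and vanish at 0.

The zeros of Re(F_i - F_j) in a thin sector form finitely many analytic arcs (`exists_arcs`).
Between adjacent arcs the Re F_l are strictly ordered, and the largest of those occurring near the
vertex propagates outwards along suitable paths, so a single branch fills the region
(`SectorData.exists_branch`). An arc lies in K if the branches on its two sides differ, and misses K
if they agree (`SectorData.arc_dichotomy`). Finitely many sectors cover all directions, so near p
the set K is p together with finitely many analytic arcs. -/

/-! ### Polar coordinates and integrability of the Cauchy kernel -/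

open Metric in
theorem setIntegral_ball_eq_integral_circleAverage {f : ℂ → ℝ} {c : ℂ} {R : ℝ}
    (hf : IntegrableOn f (ball c R)) :
    ∫ z in ball c R, f z = ∫ r in Ioo 0 R, 2 * Real.pi * r * Real.circleAverage f c r := by
  have h1 : ∫ z in ball c R, f z = ∫ z, (ball (0:ℂ) R).indicator (fun z => f (c + z)) z := by
    rw [← integral_indicator measurableSet_ball, ← integral_add_left_eq_self _ c]
    congr 1; ext z
    simp [indicator, mem_ball, dist_eq_norm]
  have hint : Integrable ((ball (0:ℂ) R).indicator (fun z => f (c + z))) := by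
    have := (integrable_indicator_iff measurableSet_ball).2 hf
    have := this.comp_add_left c
    convert this using 1
    ext z
    simp [indicator, mem_ball, dist_eq_norm]
  set g := (ball (0:ℂ) R).indicator (fun z => f (c + z)) with hg
  rw [h1, ← Complex.integral_comp_polarCoord_symm]
  have hint2 : IntegrableOn (fun p : ℝ × ℝ => p.1 • g (Complex.polarCoord.symm p))
      polarCoord.target := by
    have := (integrableOn_image_iff_integrableOn_abs_det_fderiv_smul volume
      polarCoord.open_target.measurableSet
      (fun p _ => (hasFDerivAt_polarCoord_symm p).hasFDerivWithinAt) polarCoord.symm.injOn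
      (fun p => g (Complex.measurableEquivRealProd.symm p))).1 ?_
    · refine this.congr_fun ?_ polarCoord.open_target.measurableSet
      intro p hp
      simp only [det_fderivPolarCoordSymm]
      rw [polarCoord_target] at hp
      rw [abs_of_pos hp.1]
      rfl
    · refine Integrable.integrableOn ?_
      exact (Complex.volume_preserving_equiv_real_prod.symm).integrable_comp_of_integrable hint
  rw [polarCoord_target] at hint2 ⊢
  rw [Measure.volume_eq_prod] at hint2 ⊢
  rw [setIntegral_prod _ hint2, ← integral_indicator measurableSet_Ioi,
    ← integral_indicator measurableSet_Ioo]
  congr 1; ext r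
  by_cases hr : r ∈ Ioo 0 R
  · have hr0 : r ∈ Ioi (0:ℝ) := hr.1
    rw [indicator_of_mem hr0, indicator_of_mem hr]
    rw [Real.circleAverage_def, smul_eq_mul]
    have h2 : ∀ θ : ℝ, g (Complex.polarCoord.symm (r, θ)) = f (circleMap c r θ) := by
      intro θ
      have : Complex.polarCoord.symm (r, θ) ∈ ball (0:ℂ) R := by
        rw [mem_ball_zero_iff, Complex.norm_polarCoord_symm, abs_of_pos hr.1]; exact hr.2
      rw [hg, indicator_of_mem this, circleMap, Complex.polarCoord_symm_apply]
      congr 2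
      rw [Complex.exp_mul_I]; simp
    simp only [h2, smul_eq_mul]
    rw [integral_const_mul, ← integral_Ioc_eq_integral_Ioo,
      ← intervalIntegral.integral_of_le (by linarith [Real.pi_pos])]
    have := ((periodic_circleMap c r).comp f).intervalIntegral_add_eq (-Real.pi) 0
    simp only [Function.comp_def] at this
    rw [show -Real.pi + 2 * Real.pi = Real.pi by ring, zero_add] at this
    rw [this]
    field_simp
  · rw [indicator_of_notMem hr]
    by_cases hr0 : r ∈ Ioi (0:ℝ)
    · rw [indicator_of_mem hr0]
      have h2 : ∀ θ : ℝ, g (Complex.polarCoord.symm (r, θ)) = 0 := by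
        intro θ
        apply indicator_of_notMem
        rw [mem_ball_zero_iff, Complex.norm_polarCoord_symm, abs_of_pos hr0]
        exact fun h => hr ⟨hr0, h⟩
      simp only [h2, smul_zero, integral_zero]
    · rw [indicator_of_notMem hr0]

/-- The Jacobian r of polar coordinates cancels 1/|z|, leaving at most the indicator of a bounded
rectangle. -/
theorem lintegral_ball_inv_lt_top : ∫⁻ z in Metric.ball (0:ℂ) 1, ‖1 / z‖ₑ < ⊤ := by
  rw [← lintegral_indicator measurableSet_ball, ← Complex.lintegral_comp_polarCoord_symm]
  have : ∀ p ∈ polarCoord.target, ENNReal.ofReal p.1 • (Metric.ball (0:ℂ) 1).indicator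
      (fun z => ‖1 / z‖ₑ) (Complex.polarCoord.symm p) ≤
      (Ioo (0:ℝ) 1 ×ˢ Ioo (-Real.pi) Real.pi).indicator 1 p := by
    intro p hp
    rw [polarCoord_target] at hp
    have hp1 : (0:ℝ) < p.1 := hp.1
    by_cases h : Complex.polarCoord.symm p ∈ Metric.ball (0:ℂ) 1
    · rw [indicator_of_mem h]
      rw [mem_ball_zero_iff, Complex.norm_polarCoord_symm, abs_of_pos hp.1] at h
      rw [indicator_of_mem (show p ∈ Ioo (0:ℝ) 1 ×ˢ Ioo (-Real.pi) Real.pi from ⟨⟨hp.1, h⟩, hp.2⟩)]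
      rw [← ofReal_norm, norm_div, Complex.norm_polarCoord_symm, abs_of_pos hp1,
        smul_eq_mul, ← ENNReal.ofReal_mul hp1.le]
      simp [hp1.ne']
    · rw [indicator_of_notMem h]; simp
  refine (setLIntegral_mono' polarCoord.open_target.measurableSet this).trans_lt ?_
  refine (setLIntegral_le_lintegral _ _).trans_lt ?_
  rw [lintegral_indicator_one (measurableSet_Ioo.prod measurableSet_Ioo), Measure.volume_eq_prod,
    Measure.prod_prod]
  exact ENNReal.mul_lt_top (by simp) (by simp)

/-- The kernel is at most 1 outside the unit disc about ζ, and its integral over that disc is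
translation invariant. Uniformity in ζ is what Tonelli's theorem against a finite μ requires. -/
theorem exists_lintegral_ball_cauchyKernel_le (c : ℂ) (R : ℝ) :
    ∃ C : ENNReal, C ≠ ⊤ ∧ ∀ ζ : ℂ, ∫⁻ z in Metric.ball c R, ‖1 / (z - ζ)‖ₑ ≤ C := by
  refine ⟨(∫⁻ z in Metric.ball (0:ℂ) 1, ‖1 / z‖ₑ) + volume (Metric.ball c R), ?_, fun ζ => ?_⟩
  · exact ENNReal.add_ne_top.2 ⟨lintegral_ball_inv_lt_top.ne, measure_ball_lt_top.ne⟩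
  · have h1 : ∀ z : ℂ, ‖1 / (z - ζ)‖ₑ ≤
        (Metric.ball (0:ℂ) 1).indicator (fun z => ‖1 / z‖ₑ) (z - ζ) + 1 := by
      intro z
      by_cases h : z - ζ ∈ Metric.ball (0:ℂ) 1
      · rw [indicator_of_mem h]; exact le_self_add
      · rw [indicator_of_notMem h, zero_add]
        rw [mem_ball_zero_iff, not_lt] at h
        rw [← ofReal_norm, ← ENNReal.ofReal_one, norm_div, norm_one]
        exact ENNReal.ofReal_le_ofReal (div_le_one_of_le₀ h (norm_nonneg _))
    refine (lintegral_mono h1).trans ?_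
    rw [lintegral_add_right _ measurable_const, setLIntegral_const, one_mul]
    refine add_le_add_left ((setLIntegral_le_lintegral _ _).trans ?_) _
    rw [lintegral_sub_right_eq_self
      (fun z => (Metric.ball (0:ℂ) 1).indicator (fun z => ‖1 / z‖ₑ) z) ζ,
      lintegral_indicator measurableSet_ball]

/-! ### The logarithmic potential as a primitive of the Cauchy transform -/

section Potential

variable {μ : Measure ℂ} [IsFiniteMeasure μ]

/-- The logarithmic potential of a measure on the plane. -/
noncomputable def logPotential (μ : Measure ℂ) (z : ℂ) : ℝ :=
  ∫ ζ, Real.log ‖z - ζ‖ ∂μ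

/-- For fixed τ, translating ζ reduces the integral over a disc in z to the uniform kernel bound,
which does not depend on τ; Tonelli does the rest. -/
theorem ae_lintegral_segment_cauchyKernel_lt_top (v : ℂ) :
    ∀ᵐ z : ℂ, ∫⁻ τ in Ioc (0:ℝ) 1, ∫⁻ ζ, ‖1 / (z + τ * v - ζ)‖ₑ ∂μ < ⊤ := by
  have hm : Measurable (fun p : ℂ × ℝ × ℂ => ‖1 / (p.1 + p.2.1 * v - p.2.2)‖ₑ) := by fun_prop
  have key : ∀ n : ℕ, ∀ᵐ z ∂(volume.restrict (Metric.ball (0:ℂ) n)),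
      ∫⁻ τ in Ioc (0:ℝ) 1, ∫⁻ ζ, ‖1 / (z + τ * v - ζ)‖ₑ ∂μ < ⊤ := by
    intro n
    obtain ⟨C, hC, hCle⟩ := exists_lintegral_ball_cauchyKernel_le 0 n
    have hm1 : Measurable (fun z : ℂ => ∫⁻ τ in Ioc (0:ℝ) 1, ∫⁻ ζ, ‖1 / (z + τ * v - ζ)‖ₑ ∂μ) := by
      refine Measurable.lintegral_prod_right' (f := fun p : ℂ × ℝ => ∫⁻ ζ, ‖1 / (p.1 + p.2 * v - ζ)‖ₑ ∂μ) ?_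
      refine Measurable.lintegral_prod_right' (f := fun p : (ℂ × ℝ) × ℂ => ‖1 / (p.1.1 + p.1.2 * v - p.2)‖ₑ) ?_
      fun_prop
    refine ae_lt_top hm1 ?_
    rw [lintegral_lintegral_swap]
    swap
    · refine Measurable.aemeasurable ?_
      refine Measurable.lintegral_prod_right' (f := fun p : (ℂ × ℝ) × ℂ => ‖1 / (p.1.1 + p.1.2 * v - p.2)‖ₑ) ?_
      fun_prop
    have : ∀ τ : ℝ, ∫⁻ z in Metric.ball (0:ℂ) n, ∫⁻ ζ, ‖1 / (z + τ * v - ζ)‖ₑ ∂μ ≤ C * μ univ := by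
      intro τ
      rw [lintegral_lintegral_swap]
      · calc _ ≤ ∫⁻ _, C ∂μ := by
              refine lintegral_mono fun ζ => ?_
              have := hCle (ζ - τ * v)
              simpa only [← sub_add, sub_add_eq_add_sub] using this
          _ = _ := by simp
      · exact Measurable.aemeasurable (by fun_prop)
    refine ((lintegral_mono this).trans_lt ?_).ne
    rw [setLIntegral_const]
    exact ENNReal.mul_lt_top (ENNReal.mul_lt_top hC.lt_top (measure_lt_top _ _)) (by simp)
  have := ae_restrict_iUnion_iff (μ := (volume : Measure ℂ)) (fun n : ℕ => Metric.ball (0:ℂ) n)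
    (fun z => ∫⁻ τ in Ioc (0:ℝ) 1, ∫⁻ ζ, ‖1 / (z + τ * v - ζ)‖ₑ ∂μ < ⊤)
  rw [Metric.iUnion_ball_nat, Measure.restrict_univ] at this
  exact this.2 key

/-- By Fubini ζ may be fixed first; the bad z then form a translated and reflected segment,
contained in a real line and hence null. -/
theorem ae_forall_ne_segment (μ : Measure ℂ) [SFinite μ] {v : ℂ} :
    ∀ᵐ z : ℂ, ∀ᵐ ζ ∂μ, ∀ τ ∈ Icc (0:ℝ) 1, z + τ * v ≠ ζ := by
  have hcl : IsCompact ((fun τ : ℝ => (τ:ℂ) * v) '' Icc 0 1) :=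
    isCompact_Icc.image (by fun_prop)
  have hset : ∀ z ζ : ℂ, (∀ τ ∈ Icc (0:ℝ) 1, z + τ * v ≠ ζ) ↔
      ζ - z ∉ (fun τ : ℝ => (τ:ℂ) * v) '' Icc 0 1 := by
    intro z ζ
    simp only [mem_image, not_exists, not_and]
    refine forall₂_congr fun τ _ => not_congr ?_
    rw [eq_sub_iff_add_eq, add_comm]
  simp only [hset]
  have hmeas : MeasurableSet {p : ℂ × ℂ | p.2 - p.1 ∉ (fun τ : ℝ => (τ:ℂ) * v) '' Icc 0 1} :=
    (hcl.isClosed.preimage (by fun_prop : Continuous fun p : ℂ × ℂ => p.2 - p.1)).measurableSet.compl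
  rw [Measure.ae_ae_comm hmeas]
  refine ae_of_all _ fun ζ => ?_
  have hnull : volume ((fun τ : ℝ => (τ:ℂ) * v) '' Icc 0 1) = 0 := by
    refine measure_mono_null ?_ (Measure.addHaar_submodule volume (Submodule.span ℝ {v}) ?_)
    · rintro _ ⟨τ, _, rfl⟩
      exact Submodule.mem_span_singleton.2 ⟨τ, by simp⟩
    · intro h
      have h1 := finrank_span_le_card (R := ℝ) ({v} : Set ℂ)
      rw [h, finrank_top, Complex.finrank_real_complex] at h1
      simp at h1
  have := (quasiMeasurePreserving_sub_left volume ζ).ae (measure_eq_zero_iff_ae_notMem.1 hnull)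
  exact this

/-- For fixed τ the bad z form a translate of K. Vanishing area enters here to make the algebraic
equation available almost everywhere along almost every segment. -/
theorem ae_ae_segment_notMem {K : Set ℂ} (hK : IsClosed K) (h0 : (volume : Measure ℂ) K = 0) (v : ℂ) :
    ∀ᵐ z : ℂ, ∀ᵐ τ : ℝ ∂(volume.restrict (Ioc (0:ℝ) 1)), z + τ * v ∉ K := by
  have hmeas : MeasurableSet {p : ℂ × ℝ | p.1 + p.2 * v ∉ K} :=
    (hK.preimage (by fun_prop : Continuous fun p : ℂ × ℝ => p.1 + p.2 * v)).measurableSet.compl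
  rw [Measure.ae_ae_comm hmeas]
  refine ae_of_all _ fun τ => ?_
  have := (quasiMeasurePreserving_add_right (volume : Measure ℂ) ((τ:ℂ) * v)).ae
    (measure_eq_zero_iff_ae_notMem.1 h0)
  exact this

/-- Integrability of the logarithm is thereby inherited from the Cauchy kernel. At z = 0 both sides
are 0, by the conventions for log 0 and 1/0. -/
theorem abs_log_norm_le (z : ℂ) : |Real.log ‖z‖| ≤ ‖z‖ + ‖1 / z‖ := by
  rcases eq_or_ne z 0 with rfl | hz
  · simp
  have h := norm_pos_iff.2 hz
  rw [norm_div, norm_one, abs_le]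
  constructor
  · have := Real.one_sub_inv_le_log_of_pos h
    rw [one_div]; linarith
  · have := Real.log_le_sub_one_of_pos h
    have : 0 ≤ 1 / ‖z‖ := by positivity
    linarith

theorem integrable_log_norm_sub {B : ℝ} (hB : ∀ᵐ ζ ∂μ, ‖ζ‖ ≤ B) {z : ℂ}
    (hz : ∫⁻ ζ, ‖1 / (z - ζ)‖ₑ ∂μ < ⊤) : Integrable (fun ζ => Real.log ‖z - ζ‖) μ := by
  have h1 : Integrable (fun ζ => 1 / (z - ζ)) μ :=
    ⟨Measurable.aestronglyMeasurable (by fun_prop), hz⟩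
  have h2 : Integrable (fun ζ => ‖z‖ + B + ‖1 / (z - ζ)‖) μ := (integrable_const _).add h1.norm
  refine h2.mono' (Measurable.aestronglyMeasurable (by fun_prop)) ?_
  filter_upwards [hB] with ζ hζ
  rw [Real.norm_eq_abs]
  refine (abs_log_norm_le _).trans ?_
  have := norm_sub_le z ζ
  linarith

theorem hasDerivAt_log_norm_segment {z v ζ : ℂ} {τ : ℝ} (h : z + τ * v ≠ ζ) :
    HasDerivAt (fun τ : ℝ => Real.log ‖z + τ * v - ζ‖) (1 / (z + τ * v - ζ) * v).re τ := by
  have hne : z + τ * v - ζ ≠ 0 := sub_ne_zero.2 h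
  have h1 : HasDerivAt (fun τ : ℝ => z + τ * v - ζ) v τ := by
    have := ((Complex.ofRealCLM.hasDerivAt (x := τ)).mul_const v).const_add z |>.sub_const ζ
    simpa using this
  have h2 := (h1.norm_sq).log (by positivity)
  have h3 : (fun τ : ℝ => Real.log ‖z + τ * v - ζ‖) =
      fun τ : ℝ => (1 / 2) * Real.log (‖z + τ * v - ζ‖ ^ 2) := by
    ext t; rw [Real.log_pow]; push_cast; ring
  rw [h3]
  refine (h2.const_mul (1 / 2)).congr_deriv ?_
  rw [Complex.inner]
  have hn : Complex.normSq (z + τ * v - ζ) ≠ 0 := by simpa using hne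
  rw [← Complex.normSq_eq_norm_sq]
  simp only [Complex.mul_re, one_div, Complex.inv_re, Complex.inv_im, Complex.conj_re, Complex.conj_im]
  field_simp

/-- Along the segment, log|z + τv - ζ| has τ-derivative Re(v/(z + τv - ζ)); integrate in τ for fixed
ζ, then in ζ, and exchange the integrals. -/
theorem logPotential_add_sub {z v : ℂ}
    (hfin : ∫⁻ τ in Ioc (0:ℝ) 1, ∫⁻ ζ, ‖1 / (z + τ * v - ζ)‖ₑ ∂μ < ⊤)
    (hseg : ∀ᵐ ζ ∂μ, ∀ τ ∈ Icc (0:ℝ) 1, z + τ * v ≠ ζ)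
    (hz : Integrable (fun ζ => Real.log ‖z - ζ‖) μ)
    (hzv : Integrable (fun ζ => Real.log ‖z + v - ζ‖) μ) :
    IntervalIntegrable (fun τ : ℝ => (cauchyTransform μ (z + τ * v) * v).re) volume 0 1 ∧
    logPotential μ (z + v) - logPotential μ z =
      ∫ τ in (0:ℝ)..1, (cauchyTransform μ (z + τ * v) * v).re := by
  have hint : Integrable (Function.uncurry fun (τ : ℝ) (ζ : ℂ) => 1 / (z + τ * v - ζ) * v)
      ((volume.restrict (Ioc (0:ℝ) 1)).prod μ) := by
    refine Integrable.mul_const ?_ v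
    refine ⟨Measurable.aestronglyMeasurable (by fun_prop), ?_⟩
    rw [HasFiniteIntegral, lintegral_prod _ (Measurable.aemeasurable (by fun_prop))]
    exact hfin
  have hC : ∀ τ : ℝ, (cauchyTransform μ (z + τ * v) * v) = ∫ ζ, 1 / (z + τ * v - ζ) * v ∂μ := by
    intro τ
    rw [cauchyTransform, integral_mul_const]
  have hre : ∀ τ : ℝ, ∀ _ : Integrable (fun ζ => 1 / (z + τ * v - ζ) * v) μ,
      (cauchyTransform μ (z + τ * v) * v).re = ∫ ζ, (1 / (z + τ * v - ζ) * v).re ∂μ := by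
    intro τ h
    rw [hC]
    exact (integral_re h).symm
  have hint' : Integrable (Function.uncurry fun (τ : ℝ) (ζ : ℂ) => (1 / (z + τ * v - ζ) * v).re)
      ((volume.restrict (Ioc (0:ℝ) 1)).prod μ) := hint.re
  refine ⟨?_, ?_⟩
  · rw [intervalIntegrable_iff_integrableOn_Ioc_of_le zero_le_one]
    have := hint.integral_prod_left.re
    simp only [hC]
    exact this
  · rw [intervalIntegral.integral_of_le zero_le_one]
    have h1 : ∫ τ in Ioc (0:ℝ) 1, (cauchyTransform μ (z + τ * v) * v).re =
        ∫ τ in Ioc (0:ℝ) 1, ∫ ζ, (1 / (z + τ * v - ζ) * v).re ∂μ := by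
      refine integral_congr_ae ?_
      filter_upwards [hint.prod_right_ae] with τ hτ
      exact hre τ hτ
    rw [h1, integral_integral_swap hint', logPotential, logPotential, ← integral_sub hzv hz]
    refine integral_congr_ae ?_
    filter_upwards [hseg, hint'.prod_left_ae] with ζ hζ hI
    rw [← intervalIntegral.integral_of_le zero_le_one]
    rw [intervalIntegral.integral_eq_sub_of_hasDerivAt
      (f := fun τ : ℝ => Real.log ‖z + τ * v - ζ‖)]
    · simp
    · intro τ hτ
      rw [uIcc_of_le zero_le_one] at hτ
      exact hasDerivAt_log_norm_segment (hζ τ hτ)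
    · rw [intervalIntegrable_iff_integrableOn_Ioc_of_le zero_le_one]
      exact hI

theorem ae_logPotential_add_sub {B : ℝ} (hB : ∀ᵐ ζ ∂μ, ‖ζ‖ ≤ B) (v : ℂ) :
    ∀ᵐ z : ℂ, IntervalIntegrable (fun τ : ℝ => (cauchyTransform μ (z + τ * v) * v).re) volume 0 1 ∧
    logPotential μ (z + v) - logPotential μ z =
      ∫ τ in (0:ℝ)..1, (cauchyTransform μ (z + τ * v) * v).re := by
  have h0 : ∀ᵐ z : ℂ, ∫⁻ ζ, ‖1 / (z - ζ)‖ₑ ∂μ < ⊤ := by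
    filter_upwards [ae_lintegral_segment_cauchyKernel_lt_top (μ := μ) 0] with z hz
    simpa using hz
  have h0v := (quasiMeasurePreserving_add_right volume v).ae h0
  filter_upwards [ae_lintegral_segment_cauchyKernel_lt_top (μ := μ) v,
    ae_forall_ne_segment μ (v := v), h0, h0v] with z h1 h2 h3 h4
  exact logPotential_add_sub h1 h2 (integrable_log_norm_sub hB h3) (integrable_log_norm_sub hB h4)

end Potential

/-! ### Disc averages, the strong maximum principle and regularity off the support -/

theorem ae_norm_sub_ge_of_ball_disjoint_support {μ : Measure ℂ} {z : ℂ} {δ : ℝ}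
    (h : ∀ x ∈ Metric.ball z δ, x ∉ μ.support) : ∀ᵐ ζ ∂μ, δ ≤ ‖z - ζ‖ := by
  filter_upwards [Measure.support_mem_ae (μ := μ)] with ζ hζ
  by_contra hlt
  exact h ζ (by rw [Metric.mem_ball, dist_comm, dist_eq_norm]; exact not_le.1 hlt) hζ

theorem notMem_support_of_measure_ball {μ : Measure ℂ} {z c : ℂ} {R : ℝ} (h : μ (Metric.ball c R) = 0)
    (hz : z ∈ Metric.ball c R) : z ∉ μ.support :=
  Measure.subset_compl_support_of_isOpen Metric.isOpen_ball h hz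

section Potential

variable {μ : Measure ℂ} [IsFiniteMeasure μ]

theorem integrable_prod_log_norm_sub {B : ℝ} (hB : ∀ᵐ ζ ∂μ, ‖ζ‖ ≤ B) (c : ℂ) (R : ℝ) :
    Integrable (Function.uncurry fun z ζ : ℂ => Real.log ‖z - ζ‖)
      ((volume.restrict (Metric.ball c R)).prod μ) := by
  obtain ⟨C, hC, hCle⟩ := exists_lintegral_ball_cauchyKernel_le c R
  have h1 : Integrable (Function.uncurry fun z ζ : ℂ => 1 / (z - ζ))
      ((volume.restrict (Metric.ball c R)).prod μ) := by
    refine ⟨Measurable.aestronglyMeasurable (by fun_prop), ?_⟩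
    rw [HasFiniteIntegral, lintegral_prod_symm _ (Measurable.aemeasurable (by fun_prop))]
    refine (lintegral_mono (g := fun _ => C) fun ζ => hCle ζ).trans_lt ?_
    rw [lintegral_const]
    exact ENNReal.mul_lt_top hC.lt_top (measure_lt_top _ _)
  have : IsFiniteMeasure ((volume : Measure ℂ).restrict (Metric.ball c R)) :=
    ⟨by rw [Measure.restrict_apply_univ]; exact measure_ball_lt_top⟩
  have h2 : Integrable (fun p : ℂ × ℂ => (‖c‖ + R + B) + ‖1 / (p.1 - p.2)‖)
      ((volume.restrict (Metric.ball c R)).prod μ) := (integrable_const _).add h1.norm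
  refine h2.mono' (Measurable.aestronglyMeasurable (by fun_prop)) ?_
  have e1 : ∀ᵐ p ∂((volume.restrict (Metric.ball c R)).prod μ), p.1 ∈ Metric.ball c R :=
    Measure.quasiMeasurePreserving_fst.ae (ae_restrict_mem measurableSet_ball)
  have e2 : ∀ᵐ p ∂((volume.restrict (Metric.ball c R)).prod μ), ‖p.2‖ ≤ B :=
    Measure.quasiMeasurePreserving_snd.ae hB
  filter_upwards [e1, e2] with p h1 h2
  refine (abs_log_norm_le _).trans ?_
  have h3 := norm_sub_le p.1 p.2
  have h4 : ‖p.1‖ ≤ ‖c‖ + R := by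
    have := norm_le_norm_add_norm_sub' p.1 c
    rw [Metric.mem_ball, dist_eq_norm] at h1
    linarith
  linarith

/-- The mean value property on each circle, integrated over radii. The area of the disc is kept as a
radial integral, to be compared with the logarithmic case under the integral sign. -/
theorem setIntegral_ball_re {c : ℂ} {R : ℝ} {F : ℂ → ℂ}
    (hF : DifferentiableOn ℂ F (Metric.closedBall c R)) :
    IntegrableOn (fun z => (F z).re) (Metric.ball c R) ∧
    ∫ z in Metric.ball c R, (F z).re = (∫ r in Ioo 0 R, 2 * Real.pi * r) * (F c).re := by
  have hint : IntegrableOn F (Metric.ball c R) :=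
    (hF.continuousOn.integrableOn_compact (isCompact_closedBall c R)).mono_set
      Metric.ball_subset_closedBall
  have hre : IntegrableOn (fun z => (F z).re) (Metric.ball c R) := hint.re
  refine ⟨hre, ?_⟩
  rw [setIntegral_ball_eq_integral_circleAverage hre, ← integral_mul_const]
  refine setIntegral_congr_fun measurableSet_Ioo fun r hr => ?_
  have hsub : Metric.closedBall c |r| ⊆ Metric.closedBall c R := by
    rw [abs_of_pos hr.1]; exact Metric.closedBall_subset_closedBall hr.2.le
  have hd := (hF.mono hsub)
  have h1 : Real.circleAverage F c r = F c :=
    DiffContOnCl.circleAverage (hd.diffContOnCl_ball subset_rfl)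
  have hci : IntervalIntegrable (fun θ => F (circleMap c r θ)) volume 0 (2 * Real.pi) := by
    refine Continuous.intervalIntegrable ?_ _ _
    refine ContinuousOn.comp_continuous hd.continuousOn (continuous_circleMap c r) fun θ => ?_
    exact Metric.sphere_subset_closedBall (circleMap_mem_sphere' c r θ)
  have h2 : Real.circleAverage (fun z => (F z).re) c r = (F c).re := by
    rw [← h1, Real.circleAverage_def, Real.circleAverage_def, Complex.real_smul,
      Complex.re_ofReal_mul, smul_eq_mul]
    congr 1
    exact intervalIntegral.intervalIntegral_re hci
  simp only [h2]

/-- The average of log|z - ζ| over the circle of radius r about c is log max(r, |c - ζ|). -/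
theorem setIntegral_ball_log_norm_sub {c ζ : ℂ} {R : ℝ} (hζ : ζ ≠ c) :
    ∫ z in Metric.ball c R, Real.log ‖z - ζ‖ =
      ∫ r in Ioo 0 R, 2 * Real.pi * r * Real.log (max r ‖c - ζ‖) := by
  have hint : IntegrableOn (fun z => Real.log ‖z - ζ‖) (Metric.ball c R) := by
    obtain ⟨C, hC, hCle⟩ := exists_lintegral_ball_cauchyKernel_le c R
    have h1 : IntegrableOn (fun z => 1 / (z - ζ)) (Metric.ball c R) :=
      ⟨Measurable.aestronglyMeasurable (by fun_prop), (hCle ζ).trans_lt hC.lt_top⟩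
    have h0 : IntegrableOn (fun z => ‖z - ζ‖) (Metric.ball c R) :=
      ((by fun_prop : Continuous fun z => ‖z - ζ‖).continuousOn.integrableOn_compact
        (isCompact_closedBall c R)).mono_set Metric.ball_subset_closedBall
    refine (h0.add h1.norm).mono' (Measurable.aestronglyMeasurable (by fun_prop)) ?_
    exact ae_of_all _ fun z => abs_log_norm_le _
  rw [setIntegral_ball_eq_integral_circleAverage hint]
  refine setIntegral_congr_fun measurableSet_Ioo fun r hr => ?_
  have hd : 0 < ‖c - ζ‖ := norm_pos_iff.2 (sub_ne_zero.2 hζ.symm)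
  rw [circleAverage_log_norm_sub_const_eq_log_radius_add_posLog hr.1.ne']
  congr 1
  rcases le_total r ‖c - ζ‖ with h | h
  · rw [max_eq_right h, Real.posLog_eq_log, Real.log_mul (by simpa using hr.1.ne') hd.ne', Real.log_inv]
    · ring
    · rw [abs_of_pos (mul_pos (inv_pos.2 hr.1) hd), ← div_eq_inv_mul, le_div_iff₀ hr.1]
      linarith
  · rw [max_eq_left h, (Real.posLog_eq_zero_iff _).2, add_zero]
    rw [abs_of_pos (mul_pos (inv_pos.2 hr.1) hd), ← div_eq_inv_mul, div_le_one hr.1]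
    exact h

/-- Replacing max(r, |c - ζ|) by |c - ζ| can only lower the integrand, and lowers it strictly for r
> |c - ζ|. The strict case is what detects mass inside the disc. -/
theorem log_norm_le_ball_mean {c ζ : ℂ} {R : ℝ} (hζ : ζ ≠ c) :
    (∫ r in Ioo 0 R, 2 * Real.pi * r) * Real.log ‖c - ζ‖ ≤
      ∫ z in Metric.ball c R, Real.log ‖z - ζ‖ ∧
    (‖c - ζ‖ < R → (∫ r in Ioo 0 R, 2 * Real.pi * r) * Real.log ‖c - ζ‖ <
      ∫ z in Metric.ball c R, Real.log ‖z - ζ‖) := by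
  have hd : 0 < ‖c - ζ‖ := norm_pos_iff.2 (sub_ne_zero.2 hζ.symm)
  rw [setIntegral_ball_log_norm_sub hζ, ← integral_mul_const]
  have hcont : Continuous fun r : ℝ => 2 * Real.pi * r * Real.log (max r ‖c - ζ‖) := by
    refine Continuous.mul (by fun_prop) (Continuous.log (by fun_prop) fun r => ?_)
    exact (lt_max_of_lt_right hd).ne'
  have hcont' : Continuous fun r : ℝ => 2 * Real.pi * r * Real.log ‖c - ζ‖ := by fun_prop
  have hle : ∀ r : ℝ, 0 < r → 2 * Real.pi * r * Real.log ‖c - ζ‖ ≤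
      2 * Real.pi * r * Real.log (max r ‖c - ζ‖) := by
    intro r hr
    have : 0 ≤ 2 * Real.pi * r := by positivity
    exact mul_le_mul_of_nonneg_left (Real.log_le_log hd (le_max_right _ _)) this
  refine ⟨?_, fun hR => ?_⟩
  · refine setIntegral_mono_on (hcont'.integrableOn_Icc.mono_set Ioo_subset_Icc_self)
      (hcont.integrableOn_Icc.mono_set Ioo_subset_Icc_self) measurableSet_Ioo fun r hr => hle r hr.1
  · have hR0 : 0 < R := hd.trans hR
    rw [← integral_Ioc_eq_integral_Ioo, ← integral_Ioc_eq_integral_Ioo,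
      ← intervalIntegral.integral_of_le hR0.le, ← intervalIntegral.integral_of_le hR0.le]
    refine intervalIntegral.integral_lt_integral_of_continuousOn_of_le_of_exists_lt hR0
      hcont'.continuousOn hcont.continuousOn (fun r hr => hle r hr.1) ⟨R, ⟨hR0.le, le_rfl⟩, ?_⟩
    rw [max_eq_left hR.le]
    exact mul_lt_mul_of_pos_left (Real.log_lt_log hd hR) (by positivity)

/-- Strong maximum principle: if `U - Re F` does not exceed its value at `c` on a disk
around `c`, then the disk carries no mass. -/
theorem measure_ball_eq_zero_of_logPotential_le {B : ℝ} (hB : ∀ᵐ ζ ∂μ, ‖ζ‖ ≤ B)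
    {c : ℂ} {R : ℝ} {F : ℂ → ℂ} (hF : DifferentiableOn ℂ F (Metric.closedBall c R))
    (hlog : Integrable (fun ζ => Real.log ‖c - ζ‖) μ) (hc : μ {c} = 0)
    (hle : ∀ᵐ z, z ∈ Metric.ball c R →
      logPotential μ z - (F z).re ≤ logPotential μ c - (F c).re) :
    μ (Metric.ball c R) = 0 := by
  have hint := integrable_prod_log_norm_sub hB c R
  set A := ∫ r in Ioo 0 R, 2 * Real.pi * r with hA
  have hne : ∀ᵐ ζ ∂μ, ζ ≠ c := measure_eq_zero_iff_ae_notMem.1 hc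
  obtain ⟨hFi, hFm⟩ := setIntegral_ball_re hF
  have hright : Integrable (fun ζ => ∫ z in Metric.ball c R, Real.log ‖z - ζ‖) μ :=
    hint.integral_prod_right
  have hUi : IntegrableOn (logPotential μ) (Metric.ball c R) := hint.integral_prod_left
  have hAvol : ∀ x : ℝ, ∫ _ in Metric.ball c R, x = A * x := by
    intro x
    have := (setIntegral_ball_re (c := c) (R := R) (F := fun _ => (x:ℂ))
      (differentiableOn_const _)).2
    simpa using this
  have h1 : ∫ z in Metric.ball c R, (logPotential μ z - (F z).re) ≤
      A * (logPotential μ c - (F c).re) := by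
    rw [← hAvol]
    refine setIntegral_mono_on_ae (hUi.sub hFi) ?_ measurableSet_ball hle
    exact integrableOn_const (measure_ball_lt_top (μ := (volume : Measure ℂ))).ne
  rw [integral_sub hUi hFi, hFm] at h1
  have h2 : ∫ z in Metric.ball c R, logPotential μ z =
      ∫ ζ, (∫ z in Metric.ball c R, Real.log ‖z - ζ‖) ∂μ := integral_integral_swap hint
  have h3 : Integrable (fun ζ => (∫ z in Metric.ball c R, Real.log ‖z - ζ‖) -
      A * Real.log ‖c - ζ‖) μ := hright.sub (hlog.const_mul A)
  -- Re F has the exact mean value property, so the hypothesis at c bounds the total defect of the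
  -- sub-mean-value inequality by 0. The defect is nonnegative, hence zero μ-almost everywhere,
  -- which the strict case forbids for ζ in the disc.
  have h4 : ∫ ζ, ((∫ z in Metric.ball c R, Real.log ‖z - ζ‖) - A * Real.log ‖c - ζ‖) ∂μ ≤ 0 := by
    rw [integral_sub hright (hlog.const_mul A), ← h2, integral_const_mul]
    have : logPotential μ c = ∫ ζ, Real.log ‖c - ζ‖ ∂μ := rfl
    rw [← this]
    linarith
  have hnn : 0 ≤ᵐ[μ] fun ζ => (∫ z in Metric.ball c R, Real.log ‖z - ζ‖) -
      A * Real.log ‖c - ζ‖ := by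
    filter_upwards [hne] with ζ hζ
    exact sub_nonneg.2 (log_norm_le_ball_mean hζ).1
  have h5 := (integral_eq_zero_iff_of_nonneg_ae hnn h3).1 (le_antisymm h4 (integral_nonneg_of_ae hnn))
  rw [measure_eq_zero_iff_ae_notMem]
  filter_upwards [h5, hne] with ζ h6 hζ hmem
  have := (log_norm_le_ball_mean (R := R) hζ).2 (by
    rwa [Metric.mem_ball, dist_comm, dist_eq_norm] at hmem)
  simp only [Pi.zero_apply] at h6
  linarith

theorem differentiableAt_cauchyTransform {z : ℂ} (hz : z ∉ μ.support) :
    DifferentiableAt ℂ (cauchyTransform μ) z := by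
  obtain ⟨δ, hδ, hball⟩ := Metric.isOpen_iff.1 Measure.isOpen_compl_support z hz
  have hae := ae_norm_sub_ge_of_ball_disjoint_support (μ := μ) (z := z) (δ := δ) fun x hx => hball hx
  have hge : ∀ᵐ ζ ∂μ, ∀ x ∈ Metric.ball z (δ / 2), δ / 2 ≤ ‖x - ζ‖ := by
    filter_upwards [hae] with ζ hζ x hx
    rw [Metric.mem_ball, dist_eq_norm] at hx
    have := norm_sub_le_norm_sub_add_norm_sub z x ζ
    rw [norm_sub_rev z x] at this
    linarith
  have hd : 0 < δ / 2 := by positivity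
  refine (hasDerivAt_integral_of_dominated_loc_of_deriv_le (μ := μ)
    (F := fun z ζ => 1 / (z - ζ)) (F' := fun z ζ => -1 / (z - ζ) ^ 2)
    (bound := fun _ => 1 / (δ / 2) ^ 2) (Metric.ball_mem_nhds z hd)
    (Eventually.of_forall fun x => Measurable.aestronglyMeasurable (by fun_prop)) ?_
    (Measurable.aestronglyMeasurable (by fun_prop)) ?_ (integrable_const _) ?_).2.differentiableAt
  · refine (integrable_const (1 / (δ / 2))).mono' (Measurable.aestronglyMeasurable (by fun_prop)) ?_
    filter_upwards [hge] with ζ hζ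
    rw [norm_div, norm_one]
    exact one_div_le_one_div_of_le hd (hζ z (Metric.mem_ball_self hd))
  · filter_upwards [hge] with ζ hζ x hx
    rw [norm_div, norm_neg, norm_one, norm_pow]
    exact one_div_le_one_div_of_le (by positivity) (pow_le_pow_left₀ hd.le (hζ x hx) 2)
  · filter_upwards [hge] with ζ hζ x hx
    have hne : x - ζ ≠ 0 := norm_pos_iff.1 (hd.trans_le (hζ x hx))
    have := ((hasDerivAt_id x).sub_const ζ).inv hne
    simpa only [one_div] using! this

theorem integrable_log_norm_sub_of_notMem_support {B : ℝ} (hB : ∀ᵐ ζ ∂μ, ‖ζ‖ ≤ B) {z : ℂ}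
    (hz : z ∉ μ.support) : Integrable (fun ζ => Real.log ‖z - ζ‖) μ := by
  obtain ⟨δ, hδ, hball⟩ := Metric.isOpen_iff.1 Measure.isOpen_compl_support z hz
  have hae := ae_norm_sub_ge_of_ball_disjoint_support (μ := μ) (z := z) (δ := δ) fun x hx => hball hx
  refine integrable_log_norm_sub hB ?_
  have : Integrable (fun ζ => 1 / (z - ζ)) μ := by
    refine (integrable_const (1 / δ)).mono' (Measurable.aestronglyMeasurable (by fun_prop)) ?_
    filter_upwards [hae] with ζ hζ
    rw [norm_div, norm_one]
    exact one_div_le_one_div_of_le hδ hζ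
  exact this.2

/-- Off the support the kernel is bounded along segments, so the integral formula for U holds for
every segment in the disc, not merely almost every one. -/
theorem logPotential_sub_re_eq {B : ℝ} (hB : ∀ᵐ ζ ∂μ, ‖ζ‖ ≤ B) {z₀ : ℂ} {δ : ℝ} {F : ℂ → ℂ}
    (hK : ∀ z ∈ Metric.ball z₀ δ, z ∉ μ.support)
    (hF : ∀ z ∈ Metric.ball z₀ δ, HasDerivAt F (cauchyTransform μ z) z) {z : ℂ}
    (hz : z ∈ Metric.ball z₀ δ) :
    logPotential μ z - (F z).re = logPotential μ z₀ - (F z₀).re := by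
  have hδ : 0 < δ := Metric.pos_of_mem_ball hz
  have hz₀ : z₀ ∈ Metric.ball z₀ δ := Metric.mem_ball_self hδ
  set v := z - z₀ with hv
  have hzv : z₀ + v = z := by simp [hv]
  have hvδ : ‖v‖ < δ := by rwa [Metric.mem_ball, dist_eq_norm] at hz
  have hmem : ∀ τ ∈ Icc (0:ℝ) 1, z₀ + τ * v ∈ Metric.ball z₀ δ := by
    intro τ hτ
    rw [Metric.mem_ball, dist_eq_norm, add_sub_cancel_left, norm_mul, Complex.norm_real,
      Real.norm_of_nonneg hτ.1]
    nlinarith [hτ.2, norm_nonneg v]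
  have hae := ae_norm_sub_ge_of_ball_disjoint_support (μ := μ) hK
  have hge : ∀ᵐ ζ ∂μ, ∀ τ ∈ Icc (0:ℝ) 1, δ - ‖v‖ ≤ ‖z₀ + τ * v - ζ‖ := by
    filter_upwards [hae] with ζ hζ τ hτ
    have h1 : ‖(τ:ℂ) * v‖ ≤ ‖v‖ := by
      rw [norm_mul, Complex.norm_real, Real.norm_of_nonneg hτ.1]
      nlinarith [hτ.2, norm_nonneg v]
    have h2 : z₀ - ζ = (z₀ + τ * v - ζ) - τ * v := by ring
    have h3 := norm_sub_le (z₀ + τ * v - ζ) (τ * v)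
    rw [← h2] at h3
    linarith
  have hfin : ∫⁻ τ in Ioc (0:ℝ) 1, ∫⁻ ζ, ‖1 / (z₀ + τ * v - ζ)‖ₑ ∂μ < ⊤ := by
    have : ∀ τ ∈ Ioc (0:ℝ) 1, ∫⁻ ζ, ‖1 / (z₀ + τ * v - ζ)‖ₑ ∂μ ≤
        ∫⁻ _, ENNReal.ofReal (1 / (δ - ‖v‖)) ∂μ := by
      intro τ hτ
      refine lintegral_mono_ae ?_
      filter_upwards [hge] with ζ hζ
      rw [← ofReal_norm, norm_div, norm_one]
      exact ENNReal.ofReal_le_ofReal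
        (one_div_le_one_div_of_le (by linarith) (hζ τ ⟨hτ.1.le, hτ.2⟩))
    refine (setLIntegral_mono' measurableSet_Ioc this).trans_lt ?_
    rw [setLIntegral_const, lintegral_const]
    exact ENNReal.mul_lt_top (ENNReal.mul_lt_top ENNReal.ofReal_lt_top (measure_lt_top _ _)) (by simp)
  have hseg : ∀ᵐ ζ ∂μ, ∀ τ ∈ Icc (0:ℝ) 1, z₀ + τ * v ≠ ζ := by
    filter_upwards [hge] with ζ hζ τ hτ heq
    have := hζ τ hτ
    rw [heq, sub_self, norm_zero] at this
    linarith
  obtain ⟨hI, hU⟩ := logPotential_add_sub hfin hseg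
    (integrable_log_norm_sub_of_notMem_support hB (hK _ hz₀))
    (by rw [hzv]; exact integrable_log_norm_sub_of_notMem_support hB (hK _ hz))
  have hFd : ∀ τ ∈ uIcc (0:ℝ) 1, HasDerivAt (fun τ : ℝ => (F (z₀ + τ * v)).re)
      (cauchyTransform μ (z₀ + τ * v) * v).re τ := by
    intro τ hτ
    rw [uIcc_of_le zero_le_one] at hτ
    have h1 : HasDerivAt (fun τ : ℝ => z₀ + τ * v) v τ := by
      have := ((Complex.ofRealCLM.hasDerivAt (x := τ)).mul_const v).const_add z₀
      simpa using this
    have h2 := (hF _ (hmem τ hτ)).comp τ h1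
    exact Complex.reCLM.hasFDerivAt.comp_hasDerivAt τ h2
  rw [intervalIntegral.integral_eq_sub_of_hasDerivAt hFd hI, hzv] at hU
  simp only [Complex.ofReal_one, one_mul, Complex.ofReal_zero, zero_mul, add_zero, hzv] at hU
  linarith

end Potential

/-! ### Propagation of a branch in dominated directions -/

section Potential

variable {μ : Measure ℂ} [IsFiniteMeasure μ]

/-- At almost every point of the segment μ̂ is some α_l, and Re(α_l e) ≤ Re(α_m e); integrating, U
increases by no more than Re F does. -/
theorem ae_logPotential_sub_re_le {ι : Type*} {B : ℝ} (hB : ∀ᵐ ζ ∂μ, ‖ζ‖ ≤ B)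
    (h0 : volume μ.support = 0) {a : ℂ} {R : ℝ} {α : ι → ℂ → ℂ} {m : ι} {F : ℂ → ℂ}
    (hαm : ContinuousOn (α m) (Metric.ball a R))
    (hF : ∀ z ∈ Metric.ball a R, HasDerivAt F (α m z) z)
    (hroot : ∀ z ∈ Metric.ball a R, z ∉ μ.support → ∃ l, cauchyTransform μ z = α l z)
    {e : ℂ} (hdir : ∀ z ∈ Metric.ball a R, ∀ l, 0 ≤ ((α m z - α l z) * e).re) {t : ℝ} (ht : 0 ≤ t) :
    ∀ᵐ z : ℂ, z ∈ Metric.ball a R → z + t * e ∈ Metric.ball a R →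
      logPotential μ (z + t * e) - (F (z + t * e)).re ≤ logPotential μ z - (F z).re := by
  filter_upwards [ae_logPotential_add_sub hB (t * e),
    ae_ae_segment_notMem Measure.isClosed_support h0 (t * e)] with z ⟨hI, hU⟩ hK hz hz'
  have hmem : ∀ τ ∈ Icc (0:ℝ) 1, z + τ * (t * e) ∈ Metric.ball a R := by
    intro τ hτ
    have := (convex_ball a R).add_smul_mem hz (y := t * e) hz' hτ
    simpa using this
  have hFd : ∀ τ ∈ uIcc (0:ℝ) 1, HasDerivAt (fun τ : ℝ => (F (z + τ * (t * e))).re)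
      (α m (z + τ * (t * e)) * (t * e)).re τ := by
    intro τ hτ
    rw [uIcc_of_le zero_le_one] at hτ
    have h1 : HasDerivAt (fun τ : ℝ => z + τ * (t * e)) (t * e) τ := by
      have := ((Complex.ofRealCLM.hasDerivAt (x := τ)).mul_const (t * e)).const_add z
      simpa using this
    have h2 := (hF _ (hmem τ hτ)).comp τ h1
    exact Complex.reCLM.hasFDerivAt.comp_hasDerivAt τ h2
  have hcont : ContinuousOn (fun τ : ℝ => (α m (z + τ * (t * e)) * (t * e)).re) (uIcc 0 1) := by
    rw [uIcc_of_le zero_le_one]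
    refine Complex.continuous_re.comp_continuousOn (ContinuousOn.mul ?_ continuousOn_const)
    exact hαm.comp (by fun_prop) fun τ hτ => hmem τ hτ
  have h1 := intervalIntegral.integral_eq_sub_of_hasDerivAt hFd hcont.intervalIntegrable
  have h2 : ∫ τ in (0:ℝ)..1, (cauchyTransform μ (z + τ * (t * e)) * (t * e)).re ≤
      ∫ τ in (0:ℝ)..1, (α m (z + τ * (t * e)) * (t * e)).re := by
    refine intervalIntegral.integral_mono_ae_restrict zero_le_one hI hcont.intervalIntegrable ?_
    rw [← restrict_Ioc_eq_restrict_Icc]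
    filter_upwards [hK, ae_restrict_mem measurableSet_Ioc] with τ hτ hτm
    obtain ⟨l, hl⟩ := hroot _ (hmem τ ⟨hτm.1.le, hτm.2⟩) hτ
    have h3 := hdir _ (hmem τ ⟨hτm.1.le, hτm.2⟩) l
    rw [hl]
    have h4 : ((α m (z + τ * (t * e)) * (t * e))).re - (α l (z + τ * (t * e)) * (t * e)).re =
        t * ((α m (z + τ * (t * e)) - α l (z + τ * (t * e))) * e).re := by
      rw [← Complex.sub_re, ← Complex.re_ofReal_mul]; congr 1; ring
    nlinarith [mul_nonneg ht h3]
  rw [← hU, h1] at h2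
  simp only [Complex.ofReal_one, one_mul, Complex.ofReal_zero, zero_mul, add_zero] at h2
  linarith

/-- The disc is moved by steps shorter than its radius, so that each new centre lies in the old
disc, where U - Re F is constant. Every point of the new disc is a translate along e of a point of
the old one, so that constant is an upper bound; it is attained at the new centre, and the maximum
principle removes the mass. The identity theorem then carries the branch over. -/
theorem propagate_ball {ι : Type*} {B : ℝ} (hB : ∀ᵐ ζ ∂μ, ‖ζ‖ ≤ B)
    (h0 : volume μ.support = 0) {a : ℂ} {R : ℝ} {α : ι → ℂ → ℂ} {m : ι}
    (hαm : DifferentiableOn ℂ (α m) (Metric.ball a R))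
    (hroot : ∀ z ∈ Metric.ball a R, z ∉ μ.support → ∃ l, cauchyTransform μ z = α l z)
    {e : ℂ} (hdir : ∀ z ∈ Metric.ball a R, ∀ l, 0 ≤ ((α m z - α l z) * e).re)
    {z₀ : ℂ} {δ : ℝ} (hδ : 0 < δ)
    (hstart : ∀ z ∈ Metric.ball z₀ δ, z ∉ μ.support ∧ cauchyTransform μ z = α m z)
    (hsub₀ : Metric.ball z₀ δ ⊆ Metric.ball a R) (hsub₁ : Metric.ball (z₀ + e) δ ⊆ Metric.ball a R) :
    ∀ z ∈ Metric.ball (z₀ + e) δ, z ∉ μ.support ∧ cauchyTransform μ z = α m z := by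
  obtain ⟨F, hF⟩ := hαm.isExactOn_ball
  have hsub : ∀ t ∈ Icc (0:ℝ) 1, Metric.ball (z₀ + t * e) δ ⊆ Metric.ball a R := by
    intro t ht z hz
    have h1 : z - t * e ∈ Metric.ball z₀ δ := by
      rw [Metric.mem_ball, dist_eq_norm] at hz ⊢; convert hz using 2; ring
    have h2 : z - t * e + e ∈ Metric.ball (z₀ + e) δ := by
      rw [Metric.mem_ball, dist_eq_norm] at h1 ⊢; convert h1 using 2; ring
    have := (convex_ball a R).add_smul_mem (hsub₀ h1) (hsub₁ h2) ht
    simpa using this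
  have step : ∀ t h : ℝ, 0 ≤ t → 0 ≤ h → t + h ≤ 1 → h * ‖e‖ < δ →
      (∀ z ∈ Metric.ball (z₀ + t * e) δ, z ∉ μ.support ∧ cauchyTransform μ z = α m z) →
      ∀ z ∈ Metric.ball (z₀ + (t + h : ℝ) * e) δ, z ∉ μ.support ∧ cauchyTransform μ z = α m z := by
    intro t h ht hh hth hhe hQ
    set c := z₀ + (t + h : ℝ) * e with hc
    have hcb : c ∈ Metric.ball (z₀ + t * e) δ := by
      rw [Metric.mem_ball, dist_eq_norm]
      have : c - (z₀ + t * e) = (h:ℂ) * e := by rw [hc]; push_cast; ring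
      rwa [this, norm_mul, Complex.norm_real, Real.norm_of_nonneg hh]
    have hFt : ∀ z ∈ Metric.ball (z₀ + t * e) δ, HasDerivAt F (cauchyTransform μ z) z := by
      intro z hz
      rw [(hQ z hz).2]
      exact hF z (hsub t ⟨ht, by linarith⟩ hz)
    have hconst : ∀ z ∈ Metric.ball (z₀ + t * e) δ,
        logPotential μ z - (F z).re = logPotential μ c - (F c).re := by
      intro z hz
      rw [logPotential_sub_re_eq hB (fun z hz => (hQ z hz).1) hFt hz,
        logPotential_sub_re_eq hB (fun z hz => (hQ z hz).1) hFt hcb]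
    have hsubc : Metric.ball c δ ⊆ Metric.ball a R := hsub (t + h) ⟨by linarith, hth⟩
    have hle : ∀ᵐ z, z ∈ Metric.ball c δ →
        logPotential μ z - (F z).re ≤ logPotential μ c - (F c).re := by
      have h1 := ae_logPotential_sub_re_le hB h0 hαm.continuousOn hF hroot hdir hh
      have h2 := (quasiMeasurePreserving_add_right (volume : Measure ℂ) (-((h:ℂ) * e))).ae h1
      filter_upwards [h2] with z hz hzc
      have hz1 : z + -((h:ℂ) * e) ∈ Metric.ball (z₀ + t * e) δ := by
        rw [Metric.mem_ball, dist_eq_norm] at hzc ⊢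
        convert hzc using 2; rw [hc]; push_cast; ring
      rw [← hconst _ hz1]
      have hz2 : z + -((h:ℂ) * e) + (h:ℂ) * e = z := by ring
      rw [hz2] at hz
      exact hz (hsub t ⟨ht, by linarith⟩ hz1) (hsubc hzc)
    have hoff : ∀ z ∈ Metric.ball c δ, z ∉ μ.support := by
      intro z hz
      -- The maximum principle needs F on a closed disc, so the radius is shrunk slightly around the
      -- given point.
      obtain ⟨δ', hδ'1, hδ'2⟩ := exists_between (Metric.mem_ball.1 hz)
      have hcs : μ {c} = 0 := by
        obtain ⟨U, hU, hU0⟩ := Measure.notMem_support_iff_exists.1 (hQ c hcb).1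
        exact measure_mono_null (singleton_subset_iff.2 (mem_of_mem_nhds hU)) hU0
      refine notMem_support_of_measure_ball (c := c) (R := δ') ?_ hδ'1
      refine measure_ball_eq_zero_of_logPotential_le hB (F := F) ?_
        (integrable_log_norm_sub_of_notMem_support hB (hQ c hcb).1) hcs ?_
      · intro x hx
        exact (hF x (hsubc (Metric.closedBall_subset_ball hδ'2 hx))).differentiableAt.differentiableWithinAt
      · filter_upwards [hle] with x hx hxm
        exact hx (Metric.ball_subset_ball hδ'2.le hxm)
    refine fun z hz => ⟨hoff z hz, ?_⟩
    have hA1 : AnalyticOnNhd ℂ (cauchyTransform μ) (Metric.ball c δ) :=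
      DifferentiableOn.analyticOnNhd (fun x hx =>
        (differentiableAt_cauchyTransform (hoff x hx)).differentiableWithinAt) Metric.isOpen_ball
    have hA2 : AnalyticOnNhd ℂ (α m) (Metric.ball c δ) :=
      (hαm.mono hsubc).analyticOnNhd Metric.isOpen_ball
    refine hA1.eqOn_of_preconnected_of_eventuallyEq hA2 (convex_ball c δ).isPreconnected
      (Metric.mem_ball_self hδ) ?_ hz
    filter_upwards [Metric.isOpen_ball.mem_nhds hcb] with x hx
    exact (hQ x hx).2
  obtain ⟨n, hn⟩ := exists_nat_gt (‖e‖ / δ)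
  have hn0 : (0:ℝ) < n := lt_of_le_of_lt (by positivity) hn
  have hne : 1 / (n:ℝ) * ‖e‖ < δ := by
    rw [div_lt_iff₀ hδ] at hn
    rw [one_div, ← div_eq_inv_mul, div_lt_iff₀ hn0]; linarith
  have key : ∀ k : ℕ, k ≤ n → ∀ z ∈ Metric.ball (z₀ + ((k / n : ℝ) : ℂ) * e) δ,
      z ∉ μ.support ∧ cauchyTransform μ z = α m z := by
    intro k
    induction k with
    | zero => intro _; simpa using hstart
    | succ k ih =>
      intro hk
      have hkn : ((k:ℝ) + 1) / n ≤ 1 := by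
        rw [div_le_one hn0]; exact_mod_cast hk
      have := step (k / n) (1 / n) (by positivity) (by positivity) (by rw [← add_div]; exact hkn) hne
        (ih (by omega))
      rw [← add_div] at this
      push_cast at this ⊢
      exact this
  have := key n le_rfl
  rw [div_self hn0.ne'] at this
  simpa using this

/-- Near `s`, the image under `Φ` avoids the support and the Cauchy transform is given by `f`. -/
def OnBranch (μ : Measure ℂ) (Φ f : ℂ → ℂ) (s : ℂ) : Prop :=
  ∀ᶠ s' in 𝓝 s, Φ s' ∉ μ.support ∧ cauchyTransform μ (Φ s') = f s'

/-- Near s₀ the chart is inverted and the curve is replaced by the chord from an earlier point z' to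
Φ s₀. Its direction is close to the tangent, so the strict dominance at s₀ persists along the chord,
and `propagate_ball` applies in the z-plane. -/
theorem onBranch_of_left {ι : Type*} [Finite ι] {B : ℝ} (hB : ∀ᵐ ζ ∂μ, ‖ζ‖ ≤ B)
    (h0 : volume μ.support = 0) {G : Set ℂ} (hG : IsOpen G) {Φ Φ' : ℂ → ℂ}
    (hΦ : ∀ s ∈ G, HasStrictDerivAt Φ (Φ' s) s)
    (hΦ0 : ∀ s ∈ G, Φ' s ≠ 0) {g : ι → ℂ → ℂ} (hg : ∀ l, DifferentiableOn ℂ (g l) G)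
    (hroot : ∀ s ∈ G, Φ s ∉ μ.support → ∃ l, cauchyTransform μ (Φ s) = g l s)
    {m : ι} {t : ℝ} {γ : ℝ → ℂ} {γ' : ℂ} (hγ : HasDerivAt γ γ' t) (hγG : γ t ∈ G)
    (hdir : ∀ l, l ≠ m → 0 < ((g m (γ t) - g l (γ t)) * (Φ' (γ t) * γ')).re)
    (hleft : ∀ᶠ t' in 𝓝[<] t, OnBranch μ Φ (g m) (γ t')) : OnBranch μ Φ (g m) (γ t) := by
  set s₀ := γ t with hs₀
  set φ := ((hΦ s₀ hγG).hasStrictFDerivAt_equiv (hΦ0 s₀ hγG)).toOpenPartialHomeomorph Φ with hφ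
  have hφc : ∀ s, φ s = Φ s := fun s => rfl
  have hs₀φ : s₀ ∈ φ.source :=
    ((hΦ s₀ hγG).hasStrictFDerivAt_equiv (hΦ0 s₀ hγG)).mem_toOpenPartialHomeomorph_source
  have hinv₀ : φ.symm (Φ s₀) = s₀ := φ.left_inv hs₀φ
  set T := φ.target ∩ φ.symm ⁻¹' G with hT
  have hTo : IsOpen T := φ.isOpen_inter_preimage_symm hG
  have hzT : Φ s₀ ∈ T := ⟨φ.map_source hs₀φ, by simpa [hinv₀] using hγG⟩
  have hright : ∀ z ∈ T, Φ (φ.symm z) = z := fun z hz => φ.right_inv hz.1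
  have hα : ∀ l, DifferentiableOn ℂ (fun z => g l (φ.symm z)) T := by
    intro l z hz
    have h1 : HasDerivAt φ.symm (Φ' (φ.symm z))⁻¹ z :=
      φ.hasDerivAt_symm hz.1 (hΦ0 _ hz.2) (hΦ _ hz.2).hasDerivAt
    exact (((hg l).differentiableAt (hG.mem_nhds hz.2)).comp z
      h1.differentiableAt).differentiableWithinAt
  have hαc : ∀ l, ContinuousAt (fun z => g l (φ.symm z)) (Φ s₀) := fun l =>
    ((hα l).differentiableAt (hTo.mem_nhds hzT)).continuousAt
  set e₀ := Φ' s₀ * γ' with he₀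
  have hev : ∀ᶠ p : ℂ × ℂ in 𝓝 (Φ s₀) ×ˢ 𝓝 e₀, ∀ l, l ≠ m →
      0 < ((g m (φ.symm p.1) - g l (φ.symm p.1)) * p.2).re := by
    rw [eventually_all]
    intro l
    by_cases hl : l = m
    · exact Eventually.of_forall fun _ h => absurd hl h
    have h1 : Tendsto (fun p : ℂ × ℂ => ((g m (φ.symm p.1) - g l (φ.symm p.1)) * p.2).re)
        (𝓝 (Φ s₀) ×ˢ 𝓝 e₀) (𝓝 ((g m (φ.symm (Φ s₀)) - g l (φ.symm (Φ s₀))) * e₀).re) := by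
      refine (Complex.continuous_re.tendsto _).comp (Tendsto.mul (Tendsto.sub ?_ ?_) tendsto_snd)
      · exact (hαc m).tendsto.comp tendsto_fst
      · exact (hαc l).tendsto.comp tendsto_fst
    rw [hinv₀] at h1
    filter_upwards [h1.eventually_const_lt (hdir l hl)] with p hp _ using hp
  obtain ⟨p₁, hp₁, p₂, hp₂, hp⟩ := eventually_prod_iff.1 hev
  obtain ⟨R, hR, hball⟩ := Metric.mem_nhds_iff.1 (inter_mem (hTo.mem_nhds hzT) hp₁)
  have hderiv : HasDerivAt (fun t => Φ (γ t)) e₀ t := (hΦ s₀ hγG).hasDerivAt.comp t hγ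
  have hslope := (hasDerivAt_iff_tendsto_slope_left_right.1 hderiv).1
  have hcontl : Tendsto (fun t => Φ (γ t)) (𝓝[<] t) (𝓝 (Φ s₀)) :=
    hderiv.continuousAt.tendsto.mono_left nhdsWithin_le_nhds
  have hγl : Tendsto γ (𝓝[<] t) (𝓝 s₀) := hγ.continuousAt.tendsto.mono_left nhdsWithin_le_nhds
  obtain ⟨t', ht'1, ht'2, ht'3, ht'4, ht'5⟩ := (hleft.and ((hslope.eventually hp₂).and
    ((hcontl.eventually (Metric.ball_mem_nhds _ (half_pos hR))).and
    ((hγl.eventually (φ.open_source.mem_nhds hs₀φ)).and self_mem_nhdsWithin)))).exists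
  set z' := Φ (γ t') with hz'
  have hinv' : φ.symm z' = γ t' := φ.left_inv ht'4
  have hsymm : Tendsto φ.symm (𝓝 z') (𝓝 (γ t')) := by
    rw [← hinv']
    exact φ.continuousAt_symm (φ.map_source ht'4)
  have hz'T : z' ∈ Metric.ball (Φ s₀) R := Metric.ball_subset_ball (by linarith) ht'3
  obtain ⟨δ₁, hδ₁, hb₁⟩ := Metric.eventually_nhds_iff_ball.1
    ((hsymm.eventually ht'1).and (hTo.mem_nhds (hball hz'T).1))
  -- As z' is within R/2 of Φ s₀, a radius at most R/2 keeps both the initial and the final disc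
  -- inside the disc of radius R.
  set δ := min δ₁ (R / 2) with hδ
  have hδ0 : 0 < δ := lt_min hδ₁ (half_pos hR)
  have hz'e : z' + (Φ s₀ - z') = Φ s₀ := by ring
  have hfin := propagate_ball (α := fun l z => g l (φ.symm z)) (m := m) (e := Φ s₀ - z')
    (a := Φ s₀) (R := R) (z₀ := z') (δ := δ) hB h0
    ((hα m).mono fun z hz => (hball hz).1) ?_ ?_ hδ0 ?_ ?_ ?_
  · rw [hz'e] at hfin
    have hcs : Tendsto Φ (𝓝 s₀) (𝓝 (Φ s₀)) := (hΦ s₀ hγG).hasDerivAt.continuousAt.tendsto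
    filter_upwards [hcs.eventually (Metric.ball_mem_nhds _ hδ0), φ.open_source.mem_nhds hs₀φ]
      with s hs1 hs2
    refine ⟨(hfin _ hs1).1, ?_⟩
    rw [(hfin _ hs1).2]
    exact congrArg (g m) (φ.left_inv hs2)
  · intro z hz hzK
    have h1 := hright z (hball hz).1
    obtain ⟨l, hl⟩ := hroot (φ.symm z) (hball hz).1.2 (by rwa [h1])
    exact ⟨l, by rw [h1] at hl; exact hl⟩
  · intro z hz l
    by_cases hl : l = m
    · simp [hl]
    have h1 := hp (hball hz).2 ht'2 l hl
    rw [slope_def_module] at h1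
    have h2 : t' - t < 0 := sub_neg.2 ht'5
    have h3 : (Φ s₀ - z') = ((-(t' - t) : ℝ) : ℂ) * ((t' - t)⁻¹ • (Φ (γ t') - Φ (γ t))) := by
      rw [Complex.real_smul, ← mul_assoc, ← Complex.ofReal_mul, neg_mul, mul_inv_cancel₀ h2.ne]
      push_cast; ring
    rw [h3, mul_left_comm, Complex.re_ofReal_mul]
    exact (mul_pos (by linarith) h1).le
  · intro z hz
    have h1 := hb₁ z (Metric.ball_subset_ball (min_le_left _ _) hz)
    have h2 := h1.1
    rw [hright z h1.2] at h2
    exact h2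
  · intro z hz
    have h1 := Metric.ball_subset_ball (min_le_right δ₁ (R / 2)) hz
    rw [Metric.mem_ball] at h1 ⊢
    have h3 : dist z' (Φ s₀) < R / 2 := ht'3
    linarith [dist_triangle z z' (Φ s₀)]
  · rw [hz'e]
    exact Metric.ball_subset_ball ((min_le_right _ _).trans (by linarith))

/-- Continuous induction on the time up to which the branch persists: the set of such times is
closed by `onBranch_of_left`, and open to the right because `OnBranch` is an open condition. -/
theorem propagate_path {ι : Type*} [Finite ι] {B : ℝ} (hB : ∀ᵐ ζ ∂μ, ‖ζ‖ ≤ B)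
    (h0 : volume μ.support = 0) {G : Set ℂ} (hG : IsOpen G) {Φ Φ' : ℂ → ℂ}
    (hΦ : ∀ s ∈ G, HasStrictDerivAt Φ (Φ' s) s)
    (hΦ0 : ∀ s ∈ G, Φ' s ≠ 0) {g : ι → ℂ → ℂ} (hg : ∀ l, DifferentiableOn ℂ (g l) G)
    (hroot : ∀ s ∈ G, Φ s ∉ μ.support → ∃ l, cauchyTransform μ (Φ s) = g l s)
    {m : ι} {a b : ℝ} (hab : a ≤ b) {γ γ' : ℝ → ℂ} (hγ : ∀ t ∈ Icc a b, HasDerivAt γ (γ' t) t)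
    (hγG : ∀ t ∈ Icc a b, γ t ∈ G)
    (hdir : ∀ t ∈ Icc a b, ∀ l, l ≠ m → 0 < ((g m (γ t) - g l (γ t)) * (Φ' (γ t) * γ' t)).re)
    (hstart : OnBranch μ Φ (g m) (γ a)) : OnBranch μ Φ (g m) (γ b) := by
  set S := {t : ℝ | ∀ t' ∈ Icc a t, OnBranch μ Φ (g m) (γ t')} with hS
  have hcl : IsClosed (S ∩ Icc a b) := by
    refine isClosed_of_closure_subset fun t ht => ?_
    have htI : t ∈ Icc a b := (closure_minimal inter_subset_right isClosed_Icc) ht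
    have hlt : ∀ t', a ≤ t' → t' < t → OnBranch μ Φ (g m) (γ t') := by
      intro t' h1 h2
      obtain ⟨x, hx1, hx2⟩ := mem_closure_iff.1 ht (Ioi t') isOpen_Ioi h2
      exact hx2.1 t' ⟨h1, le_of_lt hx1⟩
    refine ⟨fun t' ht' => ?_, htI⟩
    rcases ht'.2.lt_or_eq with h | rfl
    · exact hlt t' ht'.1 h
    rcases htI.1.lt_or_eq with h | rfl
    · refine onBranch_of_left hB h0 hG hΦ hΦ0 hg hroot (hγ t' htI) (hγG t' htI) (hdir t' htI) ?_
      filter_upwards [Ioo_mem_nhdsLT h] with x hx using hlt x hx.1.le hx.2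
    · exact hstart
  refine hcl.Icc_subset_of_forall_mem_nhdsWithin ?_ ?_ (right_mem_Icc.2 hab) b (right_mem_Icc.2 hab)
  · intro t' ht'
    rw [Icc_self, mem_singleton_iff] at ht'
    rwa [ht']
  · rintro x ⟨hx, hxI⟩
    have h1 : ∀ᶠ t in 𝓝 x, OnBranch μ Φ (g m) (γ t) :=
      (hγ x ⟨hxI.1, hxI.2.le⟩).continuousAt.eventually
        (eventually_eventually_nhds.2 (hx x (right_mem_Icc.2 hxI.1)))
    obtain ⟨ε, hε, hball⟩ := Metric.eventually_nhds_iff_ball.1 h1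
    filter_upwards [Ioo_mem_nhdsGT (show x < x + ε by linarith)] with y hy t' ht'
    by_cases h : t' ≤ x
    · exact hx t' ⟨ht'.1, h⟩
    · refine hball t' ?_
      rw [Metric.mem_ball, Real.dist_eq, abs_of_pos (by linarith [not_le.1 h])]
      linarith [ht'.2, hy.2]

end Potential

/-! ### Implicit functions and simple roots of bivariate polynomials -/

-- Stated over both scalar fields: the complex case gives local algebraic branches, the real case
-- the level arcs in polar coordinates.
open scoped ContDiff in
theorem exists_implicitFunction_of_hasDerivAt_ne_zero {𝕜 : Type*} [RCLike 𝕜] {f : 𝕜 × 𝕜 → 𝕜}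
    {x₀ y₀ d : 𝕜} (hf : ContDiffAt 𝕜 ω f (x₀, y₀)) (h0 : f (x₀, y₀) = 0)
    (hd : HasDerivAt (fun y => f (x₀, y)) d y₀) (hd0 : d ≠ 0) :
    ∃ φ : 𝕜 → 𝕜, ContDiffAt 𝕜 ω φ x₀ ∧ φ x₀ = y₀ ∧
      ∀ᶠ v in 𝓝 (x₀, y₀), f v = 0 ↔ φ v.1 = v.2 := by
  have h1 : HasFDerivAt f (fderiv 𝕜 f (x₀, y₀)) (x₀, y₀) :=
    (hf.differentiableAt (by simp)).hasFDerivAt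
  have h2 : HasDerivAt (fun y => f (x₀, y)) ((fderiv 𝕜 f (x₀, y₀)) (0, 1)) y₀ :=
    h1.comp_hasDerivAt y₀ ((hasDerivAt_const y₀ x₀).prodMk (hasDerivAt_id y₀))
  have h3 : (fderiv 𝕜 f (x₀, y₀)) (0, 1) = d := h2.unique hd
  have hinv : (fderiv 𝕜 f (x₀, y₀) ∘L .inr 𝕜 𝕜 𝕜).IsInvertible := by
    refine ⟨ContinuousLinearEquiv.unitsEquivAut 𝕜 (Units.mk0 d hd0), ?_⟩
    ext
    simp [h3]
  refine ⟨hf.implicitFunction (by simp) hinv, hf.contDiffAt_implicitFunction (by simp) hinv,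
    hf.implicitFunction_apply_self (by simp) hinv, ?_⟩
  filter_upwards [hf.eventually_apply_eq_iff_implicitFunction (by simp) hinv] with v hv
  rw [← hv, h0]

section Puiseux

open Polynomial
open scoped Polynomial.Bivariate

/-- Clearing denominators moves identities from ℂ(z)[w] back to ℂ[z][w]. -/
theorem exists_smul_map_eq (F : (FractionRing ℂ[X])[X]) :
    ∃ (b : ℂ[X]) (F' : ℂ[X][X]), b ≠ 0 ∧
      F'.map (algebraMap ℂ[X] (FractionRing ℂ[X])) = C (algebraMap _ _ b) * F := by
  obtain ⟨b, hb, h⟩ := IsLocalization.integerNormalization_spec (nonZeroDivisors ℂ[X]) F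
  refine ⟨b, IsLocalization.integerNormalization (nonZeroDivisors ℂ[X]) F,
    nonZeroDivisors.ne_zero hb, ?_⟩
  ext i
  rw [h, coeff_C_mul, coeff_smul, Algebra.smul_def]

theorem map_algebraMap_fractionRing_injective :
    Function.Injective (Polynomial.map (algebraMap ℂ[X] (FractionRing ℂ[X]))) :=
  map_injective _ (IsFractionRing.injective _ _)

/-- Outside the zeros of some nonzero `D`, the roots of a bivariate polynomial are among the
roots, all simple, of a polynomial whose leading coefficient does not vanish. -/
theorem exists_separable_polynomial {P : ℂ[X][X]} (hP : P ≠ 0) :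
    ∃ (Q : ℂ[X][X]) (D : ℂ[X]), D ≠ 0 ∧ ∀ z, D.eval z ≠ 0 → Q.leadingCoeff.eval z ≠ 0 ∧
      (∀ w, Q.evalEval z w = 0 → Q.derivative.evalEval z w ≠ 0) ∧
      (∀ w, P.evalEval z w = 0 → Q.evalEval z w = 0) := by
  let ι := algebraMap ℂ[X] (FractionRing ℂ[X])
  have hinj : Function.Injective ι := IsFractionRing.injective _ _
  have hPK : P.map ι ≠ 0 := by
    rwa [Ne, ← Polynomial.map_zero ι, map_algebraMap_fractionRing_injective.eq_iff]
  -- In characteristic zero the squarefree part is separable, so S satisfies a Bézout identity with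
  -- its derivative, while P divides a power of it.
  set S := UniqueFactorizationMonoid.radical (P.map ι) with hS
  have hS0 : S ≠ 0 := UniqueFactorizationMonoid.radical_ne_zero
  have hsep : S.Separable :=
    PerfectField.separable_iff_squarefree.2 UniqueFactorizationMonoid.squarefree_radical
  obtain ⟨n, T, hT⟩ := UniqueFactorizationMonoid.exists_dvd_radical_self_pow hPK
  obtain ⟨A, B, hAB⟩ := hsep
  obtain ⟨b, Q, hb, hQ⟩ := exists_smul_map_eq S
  obtain ⟨c₁, A', hc₁, hA'⟩ := exists_smul_map_eq A
  obtain ⟨c₂, B', hc₂, hB'⟩ := exists_smul_map_eq B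
  obtain ⟨c₃, T', hc₃, hT'⟩ := exists_smul_map_eq T
  have hQ0 : Q ≠ 0 := by
    rintro rfl
    rw [Polynomial.map_zero] at hQ
    refine mul_ne_zero ?_ hS0 hQ.symm
    rw [Ne, C_eq_zero]
    exact fun h => hb (hinj (by rw [h, map_zero]))
  have hQ' : Q.derivative.map (algebraMap ℂ[X] (FractionRing ℂ[X])) =
      C (algebraMap ℂ[X] (FractionRing ℂ[X]) b) * derivative S := by
    rw [← derivative_map, hQ, derivative_C_mul]
  -- The Bézout identity without denominators: Q and its derivative have no common zero over z
  -- unless the left side vanishes at z.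
  have key1 : C (c₁ * c₂ * b) = C c₂ * A' * Q + C c₁ * B' * Q.derivative := by
    apply map_algebraMap_fractionRing_injective
    simp only [Polynomial.map_add, Polynomial.map_mul, map_C, hA', hB', hQ, hQ', map_mul]
    linear_combination (-(C (algebraMap ℂ[X] (FractionRing ℂ[X]) c₁) *
      C (algebraMap ℂ[X] (FractionRing ℂ[X]) c₂) *
      C (algebraMap ℂ[X] (FractionRing ℂ[X]) b))) * hAB
  -- Divisibility of a power of S by P, without denominators: roots of P are roots of Q wherever c₃
  -- is nonzero.
  have key2 : C c₃ * Q ^ n = C (b ^ n) * P * T' := by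
    apply map_algebraMap_fractionRing_injective
    simp only [Polynomial.map_mul, Polynomial.map_pow, map_C, hT', hQ, map_pow, mul_pow]
    rw [← hS] at hT
    rw [hT]; ring
  refine ⟨Q, Q.leadingCoeff * (c₁ * c₂ * b) * c₃, ?_, fun z hz => ?_⟩
  · exact mul_ne_zero (mul_ne_zero (by simpa using hQ0) (mul_ne_zero (mul_ne_zero hc₁ hc₂) hb)) hc₃
  · rw [eval_mul, eval_mul] at hz
    have hz3 := right_ne_zero_of_mul hz
    have hz2 := right_ne_zero_of_mul (left_ne_zero_of_mul hz)
    refine ⟨left_ne_zero_of_mul (left_ne_zero_of_mul hz), fun w hw hw' => ?_, fun w hw => ?_⟩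
    · have := congrArg (evalEval z w) key1
      rw [evalEval_C, evalEval_add, evalEval_mul, evalEval_mul _ _ (C c₁ * B'), hw, hw'] at this
      exact hz2 (by simpa using this)
    · have := congrArg (evalEval z w) key2
      rw [evalEval_mul, evalEval_C, evalEval_pow, evalEval_mul, evalEval_mul, hw] at this
      simp only [mul_zero, zero_mul] at this
      exact eq_zero_of_pow_eq_zero ((mul_eq_zero.1 this).resolve_left hz3)

open scoped ContDiff in
theorem contDiff_evalEval (Q : ℂ[X][X]) :
    ContDiff ℂ ω (fun v : ℂ × ℂ => Q.evalEval v.1 v.2) := by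
  induction Q using Polynomial.induction_on' with
  | add p q hp hq => simpa only [evalEval_add] using hp.add hq
  | monomial n a =>
    have : (fun v : ℂ × ℂ => (monomial n a).evalEval v.1 v.2) =
        fun v : ℂ × ℂ => a.eval v.1 * v.2 ^ n := by
      ext v; simp [evalEval, eval_monomial]
    rw [this]
    refine ContDiff.mul ?_ (by fun_prop)
    have : ContDiff ℂ ω (fun z : ℂ => a.eval z) := by
      simpa using a.contDiff_aeval (𝕜 := ℂ) ω
    exact this.comp contDiff_fst

theorem hasDerivAt_evalEval (Q : ℂ[X][X]) (z w : ℂ) :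
    HasDerivAt (fun w => Q.evalEval z w) (Q.derivative.evalEval z w) w := by
  have h : ∀ (R : ℂ[X][X]) (w : ℂ), R.evalEval z w = (R.map (evalRingHom z)).eval w := by
    intro R w; rw [map_evalRingHom_eval]
  simp only [h]
  rw [← derivative_map]
  exact Polynomial.hasDerivAt _ _

open scoped ContDiff in
theorem exists_local_root {Q : ℂ[X][X]} {z w : ℂ} (h0 : Q.evalEval z w = 0)
    (h1 : Q.derivative.evalEval z w ≠ 0) :
    ∃ φ : ℂ → ℂ, ContDiffAt ℂ ω φ z ∧ φ z = w ∧
      ∀ᶠ v in 𝓝 (z, w), Q.evalEval v.1 v.2 = 0 ↔ φ v.1 = v.2 :=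
  exists_implicitFunction_of_hasDerivAt_ne_zero (contDiff_evalEval Q).contDiffAt h0
    (hasDerivAt_evalEval Q z w) h1

/-- Cauchy's bound in terms of the coefficients. It makes the roots locally bounded, hence the root
space proper over the base, and later limits their growth to a pole. -/
theorem norm_root_le {Q : ℂ[X][X]} {z w : ℂ} (hl : Q.leadingCoeff.eval z ≠ 0)
    (h0 : Q.evalEval z w = 0) :
    ‖w‖ ≤ (∑ i ∈ Finset.range Q.natDegree, ‖(Q.coeff i).eval z‖) / ‖Q.leadingCoeff.eval z‖ + 1 := by
  set q := Q.map (evalRingHom z) with hq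
  have hlc : q.leadingCoeff = Q.leadingCoeff.eval z :=
    leadingCoeff_map_of_leadingCoeff_ne_zero _ hl
  have hdeg : q.natDegree = Q.natDegree := natDegree_map_of_leadingCoeff_ne_zero _ hl
  have hq0 : q ≠ 0 := by rintro h; rw [h, leadingCoeff_zero] at hlc; exact hl hlc.symm
  have hr : q.IsRoot w := by rw [IsRoot, hq, map_evalRingHom_eval, h0]
  have h := le_of_lt (hr.norm_lt_cauchyBound hq0)
  rw [cauchyBound, hlc, hdeg] at h
  have h' : (Finset.range Q.natDegree).sup (fun i => ‖q.coeff i‖₊) ≤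
      ∑ i ∈ Finset.range Q.natDegree, ‖(Q.coeff i).eval z‖₊ := by
    refine Finset.sup_le fun i hi => ?_
    rw [hq, coeff_map, coe_evalRingHom]
    exact Finset.single_le_sum (f := fun i => ‖(Q.coeff i).eval z‖₊) (fun _ _ => zero_le) hi
  have h2 := (show _ ≤ _ from h).trans (add_le_add_left (div_le_div_of_nonneg_right h' zero_le) 1)
  simpa using NNReal.coe_le_coe.2 h2

end Puiseux

/-! ### The covering space formed by the roots -/

section RootCovering

variable {F : ℂ × ℂ → ℂ} {H : Set ℂ}

/-- If the zeros of `F ζ · ` are finitely many, locally bounded, and locally given by continuous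
functions of `ζ`, then they form a covering space. -/
theorem isCoveringMap_zeros (hF : ContinuousOn F (H ×ˢ univ)) (hH : IsOpen H)
    (hloc : ∀ ζ ∈ H, ∀ w, F (ζ, w) = 0 → ∃ ψ : ℂ → ℂ, ContinuousAt ψ ζ ∧ ψ ζ = w ∧
      ∀ᶠ v in 𝓝 (ζ, w), F v = 0 ↔ ψ v.1 = v.2)
    (hbd : ∀ ζ ∈ H, ∃ C : ℝ, ∀ᶠ ζ' in 𝓝 ζ, ∀ w, F (ζ', w) = 0 → ‖w‖ ≤ C)
    (hfin : ∀ ζ ∈ H, {w | F (ζ, w) = 0}.Finite) :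
    IsCoveringMap (fun x : {x : ℂ × ℂ // x.1 ∈ H ∧ F x = 0} => (⟨x.1.1, x.2.1⟩ : H)) := by
  set f := fun x : {x : ℂ × ℂ // x.1 ∈ H ∧ F x = 0} => (⟨x.1.1, x.2.1⟩ : H) with hf
  have hcont : Continuous f := by fun_prop
  -- Along an ultrafilter whose base points converge, the roots stay in a compact disc, so they
  -- converge too; by continuity of F the limit is again a zero.
  have hproper : IsProperMap f := by
    rw [isProperMap_iff_ultrafilter]
    refine ⟨hcont, fun 𝒰 y hy => ?_⟩
    obtain ⟨C, hC⟩ := hbd y y.2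
    have hy' : Tendsto (fun x : {x : ℂ × ℂ // x.1 ∈ H ∧ F x = 0} => x.1.1) 𝒰 (𝓝 y.1) :=
      (continuous_subtype_val.tendsto y).comp hy
    have h1 : ∀ᶠ x in (𝒰 : Filter {x : ℂ × ℂ // x.1 ∈ H ∧ F x = 0}),
        x.1.2 ∈ Metric.closedBall (0 : ℂ) C := by
      filter_upwards [hy'.eventually hC] with x hx
      simpa using hx x.1.2 x.2.2
    obtain ⟨w, -, hw⟩ := (isCompact_closedBall (0 : ℂ) C).ultrafilter_le_nhds
      (𝒰.map fun x => x.1.2) (by rw [le_principal_iff, Ultrafilter.coe_map]; exact h1)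
    have hw' : Tendsto (fun x : {x : ℂ × ℂ // x.1 ∈ H ∧ F x = 0} => x.1.2) 𝒰 (𝓝 w) := hw
    have h2 : Tendsto (fun x : {x : ℂ × ℂ // x.1 ∈ H ∧ F x = 0} => x.1) 𝒰 (𝓝 (y.1, w)) :=
      hy'.prodMk_nhds hw'
    have h3 : F (y.1, w) = 0 := by
      have hc : ContinuousAt F (y.1, w) :=
        hF.continuousAt ((hH.prod isOpen_univ).mem_nhds ⟨y.2, mem_univ _⟩)
      refine tendsto_nhds_unique (hc.tendsto.comp h2) ?_
      refine tendsto_const_nhds.congr fun x => x.2.2.symm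
    refine ⟨⟨(y.1, w), y.2, h3⟩, rfl, ?_⟩
    rw [nhds_subtype_eq_comap]
    exact tendsto_iff_comap.1 h2
  have hopen : IsOpenMap f := by
    rw [isOpenMap_iff_nhds_le]
    rintro ⟨⟨ζ, w⟩, hζ, hw⟩
    obtain ⟨ψ, hψc, hψ, hev⟩ := hloc ζ hζ w hw
    intro V hV
    rw [mem_map, nhds_subtype_eq_comap, mem_comap] at hV
    obtain ⟨W, hW, hWV⟩ := hV
    rw [nhds_subtype_eq_comap, mem_comap]
    have h1 : Tendsto (fun ζ' => (ζ', ψ ζ')) (𝓝 ζ) (𝓝 (ζ, w)) := by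
      have := (continuousAt_id (x := ζ)).prodMk hψc
      rw [← hψ]; exact this
    refine ⟨_, (h1.eventually (hev.and hW)), ?_⟩
    rintro ⟨ζ', hζ'⟩ ⟨h2, h3⟩
    exact @hWV ⟨(ζ', ψ ζ'), hζ', h2.2 rfl⟩ h3
  have hlocal : IsLocalHomeomorph f := by
    rw [isLocalHomeomorph_iff_isOpenEmbedding_restrict]
    rintro ⟨⟨ζ, w⟩, hζ, hw⟩
    obtain ⟨ψ, hψc, hψ, hev⟩ := hloc ζ hζ w hw
    obtain ⟨W, hW, hWo, hmem⟩ := eventually_nhds_iff.1 hev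
    have hU : IsOpen ((↑) ⁻¹' W : Set {x : ℂ × ℂ // x.1 ∈ H ∧ F x = 0}) :=
      hWo.preimage continuous_subtype_val
    refine ⟨_, hU.mem_nhds hmem, .of_continuous_injective_isOpenMap
      (hcont.comp continuous_subtype_val) ?_ (hopen.comp hU.isOpenMap_subtype_val)⟩
    rintro ⟨⟨⟨a, b⟩, ha⟩, haW⟩ ⟨⟨⟨a', b'⟩, ha'⟩, haW'⟩ hab
    have e1 : a = a' := congrArg Subtype.val hab
    have e2 := (hW _ haW).1 ha.2
    have e3 := (hW _ haW').1 ha'.2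
    simp only at e2 e3
    subst e1
    subst e2
    subst e3
    rfl
  rw [isCoveringMap_iff_isCoveringMapOn_univ]
  refine hproper.isClosedMap.isCoveringMapOn_of_isLocalHomeomorphOn (fun ζ _ => ?_)
    hlocal.isLocalHomeomorphOn
  refine Finite.of_finite_image ((hfin ζ ζ.2).subset ?_) (f := fun x => x.1.2) ?_
  · rintro _ ⟨⟨⟨a, b⟩, ha⟩, h, rfl⟩
    obtain rfl : (⟨a, ha.1⟩ : H) = ζ := h
    exact ha.2
  · rintro ⟨⟨a, b⟩, ha⟩ h ⟨⟨a', b'⟩, ha'⟩ h' hb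
    have e1 : (⟨a, ha.1⟩ : H) = ζ := h
    have e2 : (⟨a', ha'.1⟩ : H) = ζ := h'
    have e3 : a = a' := congrArg Subtype.val (e1.trans e2.symm)
    simp only at hb
    subst e3
    subst hb
    rfl

/-- A convex base is contractible, so its identity map lifts through the covering with any
prescribed starting root. -/
theorem exists_continuousOn_zero
    (hcov : IsCoveringMap (fun x : {x : ℂ × ℂ // x.1 ∈ H ∧ F x = 0} => (⟨x.1.1, x.2.1⟩ : H)))
    (hH : IsOpen H) (hc : Convex ℝ H) {ζ w : ℂ} (hζ : ζ ∈ H) (hw : F (ζ, w) = 0) :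
    ∃ A : ℂ → ℂ, ContinuousOn A H ∧ A ζ = w ∧ ∀ ζ' ∈ H, F (ζ', A ζ') = 0 := by
  have : ContractibleSpace H := hc.contractibleSpace ⟨ζ, hζ⟩
  have : LocallyPathConnectedSpace H := hH.locallyPathConnectedSpace
  obtain ⟨G, ⟨h1, h2⟩, -⟩ := hcov.existsUnique_continuousMap_lifts (ContinuousMap.id H) ⟨ζ, hζ⟩
    ⟨(ζ, w), hζ, hw⟩ rfl
  have h3 : ∀ x : H, (G x).1.1 = x := fun x => congrArg Subtype.val (congrFun h2 x)
  classical
  refine ⟨fun z => if hz : z ∈ H then (G ⟨z, hz⟩).1.2 else 0, ?_, ?_, ?_⟩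
  · rw [continuousOn_iff_continuous_domRestrict]
    have : H.domRestrict (fun z => if hz : z ∈ H then (G ⟨z, hz⟩).1.2 else 0) =
        fun x => (G x).1.2 := by
      ext x; simp
    rw [this]
    fun_prop
  · simp [hζ, h1]
  · intro z hz
    have := (G ⟨z, hz⟩).2.2
    have e : (G ⟨z, hz⟩).1 = (z, (G ⟨z, hz⟩).1.2) := Prod.ext (h3 ⟨z, hz⟩) rfl
    rw [e] at this
    simpa [hz] using this

/-- Uniqueness of lifts over a connected base: distinct root functions never meet. -/
theorem eqOn_of_continuousOn_zero
    (hcov : IsCoveringMap (fun x : {x : ℂ × ℂ // x.1 ∈ H ∧ F x = 0} => (⟨x.1.1, x.2.1⟩ : H)))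
    (hc : Convex ℝ H) {A B : ℂ → ℂ} (hA : ContinuousOn A H) (hB : ContinuousOn B H)
    (hA0 : ∀ ζ ∈ H, F (ζ, A ζ) = 0) (hB0 : ∀ ζ ∈ H, F (ζ, B ζ) = 0) {ζ : ℂ} (hζ : ζ ∈ H)
    (h : A ζ = B ζ) : EqOn A B H := by
  have : PreconnectedSpace H := Subtype.preconnectedSpace hc.isPreconnected
  have hA' : Continuous fun x : H => A x := continuousOn_iff_continuous_domRestrict.1 hA
  have hB' : Continuous fun x : H => B x := continuousOn_iff_continuous_domRestrict.1 hB
  have := hcov.eq_of_comp_eq (A := H)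
    (g₁ := fun x => ⟨(x.1, A x), x.2, hA0 x x.2⟩) (g₂ := fun x => ⟨(x.1, B x), x.2, hB0 x x.2⟩)
    ((continuous_subtype_val.prodMk hA').subtype_mk _)
    ((continuous_subtype_val.prodMk hB').subtype_mk _) rfl ⟨ζ, hζ⟩ (by simp [h])
  intro z hz
  exact congrArg (fun x => x.1.2) (congrFun this ⟨z, hz⟩)

end RootCovering

/-! ### Puiseux's theorem -/

section Puiseux

open Polynomial Function
open scoped Polynomial.Bivariate

theorem eventually_eval_ne_zero {D : ℂ[X]} (hD : D ≠ 0) (p : ℂ) :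
    ∀ᶠ z in 𝓝[≠] p, D.eval z ≠ 0 := by
  have h : {z | D.IsRoot z}.Finite := finite_setOfPred_isRoot hD
  have : ∀ᶠ z in 𝓝[≠] p, z ∉ {z | D.IsRoot z} \ {p} := by
    filter_upwards [mem_nhdsWithin_of_mem_nhds
      ((h.subset sdiff_subset).isClosed.compl_mem_nhds (x := p) (s := {z | D.IsRoot z} \ {p})
        (by simp))] with z hz using hz
  filter_upwards [this, self_mem_nhdsWithin] with z hz hz' h0
  exact hz ⟨h0, hz'⟩

open scoped ContDiff in
/-- **Puiseux's theorem**: near `p`, the roots of a bivariate polynomial become meromorphic after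
the substitution `z = p + s ^ N`. -/
theorem exists_puiseux {P : ℂ[X][X]} (hP : P ≠ 0) (p : ℂ) :
    ∃ (N : ℕ) (ι : Type) (_ : Finite ι) (g : ι → ℂ → ℂ), 0 < N ∧
      (∀ i, MeromorphicAt (g i) 0) ∧
      (∀ᶠ s in 𝓝[≠] (0 : ℂ), ∀ w, P.evalEval (p + s ^ N) w = 0 → ∃ i, w = g i s) ∧
      ∀ᶠ s in 𝓝[≠] (0 : ℂ), Injective fun i => g i s := by
  obtain ⟨Q, D, hD, hQ⟩ := exists_separable_polynomial hP
  have hDT : ∀ᶠ ζ in comap Complex.im atTop, D.eval (p + Periodic.qParam 1 ζ) ≠ 0 := by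
    have h1 : Tendsto (fun q : ℂ => p + q) (𝓝[≠] 0) (𝓝[≠] p) := by
      refine tendsto_nhdsWithin_iff.2 ⟨?_, ?_⟩
      · exact ((continuous_const_add p).tendsto' 0 p (by simp)).mono_left nhdsWithin_le_nhds
      · filter_upwards [self_mem_nhdsWithin] with q hq
        simpa using hq
    -- The half plane Im ζ > T is the universal cover of a small punctured disc through q =
    -- exp(2πiζ); for T large, p + q avoids the zeros of D.
    exact (h1.comp (Periodic.qParam_tendsto one_pos)).eventually (eventually_eval_ne_zero hD p)
  obtain ⟨T, hT⟩ := ((atTop_basis.comap Complex.im).eventually_iff).1 hDT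
  simp only [true_and] at hT
  set H : Set ℂ := {ζ | T < ζ.im} with hH
  set h : ℂ → ℂ := fun ζ => p + Periodic.qParam 1 ζ with hh
  have hHo : IsOpen H := isOpen_lt continuous_const Complex.continuous_im
  have hHc : Convex ℝ H := convex_halfSpace_im_gt T
  have hHmem : ∀ ζ ∈ H, D.eval (h ζ) ≠ 0 := fun ζ hζ => hT (show T ≤ ζ.im from le_of_lt hζ)
  set F : ℂ × ℂ → ℂ := fun v => Q.evalEval (h v.1) v.2 with hF
  have hhc : ContDiff ℂ ω h := contDiff_const.add (Periodic.contDiff_qParam _)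
  have hFc : Continuous F := (contDiff_evalEval Q).continuous.comp
    ((hhc.continuous.comp continuous_fst).prodMk continuous_snd)
  have hloc : ∀ ζ ∈ H, ∀ w, F (ζ, w) = 0 → ∃ ψ : ℂ → ℂ, ContDiffAt ℂ ω ψ ζ ∧ ψ ζ = w ∧
      ∀ᶠ v in 𝓝 (ζ, w), F v = 0 ↔ ψ v.1 = v.2 := by
    intro ζ hζ w hw
    obtain ⟨φ, h1, h2, h3⟩ := exists_local_root hw ((hQ _ (hHmem ζ hζ)).2.1 w hw)
    refine ⟨φ ∘ h, h1.comp ζ hhc.contDiffAt, h2, ?_⟩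
    have : Tendsto (fun v : ℂ × ℂ => (h v.1, v.2)) (𝓝 (ζ, w)) (𝓝 (h ζ, w)) :=
      ((hhc.continuous.comp continuous_fst).prodMk continuous_snd).tendsto (ζ, w)
    exact this.eventually h3
  have hcovfin : ∀ ζ ∈ H, {w | F (ζ, w) = 0}.Finite := by
    intro ζ hζ
    have h0 : Q.map (evalRingHom (h ζ)) ≠ 0 := by
      intro h0
      have := leadingCoeff_map_of_leadingCoeff_ne_zero (evalRingHom (h ζ))
        (hQ _ (hHmem ζ hζ)).1
      rw [h0, leadingCoeff_zero] at this
      exact (hQ _ (hHmem ζ hζ)).1 this.symm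
    refine (finite_setOfPred_isRoot h0).subset fun w hw => ?_
    change (Q.map (evalRingHom (h ζ))).eval w = 0
    rw [map_evalRingHom_eval]
    exact hw
  have hcov := isCoveringMap_zeros hFc.continuousOn hHo
    (fun ζ hζ w hw => (hloc ζ hζ w hw).imp fun ψ h => ⟨h.1.continuousAt, h.2⟩)
    (fun ζ hζ => by
      have hc : ContinuousAt (fun z => (∑ i ∈ Finset.range Q.natDegree, ‖(Q.coeff i).eval z‖) /
          ‖Q.leadingCoeff.eval z‖ + 1) (h ζ) := by
        refine ContinuousAt.add (ContinuousAt.div ?_ ?_ ?_) continuousAt_const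
        · exact (continuous_finsetSum _ fun i _ => (Q.coeff i).continuous.norm).continuousAt
        · exact Q.leadingCoeff.continuous.norm.continuousAt
        · exact norm_ne_zero_iff.2 (hQ _ (hHmem ζ hζ)).1
      refine ⟨(∑ i ∈ Finset.range Q.natDegree, ‖(Q.coeff i).eval (h ζ)‖) /
          ‖Q.leadingCoeff.eval (h ζ)‖ + 1 + 1, ?_⟩
      filter_upwards [(hc.comp hhc.continuous.continuousAt).eventually
        (eventually_le_nhds (lt_add_one _)), hHo.mem_nhds hζ] with ζ' h1 h2 w hw
      exact (norm_root_le (hQ _ (hHmem ζ' h2)).1 hw).trans h1)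
    hcovfin
  have hlift := fun {ζ w : ℂ} => exists_continuousOn_zero (ζ := ζ) (w := w) hcov hHo hHc
  have huniq := fun {A B : ℂ → ℂ} => eqOn_of_continuousOn_zero (A := A) (B := B) hcov hHc
  set ζ₀ : ℂ := (T + 1) * Complex.I with hζ₀
  have hζ₀H : ζ₀ ∈ H := by simp [hH, hζ₀]
  have hshift : ∀ (x : ℝ) (ζ : ℂ), ζ + x ∈ H ↔ ζ ∈ H := by simp [hH]
  have hh1 : ∀ ζ, h (ζ + 1) = h ζ := by
    intro ζ
    simp only [hh, Periodic.qParam]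
    rw [mul_add, add_div, Complex.exp_add]
    simp
  let W := {w // F (ζ₀, w) = 0}
  have hWfin : Finite W := hcovfin ζ₀ hζ₀H
  choose A hAc hA₀ hA using fun w : W => hlift hζ₀H w.2
  have hAall : ∀ ζ ∈ H, ∀ w, F (ζ, w) = 0 → ∃ i, A i ζ = w := by
    intro ζ hζ w hw
    obtain ⟨B, hBc, hBζ, hB⟩ := hlift hζ hw
    refine ⟨⟨B ζ₀, hB _ hζ₀H⟩, ?_⟩
    rw [← hBζ]
    exact huniq (hAc _) hBc (hA _) hB hζ₀H (hA₀ _) hζ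
  have hAinj : ∀ ζ ∈ H, ∀ i j, A i ζ = A j ζ → i = j := by
    intro ζ hζ i j hij
    have := huniq (hAc i) (hAc j) (hA i) (hA j) hζ hij hζ₀H
    rw [hA₀, hA₀] at this
    exact Subtype.ext this
  have hAd : ∀ i, DifferentiableOn ℂ (A i) H := by
    intro i ζ hζ
    obtain ⟨ψ, h1, h2, h3⟩ := hloc ζ hζ _ (hA i ζ hζ)
    have hAc' : ContinuousAt (A i) ζ := (hAc i).continuousAt (hHo.mem_nhds hζ)
    have h4 : Tendsto (fun ζ' => (ζ', A i ζ')) (𝓝 ζ) (𝓝 (ζ, A i ζ)) :=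
      (continuousAt_id (x := ζ)).prodMk hAc'
    have h5 : ψ =ᶠ[𝓝 ζ] A i := by
      filter_upwards [h4.eventually h3, hHo.mem_nhds hζ] with ζ' h6 h7
      exact h6.1 (hA i ζ' h7)
    exact ((h1.differentiableAt (by simp)).congr_of_eventuallyEq h5.symm).differentiableWithinAt
  -- The monodromy: ζ ↦ ζ + 1 fixes the point q, hence permutes the finitely many root functions.
  -- The order of this permutation is the Puiseux exponent N.
  have hσ : ∀ i, ∃ j, ∀ ζ ∈ H, A i (ζ + 1) = A j ζ := by
    intro i
    have hm : ∀ ζ ∈ H, ζ + 1 ∈ H := fun ζ hζ => by simpa using (hshift 1 ζ).2 hζ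
    have hz : ∀ ζ ∈ H, F (ζ, A i (ζ + 1)) = 0 := by
      intro ζ hζ
      have := hA i _ (hm ζ hζ)
      simpa only [hF, hh1] using this
    obtain ⟨j, hj⟩ := hAall ζ₀ hζ₀H _ (hz ζ₀ hζ₀H)
    refine ⟨j, fun ζ hζ => ?_⟩
    exact huniq (A := fun ζ => A i (ζ + 1)) ((hAc i).comp (by fun_prop) hm) (hAc j) hz (hA j)
      hζ₀H hj.symm hζ
  choose σ hσ using hσ
  have hσinj : Injective σ := by
    intro i j hij
    have h1 := hσ i ζ₀ hζ₀H
    rw [hij, ← hσ j ζ₀ hζ₀H] at h1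
    exact hAinj _ (by simpa using (hshift 1 ζ₀).2 hζ₀H) _ _ h1
  set e : Equiv.Perm W := Equiv.ofBijective σ (Finite.injective_iff_bijective.1 hσinj) with he
  set N := orderOf e with hN
  have hN0 : 0 < N := orderOf_pos e
  have hiter : ∀ (k : ℕ) i, ∀ ζ ∈ H, A i (ζ + k) = A ((e ^ k) i) ζ := by
    intro k
    induction k with
    | zero => simp
    | succ k ih =>
      intro i ζ hζ
      rw [pow_succ', Equiv.Perm.mul_apply]
      have : e ((e ^ k) i) = σ ((e ^ k) i) := rfl
      rw [this, ← hσ _ _ hζ, ← ih i (ζ + 1) (by simpa using (hshift 1 ζ).2 hζ)]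
      push_cast
      ring_nf
  -- Extension by zero off the half plane gives a function periodic on all of ℂ; H is invariant
  -- under real translations.
  have hper : ∀ i, Periodic (H.indicator (A i)) ((N : ℝ) : ℂ) := by
    intro i ζ
    by_cases hζ : ζ ∈ H
    · rw [indicator_of_mem hζ, indicator_of_mem ((hshift N ζ).2 hζ)]
      have := hiter N i ζ hζ
      rw [hN, pow_orderOf_eq_one] at this
      simpa using this
    · rw [indicator_of_notMem hζ, indicator_of_notMem fun h => hζ ((hshift N ζ).1 h)]
  have hNR : (0 : ℝ) < N := by exact_mod_cast hN0
  have hinv : ∀ s : ℂ, s ≠ 0 → h (Periodic.invQParam N s) = p + s ^ N := by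
    intro s hs
    simp only [hh]
    congr 1
    conv_rhs => rw [← Periodic.qParam_right_inv hNR.ne' hs]
    simp only [Periodic.qParam, ← Complex.exp_nat_mul]
    congr 1
    have : (N : ℂ) ≠ 0 := by exact_mod_cast hN0.ne'
    push_cast
    field_simp
  have hsmall : ∀ᶠ s in 𝓝[≠] (0 : ℂ), Periodic.invQParam N s ∈ H := by
    have : ∀ᶠ ζ in comap Complex.im atTop, ζ ∈ H :=
      (eventually_gt_atTop T).comap Complex.im
    exact (Periodic.invQParam_tendsto hNR).eventually this
  have hcusp : ∀ᶠ s in 𝓝[≠] (0 : ℂ), ∀ i,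
      Periodic.cuspFunction N (H.indicator (A i)) s = A i (Periodic.invQParam N s) := by
    filter_upwards [hsmall, self_mem_nhdsWithin] with s hs hs0 i
    rw [Periodic.cuspFunction_eq_of_nonzero _ _ hs0, indicator_of_mem hs]
  refine ⟨N, W, hWfin, fun i => Periodic.cuspFunction N (H.indicator (A i)), hN0, fun i => ?_,
    ?_, ?_⟩
  · have hd : ∀ᶠ s in 𝓝[≠] (0 : ℂ),
        DifferentiableAt ℂ (Periodic.cuspFunction N (H.indicator (A i))) s := by
      refine Periodic.eventually_differentiableAt_cuspFunction_nhds_ne_zero hNR (hper i) ?_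
      filter_upwards [(eventually_gt_atTop T).comap Complex.im] with ζ hζ
      have hζH : H ∈ 𝓝 ζ := hHo.mem_nhds hζ
      refine ((hAd i).differentiableAt hζH).congr_of_eventuallyEq ?_
      filter_upwards [hζH] with ζ' h' using indicator_of_mem h' _
    set g := Periodic.cuspFunction N (H.indicator (A i)) with hg
    set lc : ℂ → ℂ := fun s => Q.leadingCoeff.eval (p + s ^ N) with hlc
    have hlcd : Differentiable ℂ lc := Q.leadingCoeff.differentiable.comp (by fun_prop)
    have hlc0 : ∀ᶠ s in 𝓝[≠] (0 : ℂ), lc s ≠ 0 := by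
      filter_upwards [hsmall, self_mem_nhdsWithin] with s hs hs0
      have := (hQ _ (hHmem _ hs)).1
      rwa [hinv s hs0] at this
    set M : ℂ → ℝ := fun s => (∑ j ∈ Finset.range Q.natDegree, ‖(Q.coeff j).eval (p + s ^ N)‖) +
      ‖lc s‖ with hM
    have hMc : Continuous M := by
      refine (continuous_finsetSum _ fun j _ => ?_).add hlcd.continuous.norm
      exact ((Q.coeff j).continuous.comp (by fun_prop)).norm
    have hbound : ∀ᶠ s in 𝓝[≠] (0 : ℂ), ‖lc s * g s‖ ≤ M s := by
      filter_upwards [hsmall, hcusp, hlc0, self_mem_nhdsWithin] with s hs hc hl hs0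
      have h1 := hA i _ hs
      rw [← hc i] at h1
      have h2 := norm_root_le (hQ _ (hHmem _ hs)).1 h1
      rw [hinv s hs0] at h2
      have h3 : 0 < ‖lc s‖ := norm_pos_iff.2 hl
      calc ‖lc s * g s‖ = ‖lc s‖ * ‖g s‖ := norm_mul _ _
        _ ≤ ‖lc s‖ * _ := mul_le_mul_of_nonneg_left h2 h3.le
        _ = M s := by rw [mul_add, mul_one, mul_div_cancel₀ _ h3.ne']
    -- Cauchy's bound keeps the leading coefficient times the root bounded. The extra factor s
    -- forces the limit 0, so the singularity is removable whatever value the cusp function has at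
    -- 0.
    have hcont : ContinuousAt (fun s => s * (lc s * g s)) 0 := by
      rw [continuousAt_iff_punctured_nhds, zero_mul]
      refine squeeze_zero_norm' (a := fun s : ℂ => ‖s‖ * M s) ?_ ?_
      · filter_upwards [hbound] with s hs
        rw [norm_mul]
        exact mul_le_mul_of_nonneg_left hs (norm_nonneg _)
      · have : Continuous fun s : ℂ => ‖s‖ * M s := continuous_norm.mul hMc
        exact (this.tendsto' 0 0 (by simp)).mono_left nhdsWithin_le_nhds
    have han : AnalyticAt ℂ (fun s => s * (lc s * g s)) 0 := by
      refine Complex.analyticAt_of_differentiable_on_punctured_nhds_of_continuousAt ?_ hcont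
      filter_upwards [hd] with s hs
      exact differentiableAt_id.mul ((hlcd s).mul hs)
    have hlcm : MeromorphicAt lc 0 := (hlcd.analyticAt 0).meromorphicAt
    refine ((han.meromorphicAt.mul (MeromorphicAt.id 0).inv).mul hlcm.inv).congr ?_
    filter_upwards [hlc0, self_mem_nhdsWithin] with s hl hs0
    have hs0' : s ≠ 0 := hs0
    simp only [Pi.mul_apply, Pi.inv_apply, id]
    field_simp
    rfl
  · filter_upwards [hsmall, hcusp, self_mem_nhdsWithin] with s hs hc hs0 w hw
    have : F (Periodic.invQParam N s, w) = 0 := by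
      rw [← hinv s hs0] at hw
      exact (hQ _ (hHmem _ hs)).2.2 w hw
    obtain ⟨i, hi⟩ := hAall _ hs w this
    exact ⟨i, by rw [hc, hi]⟩
  · filter_upwards [hsmall, hcusp] with s hs hc i j hij
    simp only [hc] at hij
    exact hAinj _ hs i j hij

end Puiseux

/-! ### Branches in the logarithmic chart -/

section LogChart

/-- The chart `ζ ↦ p + exp (N ζ)` from a left half plane to a punctured neighbourhood of `p`. -/
noncomputable def logChart (p : ℂ) (N : ℕ) (ζ : ℂ) : ℂ := p + Complex.exp (N * ζ)

theorem hasStrictDerivAt_logChart (p : ℂ) (N : ℕ) (ζ : ℂ) :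
    HasStrictDerivAt (logChart p N) (N * Complex.exp (N * ζ)) ζ := by
  have h := ((hasStrictDerivAt_id ζ).const_mul (N : ℂ)).cexp.const_add p
  rw [mul_comm, mul_one] at h
  exact h

/-- The branches `g l` of the Cauchy transform in the chart `logChart p N`, on the half plane
`re ζ < X`. -/
structure LogRoots {ι : Type} (μ : Measure ℂ) (p : ℂ) (N : ℕ) (X : ℝ) (g : ι → ℂ → ℂ) : Prop where
  pos : 0 < N
  differentiableOn : ∀ l, DifferentiableOn ℂ (g l) {ζ | ζ.re < X}
  root : ∀ ζ : ℂ, ζ.re < X → logChart p N ζ ∉ μ.support →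
    ∃ l, cauchyTransform μ (logChart p N ζ) = g l ζ
  inj : ∀ ζ : ℂ, ζ.re < X → Function.Injective fun l => g l ζ

theorem isOpen_re_lt (X : ℝ) : IsOpen {ζ : ℂ | ζ.re < X} :=
  isOpen_lt Complex.continuous_re continuous_const

theorem OnBranch.notMem {μ : Measure ℂ} {Φ f : ℂ → ℂ} {s : ℂ} (h : OnBranch μ Φ f s) :
    Φ s ∉ μ.support := h.self_of_nhds.1

theorem OnBranch.eq {μ : Measure ℂ} {Φ f : ℂ → ℂ} {s : ℂ} (h : OnBranch μ Φ f s) :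
    cauchyTransform μ (Φ s) = f s := h.self_of_nhds.2

namespace LogRoots

variable {ι : Type} {μ : Measure ℂ} {p : ℂ} {N : ℕ} {X : ℝ}
  {g : ι → ℂ → ℂ}

theorem onBranch_unique (h : LogRoots μ p N X g) {ζ : ℂ} (hζ : ζ.re < X) {i j : ι}
    (hi : OnBranch μ (logChart p N) (g i) ζ) (hj : OnBranch μ (logChart p N) (g j) ζ) : i = j :=
  h.inj ζ hζ (hi.eq.symm.trans hj.eq)

theorem deriv_ne_zero (h : LogRoots μ p N X g) (ζ : ℂ) : (N : ℂ) * Complex.exp (N * ζ) ≠ 0 :=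
  mul_ne_zero (by exact_mod_cast h.pos.ne') (Complex.exp_ne_zero _)

/-- The chart is open, so the image of V contains a neighbourhood, which has positive area and
cannot lie in K. -/
theorem exists_notMem (h : LogRoots μ p N X g) (h0 : volume μ.support = 0) {V : Set ℂ}
    (hV : IsOpen V) (hne : V.Nonempty) : ∃ ζ ∈ V, logChart p N ζ ∉ μ.support := by
  obtain ⟨ζ, hζ⟩ := hne
  by_contra! hcon
  have h1 : logChart p N '' V ∈ 𝓝 (logChart p N ζ) := by
    rw [← (hasStrictDerivAt_logChart p N ζ).map_nhds_eq (h.deriv_ne_zero ζ)]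
    exact image_mem_map (hV.mem_nhds hζ)
  have h2 := Measure.measure_pos_of_mem_nhds (volume : Measure ℂ) h1
  have h3 : logChart p N '' V ⊆ μ.support := by
    rintro _ ⟨ζ', hζ', rfl⟩
    exact hcon ζ' hζ'
  exact absurd (measure_mono_null h3 h0) h2.ne'

variable [Finite ι] [IsFiniteMeasure μ]

/-- The finitely many branches have distinct values at ζ, so by continuity μ̂ cannot switch to
another one nearby. -/
theorem onBranch_of_eq (h : LogRoots μ p N X g) {ζ : ℂ} (hζ : ζ.re < X)
    (hs : logChart p N ζ ∉ μ.support) {l : ι}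
    (hl : cauchyTransform μ (logChart p N ζ) = g l ζ) :
    OnBranch μ (logChart p N) (g l) ζ := by
  have hΦ : ContinuousAt (logChart p N) ζ := (hasStrictDerivAt_logChart p N ζ).hasDerivAt.continuousAt
  have h1 : ∀ᶠ ζ' in 𝓝 ζ, logChart p N ζ' ∉ μ.support :=
    hΦ.eventually (μ.isClosed_support.isOpen_compl.mem_nhds hs)
  have hC : ContinuousAt (fun ζ => cauchyTransform μ (logChart p N ζ)) ζ :=
    (differentiableAt_cauchyTransform hs).continuousAt.comp hΦ
  have hg : ∀ m, ContinuousAt (g m) ζ := fun m =>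
    ((h.differentiableOn m).differentiableAt ((isOpen_re_lt X).mem_nhds hζ)).continuousAt
  have h2 : ∀ᶠ ζ' in 𝓝 ζ, ∀ m, m ≠ l → cauchyTransform μ (logChart p N ζ') ≠ g m ζ' := by
    refine eventually_all.2 fun m => ?_
    by_cases hm : m = l
    · exact Eventually.of_forall fun _ h => absurd hm h
    · have : cauchyTransform μ (logChart p N ζ) ≠ g m ζ := by
        rw [hl]; exact fun e => hm (h.inj ζ hζ e.symm)
      filter_upwards [(hC.sub (hg m)).eventually_ne (sub_ne_zero.2 this)] with ζ' h' _
      exact sub_ne_zero.1 h'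
  filter_upwards [h1, h2, (isOpen_re_lt X).mem_nhds hζ] with ζ' h3 h4 h5
  obtain ⟨m, hm⟩ := h.root ζ' h5 h3
  by_cases e : m = l
  · exact ⟨h3, e ▸ hm⟩
  · exact absurd hm (h4 m e)

theorem exists_onBranch (h : LogRoots μ p N X g) {ζ : ℂ} (hζ : ζ.re < X)
    (hs : logChart p N ζ ∉ μ.support) : ∃ l, OnBranch μ (logChart p N) (g l) ζ :=
  (h.root ζ hζ hs).imp fun _ hl => h.onBranch_of_eq hζ hs hl

/-- Propagation of a branch along a path that moves in a direction increasing the real part of the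
primitive of the branch relative to all competing ones. -/
theorem propagate (h : LogRoots μ p N X g) {B : ℝ} (hB : ∀ᵐ ζ ∂μ, ‖ζ‖ ≤ B)
    (h0 : volume μ.support = 0) {V : Set ℂ} (hV : IsOpen V) (hVX : ∀ ζ ∈ V, ζ.re < X)
    {L : Set ι} (hL : ∀ ζ ∈ V, ∀ l, OnBranch μ (logChart p N) (g l) ζ → l ∈ L) {m : ι}
    {a b : ℝ} (hab : a ≤ b) {γ γ' : ℝ → ℂ} (hγ : ∀ t ∈ Icc a b, HasDerivAt γ (γ' t) t)
    (hγV : ∀ t ∈ Icc a b, γ t ∈ V)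
    (hdir : ∀ t ∈ Icc a b, ∀ l ∈ L, l ≠ m →
      0 < (N * Complex.exp (N * γ t) * (g m (γ t) - g l (γ t)) * γ' t).re)
    (hstart : OnBranch μ (logChart p N) (g m) (γ a)) :
    OnBranch μ (logChart p N) (g m) (γ b) := by
  have hm : m ∈ L := hL _ (hγV a ⟨le_rfl, hab⟩) m hstart
  refine propagate_path (ι := L) hB h0 hV (g := fun l => g l) (m := ⟨m, hm⟩)
    (fun ζ _ => hasStrictDerivAt_logChart p N ζ) (fun ζ _ => h.deriv_ne_zero ζ)
    (fun l => (h.differentiableOn l).mono hVX) (fun ζ hζ hs => ?_) hab hγ hγV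
    (fun t ht l hl => ?_) hstart
  · obtain ⟨l, hl⟩ := h.exists_onBranch (hVX ζ hζ) hs
    exact ⟨⟨l, hL ζ hζ l hl⟩, hl.eq⟩
  · have := hdir t ht l l.2 (fun e => hl (Subtype.ext e))
    convert this using 2
    ring

end LogRoots

end LogChart

/-! ### Asymptotics of meromorphic functions along a direction -/

section AngleFilter

/-- In the logarithmic coordinate `ζ = log s`: approach of `s` to `0` tangentially to the
direction `θ`. -/
def angleFilter (θ : ℝ) : Filter ℂ := comap Complex.re atBot ⊓ comap Complex.im (𝓝 θ)

theorem eventually_angleFilter {θ : ℝ} {P : ℂ → Prop} :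
    (∀ᶠ ζ in angleFilter θ, P ζ) ↔
      ∃ X : ℝ, ∃ δ > 0, ∀ ζ : ℂ, ζ.re < X → |ζ.im - θ| < δ → P ζ := by
  have h := (((atBot_basis_Iio (α := ℝ)).comap Complex.re).inf
    ((Metric.nhds_basis_ball (x := θ)).comap Complex.im)).eventually_iff (q := P)
  rw [angleFilter, h]
  constructor
  · rintro ⟨⟨X, δ⟩, ⟨-, hδ⟩, H⟩
    exact ⟨X, δ, hδ, fun ζ h1 h2 => H ⟨h1, h2⟩⟩
  · rintro ⟨X, δ, hδ, H⟩
    exact ⟨⟨X, δ⟩, ⟨trivial, hδ⟩, fun ζ h => H ζ h.1 h.2⟩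

theorem tendsto_exp_angleFilter (θ : ℝ) : Tendsto Complex.exp (angleFilter θ) (𝓝[≠] 0) :=
  Complex.tendsto_exp_comap_re_atBot_nhdsNE.mono_left inf_le_left

/-- The leading Laurent term c s^k dominates, and along the direction θ one has s^k ≈ |s|^k e^{ikθ}.
Dividing by |s|^k leaves a nonzero limit and does not affect signs of real parts. -/
theorem exists_tendsto_angleFilter {D : ℂ → ℂ} (hD : MeromorphicAt D 0)
    (h0 : meromorphicOrderAt D 0 ≠ ⊤) (θ : ℝ) :
    ∃ (k : ℤ) (β : ℂ), meromorphicOrderAt D 0 = k ∧ β ≠ 0 ∧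
      Tendsto (fun ζ : ℂ => (Real.exp (-(k * ζ.re)) : ℂ) * D (Complex.exp ζ)) (angleFilter θ)
        (𝓝 β) := by
  lift meromorphicOrderAt D 0 to ℤ using h0 with k hk
  obtain ⟨h, hh, hh0, hDh⟩ := (meromorphicOrderAt_eq_int_iff hD).1 hk.symm
  refine ⟨k, Complex.exp (k * θ * Complex.I) * h 0, rfl,
    mul_ne_zero (Complex.exp_ne_zero _) hh0, ?_⟩
  have h1 : Tendsto (fun ζ : ℂ => h (Complex.exp ζ)) (angleFilter θ) (𝓝 (h 0)) :=
    (hh.continuousAt.tendsto.mono_left nhdsWithin_le_nhds).comp (tendsto_exp_angleFilter θ)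
  have h2 : Tendsto (fun ζ : ℂ => Complex.exp (k * ζ.im * Complex.I)) (angleFilter θ)
      (𝓝 (Complex.exp (k * θ * Complex.I))) := by
    have hc : Continuous fun y : ℝ => Complex.exp (k * y * Complex.I) := by fun_prop
    exact (hc.tendsto θ).comp (tendsto_comap.mono_left inf_le_right)
  refine (h2.mul h1).congr' ?_
  filter_upwards [(tendsto_exp_angleFilter θ).eventually hDh] with ζ hζ
  rw [hζ, sub_zero, smul_eq_mul, ← mul_assoc, ← Complex.exp_int_mul, Complex.ofReal_exp,
    ← Complex.exp_add]
  congr 2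
  apply Complex.ext <;> simp

theorem eventually_re_pos_of_tendsto {D : ℂ → ℂ} {θ : ℝ} {k : ℤ} {β e : ℂ}
    (hD : Tendsto (fun ζ : ℂ => (Real.exp (-(k * ζ.re)) : ℂ) * D (Complex.exp ζ)) (angleFilter θ)
        (𝓝 β)) (he : 0 < (β * e).re) :
    ∀ᶠ v in angleFilter θ ×ˢ 𝓝 e, 0 < (D (Complex.exp v.1) * v.2).re := by
  have h1 : Tendsto (fun v : ℂ × ℂ =>
      ((Real.exp (-(k * v.1.re)) : ℂ) * D (Complex.exp v.1) * v.2).re) (angleFilter θ ×ˢ 𝓝 e)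
      (𝓝 (β * e).re) :=
    (Complex.continuous_re.tendsto _).comp ((hD.comp tendsto_fst).mul tendsto_snd)
  filter_upwards [h1.eventually (lt_mem_nhds he)] with v hv
  rw [mul_assoc, Complex.re_ofReal_mul] at hv
  exact pos_of_mul_pos_right hv (Real.exp_pos _).le

/-- All candidates conj(β)(1 + it) have the same positive real part against β, and each nonzero b i
excludes at most one t. -/
theorem exists_generic_direction {ι : Type*} [Finite ι] {β : ℂ} (hβ : β ≠ 0) (b : ι → ℂ) :
    ∃ e : ℂ, 0 < (β * e).re ∧ ∀ i, b i ≠ 0 → (b i * e).re ≠ 0 := by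
  have h : ∀ i, {t : ℝ | b i ≠ 0 ∧ (b i * (starRingEnd ℂ β * (1 + t * Complex.I))).re = 0}.Subsingleton := by
    rintro i t ⟨hi, ht⟩ t' ⟨-, ht'⟩
    set c := b i * starRingEnd ℂ β with hc
    have hc0 : c ≠ 0 := mul_ne_zero hi (by simpa using hβ)
    rw [← mul_assoc, ← hc] at ht ht'
    simp at ht ht'
    by_cases him : c.im = 0
    · have : c.re = 0 := by rw [him] at ht; simpa using ht
      exact absurd (Complex.ext this him) hc0
    · have : c.im * t = c.im * t' := by linarith
      exact mul_left_cancel₀ him this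
  have hfin : (⋃ i, {t : ℝ | b i ≠ 0 ∧
      (b i * (starRingEnd ℂ β * (1 + t * Complex.I))).re = 0}).Finite :=
    finite_iUnion fun i => (h i).finite
  obtain ⟨t, ht⟩ := hfin.exists_notMem
  refine ⟨starRingEnd ℂ β * (1 + t * Complex.I), ?_, fun i hi h0 => ht (mem_iUnion.2 ⟨i, hi, h0⟩)⟩
  rw [← mul_assoc, Complex.mul_conj]
  have : 0 < Complex.normSq β := Complex.normSq_pos.2 hβ
  simpa using this

end AngleFilter

/-- Where a ball of proportional radius is free of the support, `(z - p) μ̂(z)` tends to the point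
mass at `p`. -/
theorem tendsto_sub_mul_cauchyTransform (μ : Measure ℂ) [IsFiniteMeasure μ] (p : ℂ) {κ : ℝ}
    (hκ : 0 < κ) :
    Tendsto (fun z => (z - p) * cauchyTransform μ z)
      (𝓝[{z | z ≠ p ∧ ∀ x ∈ Metric.ball z (κ * ‖z - p‖), x ∉ μ.support}] p)
      (𝓝 (μ.real {p} : ℂ)) := by
  have h1 : (μ.real {p} : ℂ) = ∫ ζ, ({p} : Set ℂ).indicator (fun _ => (1 : ℂ)) ζ ∂μ := by
    rw [integral_indicator_const _ (measurableSet_singleton p)]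
    simp
  have h2 : ∀ z, (z - p) * cauchyTransform μ z = ∫ ζ, (z - p) * (1 / (z - ζ)) ∂μ := fun z => by
    rw [cauchyTransform, integral_const_mul]
  rw [h1]
  simp only [h2]
  -- The empty disc gives |z - ζ| ≥ κ|z - p|, so the integrand is bounded by 1/κ; pointwise it tends
  -- to the indicator of {p}.
  refine tendsto_integral_filter_of_dominated_convergence (fun _ => 1 / κ) ?_ ?_
    (integrable_const _) (Eventually.of_forall fun ζ => ?_)
  · refine Eventually.of_forall fun z => ?_
    exact (measurable_const.mul (measurable_const.div (measurable_const.sub measurable_id))).aestronglyMeasurable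
  · filter_upwards [self_mem_nhdsWithin] with z hz
    have hzp : 0 < ‖z - p‖ := norm_pos_iff.2 (sub_ne_zero.2 hz.1)
    filter_upwards [ae_norm_sub_ge_of_ball_disjoint_support hz.2] with ζ hζ
    have h3 : 0 < ‖z - ζ‖ := (mul_pos hκ hzp).trans_le hζ
    rw [norm_mul, norm_div, norm_one, mul_one_div, div_le_div_iff₀ h3 hκ]
    linarith
  · by_cases hζ : ζ = p
    · subst hζ
      refine tendsto_const_nhds.congr' ?_
      filter_upwards [self_mem_nhdsWithin] with z hz
      have : z - ζ ≠ 0 := sub_ne_zero.2 hz.1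
      simp [this]
    · rw [indicator_of_notMem (by simpa using hζ)]
      have hc : ContinuousAt (fun z : ℂ => (z - p) * (1 / (z - ζ))) p := by
        have : p - ζ ≠ 0 := sub_ne_zero.2 (Ne.symm hζ)
        fun_prop (disch := assumption)
      have := hc.tendsto
      simp only [sub_self, zero_mul] at this
      exact this.mono_left nhdsWithin_le_nhds

theorem eventually_re_neg_of_tendsto {D : ℂ → ℂ} {θ : ℝ} {k : ℤ} {β e : ℂ}
    (hD : Tendsto (fun ζ : ℂ => (Real.exp (-(k * ζ.re)) : ℂ) * D (Complex.exp ζ)) (angleFilter θ)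
        (𝓝 β)) (he : (β * e).re < 0) :
    ∀ᶠ v in angleFilter θ ×ˢ 𝓝 e, (D (Complex.exp v.1) * v.2).re < 0 := by
  have h1 := eventually_re_pos_of_tendsto (D := fun s => -D s) (β := -β) (e := e)
    (hD.neg.congr fun ζ => by ring) (by simpa [neg_mul] using he)
  filter_upwards [h1] with v hv
  rw [neg_mul, Complex.neg_re] at hv
  linarith

/-- Given finitely many meromorphic functions, one of which does not tend to `a`, there is a
direction `e` and an index `m` such that `E m` dominates the others in direction `e`. -/
theorem exists_dominating_direction {ι : Type*} [Finite ι] {E : ι → ℂ → ℂ}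
    (hE : ∀ l, MeromorphicAt (E l) 0)
    (hne : ∀ i j, i ≠ j → meromorphicOrderAt (fun s => E i s - E j s) 0 ≠ ⊤) (θ : ℝ) (L : Set ι)
    {l : ι} (hl : l ∈ L) {a : ℂ} (hcon : ¬ Tendsto (E l) (𝓝[≠] 0) (𝓝 a)) :
    ∃ m ∈ L, ∃ e : ℂ, ∃ c > 0, ∃ η > 0, ∀ᶠ ζ in angleFilter θ,
      c ≤ ((E m (Complex.exp ζ) - a) * e).re ∧ ∀ e' ∈ Metric.ball e η, ∀ j ∈ L, j ≠ m →
        0 < ((E m (Complex.exp ζ) - E j (Complex.exp ζ)) * e').re := by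
  set H : ℂ → ℂ := fun s => E l s - a with hH
  have hHm : MeromorphicAt H 0 := (hE l).sub (MeromorphicAt.const _ _)
  have hHpos : ¬ 0 < meromorphicOrderAt H 0 := by
    rw [← tendsto_zero_iff_meromorphicOrderAt_pos hHm]
    intro h1
    refine hcon ?_
    have := h1.add_const a
    simpa [hH] using this
  obtain ⟨k, β, hk, hβ, hlim⟩ := exists_tendsto_angleFilter hHm
    (fun h => hHpos (by rw [h]; exact WithTop.top_pos)) θ
  have hk0 : k ≤ 0 := by
    rw [hk] at hHpos
    exact_mod_cast not_lt.1 hHpos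
  have hpair : ∀ v : ι × ι, ∃ (k : ℤ) (β : ℂ), v.1 ≠ v.2 → β ≠ 0 ∧
      Tendsto (fun ζ : ℂ => (Real.exp (-(k * ζ.re)) : ℂ) *
        (E v.1 (Complex.exp ζ) - E v.2 (Complex.exp ζ))) (angleFilter θ) (𝓝 β) := by
    intro v
    by_cases hv : v.1 = v.2
    · exact ⟨0, 0, fun h => absurd hv h⟩
    · obtain ⟨k, β, -, h1, h2⟩ := exists_tendsto_angleFilter ((hE v.1).sub (hE v.2))
        (hne _ _ hv) θ
      exact ⟨k, β, fun _ => ⟨h1, h2⟩⟩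
  choose K b hb using hpair
  obtain ⟨e, he0, he⟩ := exists_generic_direction hβ b
  have hc0 : 0 < (β * e).re / 2 := half_pos he0
  -- Because E l does not tend to a, the order k of H is at most 0; then |s|^(-k) ≤ 1, and H itself
  -- inherits the lower bound.
  have ev1 : ∀ᶠ ζ in angleFilter θ, (β * e).re / 2 ≤ (H (Complex.exp ζ) * e).re := by
    have h1 : Tendsto (fun ζ : ℂ => ((Real.exp (-(k * ζ.re)) : ℂ) * H (Complex.exp ζ) * e).re)
        (angleFilter θ) (𝓝 (β * e).re) :=
      (Complex.continuous_re.tendsto _).comp (hlim.mul_const e)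
    have h2 : ∀ᶠ ζ in angleFilter θ, ζ.re < 0 :=
      eventually_angleFilter.2 ⟨0, 1, one_pos, fun ζ h _ => h⟩
    filter_upwards [h1.eventually (lt_mem_nhds (half_lt_self he0)), h2] with ζ h3 h4
    rw [mul_assoc, Complex.re_ofReal_mul] at h3
    have h5 : Real.exp (-(k * ζ.re)) ≤ 1 := by
      rw [Real.exp_le_one_iff]
      have : (k : ℝ) ≤ 0 := by exact_mod_cast hk0
      nlinarith
    have h6 : 0 < (H (Complex.exp ζ) * e).re :=
      pos_of_mul_pos_right (hc0.trans h3) (Real.exp_pos _).le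
    exact h3.le.trans (mul_le_of_le_one_left h6.le h5)
  have ev2 : ∀ q : ι × ι, ∀ᶠ v in angleFilter θ ×ˢ 𝓝 e, q.1 ≠ q.2 →
      (0 < (b q * e).re → 0 < ((E q.1 (Complex.exp v.1) - E q.2 (Complex.exp v.1)) * v.2).re) ∧
      (¬ 0 < (b q * e).re →
        ((E q.1 (Complex.exp v.1) - E q.2 (Complex.exp v.1)) * v.2).re < 0) := by
    intro q
    by_cases hq : q.1 ≠ q.2
    · by_cases hq' : 0 < (b q * e).re
      · filter_upwards [eventually_re_pos_of_tendsto
          (D := fun s => E q.1 s - E q.2 s) (hb q hq).2 hq'] with v hv _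
        exact ⟨fun _ => hv, fun h => absurd hq' h⟩
      · have h2 := lt_of_le_of_ne (not_lt.1 hq') (he q (hb q hq).1)
        filter_upwards [eventually_re_neg_of_tendsto
          (D := fun s => E q.1 s - E q.2 s) (hb q hq).2 h2] with v hv _
        exact ⟨fun h => absurd h hq', fun _ => hv⟩
    · exact Eventually.of_forall fun _ h1 => absurd h1 hq
  obtain ⟨P1, hP1, P2, hP2, hP⟩ := eventually_prod_iff.1 (eventually_all.2 ev2)
  obtain ⟨η, hη, hball⟩ := Metric.eventually_nhds_iff_ball.1 hP2
  have hne : (angleFilter θ).NeBot := by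
    refine ⟨fun h => ?_⟩
    have : ∀ᶠ ζ in angleFilter θ, False := by rw [h]; exact eventually_bot
    obtain ⟨X, δ, hδ, h'⟩ := eventually_angleFilter.1 this
    exact h' ⟨X - 1, θ⟩ (by simp) (by simpa using hδ)
  obtain ⟨ζ₁, hζ₁⟩ := (hP1).exists
  -- By genericity of e each pairwise comparison has a constant sign along the filter, so a
  -- maximiser at one sample point is the maximiser throughout.
  obtain ⟨m, hmL, hmax⟩ := (toFinite L).exists_maximalFor
    (fun j => (E j (Complex.exp ζ₁) * e).re) L ⟨l, hl⟩
  have htop : ∀ j ∈ L, j ≠ m → 0 < (b (m, j) * e).re := by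
    intro j hj hjm
    by_contra hn
    have h1 := (hP hζ₁ (hball e (Metric.mem_ball_self hη)) (m, j) hjm.symm).2 hn
    simp only [sub_mul, Complex.sub_re] at h1
    have h2 := hmax hj (by simp only; linarith)
    simp only at h2
    linarith
  refine ⟨m, hmL, e, _, hc0, η, hη, ?_⟩
  filter_upwards [ev1, hP1] with ζ h1 h2
  have h3 : ∀ e' ∈ Metric.ball e η, ∀ j ∈ L, j ≠ m →
        0 < ((E m (Complex.exp ζ) - E j (Complex.exp ζ)) * e').re := fun e' he' j hj hjm =>
    (hP h2 (hball e' he') (m, j) hjm.symm).1 (htop j hj hjm)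
  refine ⟨?_, h3⟩
  by_cases hlm : l = m
  · rw [← hlm]; exact h1
  · have := h3 e (Metric.mem_ball_self hη) l hl hlm
    have e1 : (E m (Complex.exp ζ) - a) * e =
      (E m (Complex.exp ζ) - E l (Complex.exp ζ)) * e + H (Complex.exp ζ) * e := by
      simp only [hH]; ring
    rw [e1, Complex.add_re]
    linarith

/-! ### Branches occurring near p have the residue given by the point mass -/

namespace LogRoots

variable {ι : Type} {μ : Measure ℂ} {p : ℂ} {N : ℕ} {X : ℝ} {g : ι → ℂ → ℂ}

theorem meromorphicOrderAt_sub_ne_top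
    (h : LogRoots μ p N X fun l ζ => g l (Complex.exp ζ)) (hg : ∀ l, MeromorphicAt (g l) 0)
    {i j : ι} (hij : i ≠ j) :
    meromorphicOrderAt (fun s => N * s ^ N * g i s - N * s ^ N * g j s) 0 ≠ ⊤ := by
  have hm : ∀ l, MeromorphicAt (fun s => N * s ^ N * g l s) 0 := fun l => by
    have := hg l
    fun_prop
  refine (meromorphicOrderAt_ne_top_iff_eventually_ne_zero ((hm i).sub (hm j))).2 ?_
  have h1 : ∀ᶠ s in 𝓝[≠] (0 : ℂ), ‖s‖ < Real.exp X := by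
    have : Tendsto (fun s : ℂ => ‖s‖) (𝓝[≠] 0) (𝓝 0) := by
      simpa using (continuous_norm (E := ℂ)).continuousAt.tendsto.mono_left
        (nhdsWithin_le_nhds (a := (0 : ℂ)) (s := {0}ᶜ))
    exact this.eventually (gt_mem_nhds (Real.exp_pos X))
  filter_upwards [h1, self_mem_nhdsWithin] with s hs hs0 he
  have hs0' : s ≠ 0 := hs0
  have h2 : (Complex.log s).re < X := by
    rw [Complex.log_re]
    exact (Real.log_lt_iff_lt_exp (norm_pos_iff.2 hs0')).2 hs
  refine hij (h.inj _ h2 ?_)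
  simp only [Complex.exp_log hs0']
  have h3 : (N : ℂ) * s ^ N ≠ 0 := mul_ne_zero (by exact_mod_cast h.pos.ne') (pow_ne_zero _ hs0')
  exact mul_left_cancel₀ h3 (sub_eq_zero.1 he)

variable [Finite ι] [IsFiniteMeasure μ]

/-- If a branch occurs arbitrarily near `p` tangentially to some direction, then `(z - p)` times
the branch tends to the point mass at `p`. -/
theorem tendsto_of_frequently (h : LogRoots μ p N X fun l ζ => g l (Complex.exp ζ))
    (hg : ∀ l, MeromorphicAt (g l) 0) {B : ℝ} (hB : ∀ᵐ ζ ∂μ, ‖ζ‖ ≤ B)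
    (h0 : volume μ.support = 0) {θ : ℝ} {l : ι}
    (hl : ∃ᶠ ζ in angleFilter θ,
      OnBranch μ (logChart p N) (fun ζ => g l (Complex.exp ζ)) ζ) :
    Tendsto (fun s => N * s ^ N * g l s) (𝓝[≠] 0) (𝓝 (N * μ.real {p})) := by
  by_contra hcon
  set E : ι → ℂ → ℂ := fun l s => N * s ^ N * g l s with hE
  have hEm : ∀ l, MeromorphicAt (E l) 0 := fun l => by
    have := hg l
    fun_prop
  set L : Set ι := {m | ∃ᶠ ζ in angleFilter θ,
      OnBranch μ (logChart p N) (fun ζ => g m (Complex.exp ζ)) ζ} with hL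
  obtain ⟨m, hmL, e, c, hc, η, hη, hev⟩ := exists_dominating_direction hEm
    (fun i j hij => h.meromorphicOrderAt_sub_ne_top hg hij) θ L hl hcon
  have ev3 : ∀ᶠ ζ in angleFilter θ, ∀ m,
      OnBranch μ (logChart p N) (fun ζ => g m (Complex.exp ζ)) ζ → m ∈ L := by
    refine eventually_all.2 fun m => ?_
    by_cases hm : m ∈ L
    · exact Eventually.of_forall fun _ _ => hm
    · filter_upwards [not_frequently.1 hm] with ζ h1 h2 using absurd h2 h1
  obtain ⟨X₁, δ, hδ, hbox⟩ := eventually_angleFilter.1 (hev.and ev3)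
  set X₂ := min X X₁ with hX₂
  set V : Set ℂ := {ζ | ζ.re < X₂ ∧ |ζ.im - θ| < δ} with hV
  have hVo : IsOpen V := (isOpen_re_lt X₂).inter
    (isOpen_lt (Complex.continuous_im.sub continuous_const).abs continuous_const)
  have hVb := fun ζ (hζ : ζ ∈ V) => hbox ζ (hζ.1.trans_le (min_le_right _ _)) hζ.2
  -- With this ε, every displacement ε e' with e' in the η-ball about e has norm less than δ/4 and
  -- stays in the region V.
  have hM : 0 < ‖e‖ + η := by positivity
  set ε := δ / (4 * (‖e‖ + η)) with hε
  have hε0 : 0 < ε := by positivity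
  have hεM : ε * (‖e‖ + η) = δ / 4 := by rw [hε]; field_simp
  -- A relative displacement y in the z-plane costs log(1 + y)/N in the chart, of norm at most
  -- (3/2)|y| for |y| ≤ 1/2. With |y| < κ this stays below εη, inside the ball filled by the branch.
  set κ := min (1 / 2) (ε * η / 2) with hκ
  have hκ0 : 0 < κ := lt_min (by norm_num) (by positivity)
  have hN : (0 : ℝ) < N := by exact_mod_cast h.pos
  -- Within this distance of μ({p}), the quantity N|(z - p) μ̂ - μ({p})| ‖e‖ is less than c, against
  -- the lower bound supplied by `hev`.
  have hc' : 0 < c / (N * (‖e‖ + 1)) := by positivity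
  have ev4 := eventually_nhdsWithin_iff.1 ((Metric.tendsto_nhds.1
    (tendsto_sub_mul_cauchyTransform μ p hκ0)) _ hc')
  have hlim : Tendsto (fun q => logChart p N (q + ε * e)) (angleFilter θ) (𝓝 p) := by
    have h1 : Tendsto (fun s : ℂ => p + s ^ N * Complex.exp (N * (ε * e))) (𝓝[≠] 0) (𝓝 p) := by
      have hcont : Continuous fun s : ℂ => p + s ^ N * Complex.exp (N * (ε * e)) := by fun_prop
      exact (hcont.tendsto' 0 p (by simp [h.pos.ne'])).mono_left nhdsWithin_le_nhds
    refine (h1.comp (tendsto_exp_angleFilter θ)).congr fun q => ?_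
    simp only [Function.comp, logChart]
    rw [← Complex.exp_nat_mul, ← Complex.exp_add, mul_add]
  have ev5 : ∀ᶠ q in angleFilter θ, q.re < X₂ - δ ∧ |q.im - θ| < δ / 2 :=
    eventually_angleFilter.2 ⟨X₂ - δ, δ / 2, by positivity, fun ζ h1 h2 => ⟨h1, h2⟩⟩
  obtain ⟨q, hq, ⟨hq1, hq2⟩, hq3⟩ :=
    ((show ∃ᶠ ζ in angleFilter θ, _ from hmL).and_eventually (ev5.and (hlim.eventually ev4))).exists
  -- the branch spreads over a ball
  have hspread : ∀ w : ℂ, ‖w - ε * e‖ < ε * η →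
      OnBranch μ (logChart p N) (fun ζ => g m (Complex.exp ζ)) (q + w) ∧ q + w ∈ V := by
    intro w hw
    have hwn : ‖w‖ < δ / 4 := by
      calc ‖w‖ = ‖(w - ε * e) + ε * e‖ := by rw [sub_add_cancel]
        _ ≤ ‖w - ε * e‖ + ‖(ε : ℂ) * e‖ := norm_add_le _ _
        _ < ε * η + ε * ‖e‖ := by
          rw [norm_mul, Complex.norm_real, Real.norm_of_nonneg hε0.le]
          linarith
        _ = δ / 4 := by rw [← hεM]; ring
    have hmem : ∀ t ∈ Icc (0 : ℝ) 1, q + t * w ∈ V := by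
      intro t ht
      have h1 : ‖(t : ℂ) * w‖ ≤ ‖w‖ := by
        rw [norm_mul, Complex.norm_real, Real.norm_of_nonneg ht.1]
        exact mul_le_of_le_one_left (norm_nonneg _) ht.2
      have h2 := (Complex.abs_re_le_norm _).trans h1
      have h3 := (Complex.abs_im_le_norm _).trans h1
      refine ⟨?_, ?_⟩
      · rw [Complex.add_re]
        linarith [le_abs_self ((t : ℂ) * w).re]
      · rw [Complex.add_im, add_sub_right_comm]
        exact (abs_add_le _ _).trans_lt (by linarith)
    have hmem1 : q + w ∈ V := by simpa using hmem 1 ⟨zero_le_one, le_rfl⟩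
    refine ⟨?_, hmem1⟩
    have := h.propagate hB h0 hVo (fun ζ hζ => hζ.1.trans_le (min_le_left _ _)) (L := L)
      (fun ζ hζ => (hVb ζ hζ).2) (m := m) (a := 0) (b := 1) zero_le_one
      (γ := fun t => q + t * w) (γ' := fun _ => w) (fun t _ => by
        have := ((hasDerivAt_id t).ofReal_comp.mul_const w).const_add q
        simpa using this) hmem (fun t ht j hj hjm => ?_) (by simpa using hq)
    · simpa using this
    · have h1 := (hVb _ (hmem t ht)).1.2 (w / ε) (by
        have hεc : (ε : ℂ) ≠ 0 := by exact_mod_cast hε0.ne'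
        have : w / ε - e = (w - ε * e) / ε := by field_simp
        rw [Metric.mem_ball, dist_eq_norm, this, norm_div, Complex.norm_real,
          Real.norm_of_nonneg hε0.le, div_lt_iff₀ hε0]
        linarith) j hj hjm
      have h2 : N * Complex.exp (N * (q + t * w)) * (g m (Complex.exp (q + t * w)) -
          g j (Complex.exp (q + t * w))) * w =
          (ε : ℂ) * ((E m (Complex.exp (q + t * w)) - E j (Complex.exp (q + t * w))) * (w / ε)) := by
        have hεc : (ε : ℂ) ≠ 0 := by exact_mod_cast hε0.ne'
        simp only [hE, ← Complex.exp_nat_mul]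
        field_simp
      rw [h2, Complex.re_ofReal_mul]
      exact mul_pos hε0 h1
  obtain ⟨hb, hbV⟩ := hspread (ε * e) (by simpa using mul_pos hε0 hη)
  set z₁ := logChart p N (q + ε * e) with hz₁
  have hz₁p : z₁ - p = Complex.exp (N * (q + ε * e)) := by simp [hz₁, logChart]
  have hz₁0 : z₁ - p ≠ 0 := by rw [hz₁p]; exact Complex.exp_ne_zero _
  have hfree : ∀ x ∈ Metric.ball z₁ (κ * ‖z₁ - p‖), x ∉ μ.support := by
    intro x hx
    rw [Metric.mem_ball, dist_eq_norm] at hx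
    set y := (x - z₁) / (z₁ - p) with hy
    have hyκ : ‖y‖ < κ := by
      rw [hy, norm_div, div_lt_iff₀ (norm_pos_iff.2 hz₁0)]
      exact hx
    have hy2 : ‖y‖ ≤ 1 / 2 := hyκ.le.trans (min_le_left _ _)
    have hy1 : 1 + y ≠ 0 := by
      intro h1
      have : y = -1 := by linear_combination h1
      rw [this] at hy2
      norm_num at hy2
    have hlog := Complex.norm_log_one_add_half_le_self hy2
    have hw : ‖(ε * e + Complex.log (1 + y) / N) - ε * e‖ < ε * η := by
      rw [add_sub_cancel_left, norm_div, Complex.norm_natCast, div_lt_iff₀ hN]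
      have h1 : (1 : ℝ) ≤ N := by exact_mod_cast h.pos
      have h2 : κ ≤ ε * η / 2 := min_le_right _ _
      have h3 : 0 < ε * η := by positivity
      nlinarith
    have hx' : logChart p N (q + (ε * e + Complex.log (1 + y) / N)) = x := by
      have hNc : (N : ℂ) ≠ 0 := by exact_mod_cast h.pos.ne'
      have e1 : (N : ℂ) * (q + (ε * e + Complex.log (1 + y) / N)) =
          N * (q + ε * e) + Complex.log (1 + y) := by field_simp; ring
      rw [logChart, e1, Complex.exp_add, Complex.exp_log hy1, ← hz₁p, hy]
      field_simp
      ring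
    rw [← hx']
    exact (hspread _ hw).1.notMem
  have h6 := hq3 ⟨sub_ne_zero.1 hz₁0, hfree⟩
  have h7 := (hVb _ hbV).1.1
  have h8 : E m (Complex.exp (q + ε * e)) = N * ((z₁ - p) * cauchyTransform μ z₁) := by
    have := hb.eq
    simp only [← hz₁] at this
    rw [this, hz₁p, Complex.exp_nat_mul, ← mul_assoc]
  rw [h8, ← mul_sub] at h7
  rw [dist_eq_norm] at h6
  have h9 := (h7.trans (le_abs_self _)).trans (Complex.abs_re_le_norm _)
  rw [norm_mul, norm_mul, Complex.norm_natCast] at h9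
  rw [lt_div_iff₀ (by positivity)] at h6
  have h10 := norm_nonneg ((z₁ - p) * cauchyTransform μ z₁ - (μ.real {p} : ℂ))
  nlinarith [norm_nonneg e, mul_nonneg hN.le h10]

end LogRoots

/-! ### Zeros of the real part of an analytic germ in a thin sector -/

section CriticalPair

/-- `r e ^ {i t}` -/
noncomputable def polarPoint (r t : ℝ) : ℂ := r * Complex.exp (t * Complex.I)

theorem polarPoint_zero (t : ℝ) : polarPoint 0 t = 0 := by simp [polarPoint]

theorem norm_polarPoint {r : ℝ} (hr : 0 ≤ r) (t : ℝ) : ‖polarPoint r t‖ = r := by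
  rw [polarPoint, norm_mul, Complex.norm_exp_ofReal_mul_I, Complex.norm_real,
    Real.norm_of_nonneg hr, mul_one]

theorem norm_polarPoint_sub_le {r : ℝ} (hr : 0 ≤ r) (t t' : ℝ) :
    ‖polarPoint r t - polarPoint r t'‖ ≤ r * |t - t'| := by
  have h : polarPoint r t - polarPoint r t' =
      r * (Complex.exp (t' * Complex.I) * (Complex.exp (Complex.I * (t - t' : ℝ)) - 1)) := by
    rw [mul_sub, ← Complex.exp_add, polarPoint, polarPoint, mul_one, mul_sub]
    congr 4
    push_cast; ring
  rw [h, norm_mul, norm_mul, Complex.norm_exp_ofReal_mul_I, Complex.norm_real,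
    Real.norm_of_nonneg hr, one_mul]
  exact mul_le_mul_of_nonneg_left (Real.norm_exp_I_mul_ofReal_sub_one_le) hr

theorem continuous_polarPoint : Continuous fun v : ℝ × ℝ => polarPoint v.1 v.2 := by
  unfold polarPoint; fun_prop

open scoped ContDiff in
theorem contDiff_polarPoint {n : WithTop ℕ∞} :
    ContDiff ℝ n fun v : ℝ × ℝ => polarPoint v.1 v.2 := by
  unfold polarPoint
  have h1 : ContDiff ℝ n fun v : ℝ × ℝ => (v.1 : ℂ) :=
    Complex.ofRealCLM.contDiff.comp contDiff_fst
  have h2 : ContDiff ℝ n fun v : ℝ × ℝ => (v.2 : ℂ) :=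
    Complex.ofRealCLM.contDiff.comp contDiff_snd
  exact h1.mul (h2.mul contDiff_const).cexp

/-- The nonvanishing factor of F is written as an exponential. Then the argument of F is explicit,
and s F'/F = k + s λ' controls its derivative along curves. -/
theorem exists_pow_mul_exp {F : ℂ → ℂ} (hF : AnalyticAt ℂ F 0) (hF0 : F 0 = 0)
    (hne : ¬ ∀ᶠ s in 𝓝 (0 : ℂ), F s = 0) :
    ∃ (k : ℕ) (β : ℂ) (lam : ℂ → ℂ), 1 ≤ k ∧ β ≠ 0 ∧ AnalyticAt ℂ lam 0 ∧ lam 0 = 0 ∧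
      ∀ᶠ s in 𝓝 (0 : ℂ), F s = β * s ^ k * Complex.exp (lam s) ∧
        s * deriv F s = F s * (k + s * deriv lam s) := by
  obtain ⟨k, b, hb, hb0, hFb⟩ := hF.exists_eventuallyEq_pow_smul_nonzero_iff.2 hne
  simp only [sub_zero, smul_eq_mul] at hFb
  have hk : 1 ≤ k := by
    rcases Nat.eq_zero_or_pos k with rfl | h
    · have := hFb.self_of_nhds
      rw [hF0, pow_zero, one_mul] at this
      exact absurd this.symm hb0
    · exact h
  have hbd : AnalyticAt ℂ (fun s => b s / b 0) 0 := hb.div analyticAt_const hb0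
  have hlam : AnalyticAt ℂ (fun s => Complex.log (b s / b 0)) 0 :=
    hbd.clog (by simp [hb0])
  refine ⟨k, b 0, fun s => Complex.log (b s / b 0), hk, hb0, hlam, by simp [hb0], ?_⟩
  have h1 : ∀ᶠ s in 𝓝 (0 : ℂ), F s = b 0 * s ^ k * Complex.exp (Complex.log (b s / b 0)) := by
    filter_upwards [hFb, hb.continuousAt.eventually_ne hb0] with s h1 h2
    rw [h1, Complex.exp_log (div_ne_zero h2 hb0)]
    field_simp
  filter_upwards [h1.eventually_nhds, hlam.eventually_analyticAt] with s h2 h3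
  refine ⟨h2.self_of_nhds, ?_⟩
  have h4 : F =ᶠ[𝓝 s] fun s => b 0 * s ^ k * Complex.exp (Complex.log (b s / b 0)) := h2
  have h5 : HasDerivAt (fun s => b 0 * s ^ k * Complex.exp (Complex.log (b s / b 0)))
      (b 0 * (k * s ^ (k - 1)) * Complex.exp (Complex.log (b s / b 0)) +
        b 0 * s ^ k * (Complex.exp (Complex.log (b s / b 0)) *
          deriv (fun s => Complex.log (b s / b 0)) s)) s :=
    ((hasDerivAt_pow k s).const_mul (b 0)).mul h3.differentiableAt.hasDerivAt.cexp
  rw [h4.deriv_eq, h5.deriv, h2.self_of_nhds]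
  obtain ⟨n, rfl⟩ := Nat.exists_eq_add_of_le' hk
  rw [Nat.add_sub_cancel]
  ring

/-- Points at the same radius are at distance at most r|t - t'|. The factor r is the gain: in the
angular variable the Lipschitz constant tends to 0. -/
theorem exists_polar_lipschitz {h : ℂ → ℂ} (hh : AnalyticAt ℂ h 0) :
    ∃ M > 0, ∃ δ > 0, ∀ r, 0 ≤ r → r < δ → ∀ t t' : ℝ,
      ‖h (polarPoint r t) - h (polarPoint r t')‖ ≤ M * r * |t - t'| := by
  obtain ⟨K, t, ht, hK⟩ := (hh.contDiffAt (n := 1)).exists_lipschitzOnWith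
  obtain ⟨δ, hδ, hb⟩ := Metric.mem_nhds_iff.1 ht
  refine ⟨K + 1, by positivity, δ, hδ, fun r hr hrδ a b => ?_⟩
  have hm : ∀ a, polarPoint r a ∈ t := fun a => hb (by
    rw [Metric.mem_ball, dist_zero_right, norm_polarPoint hr]; exact hrδ)
  have h1 := hK.dist_le_mul _ (hm a) _ (hm b)
  rw [dist_eq_norm, dist_eq_norm] at h1
  have h2 := norm_polarPoint_sub_le hr a b
  have h3 : 0 ≤ r * |a - b| := by positivity
  calc _ ≤ K * ‖polarPoint r a - polarPoint r b‖ := h1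
    _ ≤ K * (r * |a - b|) := mul_le_mul_of_nonneg_left h2 K.2
    _ ≤ _ := by nlinarith

theorem mul_cos_le_sin {q : ℝ} (h0 : 0 ≤ q) (h1 : q < 1) : q * Real.cos q ≤ Real.sin q := by
  have hpi := Real.pi_gt_three
  have hc : 0 < Real.cos q := Real.cos_pos_of_mem_Ioo ⟨by linarith, by linarith⟩
  have := Real.le_tan h0 (by linarith)
  rwa [Real.tan_eq_sin_div_cos, le_div_iff₀ hc] at this

/-- Since q cos q ≤ sin q, the term b cos q is at least -(3/4) sin q, which a ≥ 7/8 outweighs. -/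
theorem sin_mul_pos_aux {a b q : ℝ} (hq0 : 0 < q) (hq : q < 1) (ha : 7 / 8 ≤ a)
    (hb : -(3 / 4) * q ≤ b) : 0 < Real.sin q * (a * Real.sin q + b * Real.cos q) := by
  have hpi := Real.pi_gt_three
  have hc : 0 < Real.cos q := Real.cos_pos_of_mem_Ioo ⟨by linarith, by linarith⟩
  have hs : 0 < Real.sin q := Real.sin_pos_of_pos_of_lt_pi hq0 (by linarith)
  have h1 := mul_cos_le_sin hq0.le hq
  refine mul_pos hs ?_
  nlinarith

theorem sin_mul_pos {a b q : ℝ} (hq0 : q ≠ 0) (hq : |q| < 1) (ha : 7 / 8 ≤ a)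
    (hb : -(3 / 4) * q ^ 2 ≤ b * q) : 0 < Real.sin q * (a * Real.sin q + b * Real.cos q) := by
  rcases lt_or_gt_of_ne hq0 with h | h
  · have h1 := sin_mul_pos_aux (a := a) (b := -b) (q := -q) (by linarith)
      (by rwa [abs_of_neg h] at hq) ha (by nlinarith)
    rw [Real.sin_neg, Real.cos_neg] at h1
    linarith
  · exact sin_mul_pos_aux h (by rwa [abs_of_pos h] at hq) ha (by nlinarith)

/-- Here q and b are small perturbations of k y and k z, where y is the angular distance to an arc
and z its rate of change. The gap between 5/8 and 3/4 absorbs the errors. -/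
theorem direction_estimate {k y z q b η : ℝ} (hk : 1 ≤ k) (hη0 : 0 ≤ η) (hη : η ≤ 1 / 32)
    (hq : |q - k * y| ≤ η * |y|) (hb : |b - k * z| ≤ η * (2 * |y| + |z|))
    (hzy : -(5 / 8) * y ^ 2 ≤ y * z) : -(3 / 4) * q ^ 2 ≤ b * q := by
  by_cases hy : y = 0
  · subst hy
    simp only [mul_zero, sub_zero, abs_zero] at hq
    have : q = 0 := abs_nonpos_iff.1 hq
    simp [this]
  have hy2 : 0 < y ^ 2 := by positivity
  set c := q / y with hc
  have hqc : q = c * y := by rw [hc]; field_simp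
  have hcb : |c - k| ≤ η := by
    have : |c - k| * |y| ≤ η * |y| := by
      rw [← abs_mul, sub_mul, ← hqc]; exact hq
    exact le_of_mul_le_mul_right this (abs_pos.2 hy)
  obtain ⟨hc1, hc2⟩ := abs_le.1 hcb
  have hby : -(5 / 8 * k + 3 * η) * y ^ 2 ≤ b * y := by
    have h1 : |(b - k * z) * y| ≤ η * (2 * y ^ 2 + |y * z|) := by
      rw [abs_mul, abs_mul, ← sq_abs y]
      calc |b - k * z| * |y| ≤ η * (2 * |y| + |z|) * |y| :=
            mul_le_mul_of_nonneg_right hb (abs_nonneg _)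
        _ = _ := by ring
    have h2 := (abs_le.1 h1).1
    rcases le_or_gt 0 (y * z) with h | h
    · rw [abs_of_nonneg h] at h2
      nlinarith
    · rw [abs_of_neg h] at h2
      nlinarith
  rw [hqc]
  have hcpos : 0 < c := by linarith
  have h3 : c * (-(5 / 8 * k + 3 * η) * y ^ 2) ≤ c * (b * y) :=
    mul_le_mul_of_nonneg_left hby hcpos.le
  -- With c ≥ k - η this amounts to 15η/4 ≤ k/8, which k ≥ 1 and η ≤ 1/32 ensure.
  have h4 : 5 / 8 * k + 3 * η ≤ 3 / 4 * c := by linarith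
  have h5 : c * ((5 / 8 * k + 3 * η) * y ^ 2) ≤ c * (3 / 4 * c * y ^ 2) :=
    mul_le_mul_of_nonneg_left (mul_le_mul_of_nonneg_right h4 hy2.le) hcpos.le
  nlinarith

end CriticalPair

section CriticalPair

theorem pow_mul_exp_polarPoint (k : ℕ) (β l : ℂ) (r θ u : ℝ) :
    β * polarPoint r (θ + u) ^ k * Complex.exp l = ((r ^ k * Real.exp l.re : ℝ) : ℂ) *
      (β * Complex.exp (k * θ * Complex.I) * Complex.exp ((k * u + l.im : ℝ) * Complex.I)) := by
  rw [polarPoint, mul_pow, ← Complex.exp_nat_mul]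
  push_cast
  have h : Complex.exp l = Complex.exp l.re * Complex.exp (l.im * Complex.I) := by
    rw [← Complex.exp_add, Complex.re_add_im]
  rw [h, add_mul ((k : ℂ) * u), Complex.exp_add (_ * _) ((l.im : ℂ) * _), add_mul (θ : ℂ), mul_add,
    Complex.exp_add, ← mul_assoc (k : ℂ) θ, ← mul_assoc (k : ℂ) u]
  ring

theorem eventually_polarPoint {P : ℂ → Prop} (hP : ∀ᶠ s in 𝓝 (0 : ℂ), P s) :
    ∀ᶠ r in 𝓝[>] (0 : ℝ), ∀ t : ℝ, P (polarPoint r t) := by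
  obtain ⟨δ, hδ, h⟩ := Metric.eventually_nhds_iff_ball.1 hP
  filter_upwards [Ioo_mem_nhdsGT hδ] with r hr t
  refine h _ ?_
  rw [Metric.mem_ball, dist_zero_right, norm_polarPoint hr.1.le]
  exact hr.2

theorem exists_of_eventually_nhdsGT {P : ℝ → Prop} (hP : ∀ᶠ r in 𝓝[>] (0 : ℝ), P r) :
    ∃ δ > 0, ∀ r, 0 < r → r < δ → P r := by
  obtain ⟨δ, hδ, h⟩ := mem_nhdsGT_iff_exists_Ioo_subset.1 hP
  exact ⟨δ, hδ, fun r h1 h2 => h ⟨h1, h2⟩⟩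

theorem eventually_norm_le_nhds_zero {h : ℂ → ℂ} (hc : ContinuousAt h 0) (h0 : h 0 = 0) {ε : ℝ}
    (hε : 0 < ε) : ∀ᶠ s in 𝓝 (0 : ℂ), ‖h s‖ ≤ ε := by
  have h1 : Tendsto (fun s => ‖h s‖) (𝓝 0) (𝓝 0) := by simpa [h0] using hc.norm.tendsto
  filter_upwards [h1.eventually (gt_mem_nhds hε)] with s hs using hs.le

open scoped ContDiff in
/-- The level curve `k u + im λ(r e^{i(θ+u)}) = 0` is an analytic graph over the `r`-axis. -/
theorem exists_level_arc {lam : ℂ → ℂ} (hlam : AnalyticAt ℂ lam 0) (hlam0 : lam 0 = 0) {k : ℕ}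
    (hk : 1 ≤ k) (θ : ℝ) :
    ∃ w : ℝ → ℝ, AnalyticAt ℝ w 0 ∧ w 0 = 0 ∧ ∀ᶠ r in 𝓝[>] (0 : ℝ),
      k * w r + (lam (polarPoint r (θ + w r))).im = 0 ∧
      k * (r * deriv w r) + (polarPoint r (θ + w r) * deriv lam (polarPoint r (θ + w r)) *
        (1 + (r * deriv w r : ℝ) * Complex.I)).im = 0 := by
  set ψ : ℝ × ℝ → ℝ := fun v => k * v.2 + (lam (polarPoint v.1 (θ + v.2))).im with hψ
  have hψc : ContDiffAt ℝ ω ψ (0, 0) := by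
    have h1 : ContDiff ℝ ω fun v : ℝ × ℝ => polarPoint v.1 (θ + v.2) :=
      contDiff_polarPoint.comp (contDiff_fst.prodMk (contDiff_const.add contDiff_snd))
    have h2 : ContDiffAt ℝ ω lam (polarPoint 0 (θ + 0)) := by
      rw [polarPoint_zero]
      exact hlam.contDiffAt.restrict_scalars ℝ
    have h3 : ContDiffAt ℝ ω (fun v : ℝ × ℝ => lam (polarPoint v.1 (θ + v.2))) (0, 0) :=
      h2.comp (0, 0) h1.contDiffAt
    exact (contDiffAt_const.mul contDiffAt_snd).add (Complex.imCLM.contDiff.contDiffAt.comp _ h3)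
  have hψ0 : ψ (0, 0) = 0 := by simp [hψ, polarPoint_zero, hlam0]
  have hd : HasDerivAt (fun y => ψ (0, y)) (k : ℝ) 0 := by
    have : (fun y => ψ (0, y)) = fun y : ℝ => (k : ℝ) * y := by
      ext y; simp [hψ, polarPoint_zero, hlam0]
    rw [this]
    simpa using (hasDerivAt_id (0 : ℝ)).const_mul (k : ℝ)
  obtain ⟨w, hw, hw0, hev⟩ := exists_implicitFunction_of_hasDerivAt_ne_zero hψc hψ0 hd
    (by positivity)
  have hwa : AnalyticAt ℝ w 0 := hw.analyticAt
  have hev0 : ∀ᶠ r in 𝓝 (0 : ℝ), ψ (r, w r) = 0 := by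
    have h1 : Tendsto (fun r => (r, w r)) (𝓝 0) (𝓝 (0, 0)) := by
      have := (continuousAt_id (x := (0 : ℝ))).prodMk hw.continuousAt
      simpa [ContinuousAt, hw0] using this
    filter_upwards [h1.eventually hev] with r hr using hr.2 rfl
  have hpt : Tendsto (fun r => polarPoint r (θ + w r)) (𝓝 0) (𝓝 0) := by
    have : ContinuousAt (fun r => polarPoint r (θ + w r)) 0 :=
      continuous_polarPoint.continuousAt.comp
        ((continuousAt_id (x := (0 : ℝ))).prodMk (continuousAt_const.add hw.continuousAt))
    simpa [ContinuousAt, polarPoint_zero] using this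
  refine ⟨w, hwa, hw0, ?_⟩
  filter_upwards [nhdsWithin_le_nhds hev0.eventually_nhds,
    nhdsWithin_le_nhds hwa.eventually_analyticAt,
    nhdsWithin_le_nhds (hpt.eventually hlam.eventually_analyticAt), self_mem_nhdsWithin]
    with r h1 h2 h3 hr
  refine ⟨h1.self_of_nhds, ?_⟩
  have hwd : HasDerivAt w (deriv w r) r := h2.differentiableAt.hasDerivAt
  have e1 : HasDerivAt (fun r : ℝ => polarPoint r (θ + w r))
      (Complex.exp ((θ + w r : ℝ) * Complex.I) + r * (Complex.exp ((θ + w r : ℝ) * Complex.I) *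
        ((deriv w r : ℝ) * Complex.I))) r := by
    have h4 : HasDerivAt (fun r : ℝ => (((θ + w r : ℝ) : ℂ) * Complex.I))
        ((deriv w r : ℝ) * Complex.I) r := ((hwd.const_add θ).ofReal_comp).mul_const _
    have h5 := (hasDerivAt_id r).ofReal_comp.mul h4.cexp
    simp only [id, Complex.ofReal_one, one_mul] at h5
    exact h5
  have e2 : HasDerivAt (fun r : ℝ => lam (polarPoint r (θ + w r))) _ r :=
    h3.differentiableAt.hasDerivAt.comp_of_eq r e1 rfl
  have e3 : HasDerivAt (fun r => ψ (r, w r)) _ r :=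
    (hwd.const_mul (k : ℝ)).add ((Complex.imCLM.hasFDerivAt).comp_hasDerivAt r e2)
  have e4 : HasDerivAt (fun r => ψ (r, w r)) 0 r :=
    (hasDerivAt_const r (0 : ℝ)).congr_of_eventuallyEq h1
  have e5 := e3.unique e4
  rw [Complex.imCLM_apply] at e5
  -- The second identity is the derivative of the first along the arc, multiplied by r.
  have e6 : polarPoint r (θ + w r) * deriv lam (polarPoint r (θ + w r)) *
      (1 + (r * deriv w r : ℝ) * Complex.I) = (r : ℝ) * (deriv lam (polarPoint r (θ + w r)) *
        (Complex.exp ((θ + w r : ℝ) * Complex.I) + r * (Complex.exp ((θ + w r : ℝ) * Complex.I) *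
          ((deriv w r : ℝ) * Complex.I)))) := by
    rw [show polarPoint r (θ + w r) * deriv lam (polarPoint r (θ + w r)) =
      deriv lam (polarPoint r (θ + w r)) * (r * Complex.exp ((θ + w r : ℝ) * Complex.I)) by
        rw [mul_comm, polarPoint]]
    push_cast
    ring
  rw [e6, Complex.im_ofReal_mul, ← mul_zero r, ← e5]
  ring

end CriticalPair

section CriticalPair

theorem re_mul_I_mul (R B c d : ℝ) :
    ((R : ℂ) * (B * Complex.I * (c + d * Complex.I))).re = -(R * B * d) := by
  simp; ring

theorem re_mul_I_mul_mul (R B c d : ℝ) (z : ℂ) :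
    ((R : ℂ) * (B * Complex.I * (c + d * Complex.I)) * z).re =
      -(R * B * (z.re * d + z.im * c)) := by
  simp; ring

/-- The germ-level information on the sign of the real part of an analytic function vanishing at
`0`, near the direction `θ`: off finitely many arcs `u = w r` the real part does not vanish, and it
is strictly monotone along paths that do not approach the arcs too fast. -/
theorem exists_arcs {F : ℂ → ℂ} (hF : AnalyticAt ℂ F 0) (hF0 : F 0 = 0)
    (hne : ¬ ∀ᶠ s in 𝓝 (0 : ℂ), F s = 0) (θ : ℝ) :
    ∃ W : Set (ℝ → ℝ), W.Finite ∧ (∀ w ∈ W, AnalyticAt ℝ w 0 ∧ w 0 = 0) ∧ ∃ δ > 0, ∀ r u : ℝ,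
      0 < r → r < δ → |u| < δ → (∀ w ∈ W, u ≠ w r) →
        (F (polarPoint r (θ + u))).re ≠ 0 ∧
        ∀ v : ℝ, |v| < δ → (∀ w ∈ W, -(5 / 8) * (u - w r) ^ 2 ≤ (u - w r) * (v - r * deriv w r)) →
          0 < (F (polarPoint r (θ + u))).re *
            (polarPoint r (θ + u) * deriv F (polarPoint r (θ + u)) * (1 + v * Complex.I)).re := by
  obtain ⟨k, β, lam, hk, hβ, hlam, hlam0, hev⟩ := exists_pow_mul_exp hF hF0 hne
  set kap : ℂ → ℂ := fun s => s * deriv lam s with hkap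
  have hkapa : AnalyticAt ℂ kap 0 := analyticAt_id.mul hlam.deriv
  have hkap0 : kap 0 = 0 := by simp [hkap]
  set b := β * Complex.exp (k * θ * Complex.I) with hb
  have hb0 : b ≠ 0 := mul_ne_zero hβ (Complex.exp_ne_zero _)
  -- both real parts, up to a positive factor
  have hform : ∀ᶠ r in 𝓝[>] (0 : ℝ), ∀ u : ℝ, ∃ R : ℝ, 0 < R ∧
      F (polarPoint r (θ + u)) = R * (b * Complex.exp
        ((k * u + (lam (polarPoint r (θ + u))).im : ℝ) * Complex.I)) ∧
      polarPoint r (θ + u) * deriv F (polarPoint r (θ + u)) =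
        F (polarPoint r (θ + u)) * (k + kap (polarPoint r (θ + u))) := by
    filter_upwards [eventually_polarPoint hev, self_mem_nhdsWithin] with r h1 hr u
    have hr' : (0 : ℝ) < r := hr
    refine ⟨r ^ k * Real.exp (lam (polarPoint r (θ + u))).re, by positivity, ?_, (h1 _).2⟩
    rw [(h1 _).1, pow_mul_exp_polarPoint]
  by_cases hcrit : b.re = 0
  · -- critical direction
    obtain ⟨w, hwa, hw0, hw⟩ := exists_level_arc hlam hlam0 hk θ
    obtain ⟨M₁, hM₁, δ₁, hδ₁, hLip₁⟩ := exists_polar_lipschitz hlam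
    obtain ⟨M₂, hM₂, δ₂, hδ₂, hLip₂⟩ := exists_polar_lipschitz hkapa
    have hkR : (1 : ℝ) ≤ k := by exact_mod_cast hk
    have hwc : ∀ᶠ r in 𝓝[>] (0 : ℝ), |r * deriv w r| ≤ 1 := by
      have h1 : Tendsto (fun r => |r * deriv w r|) (𝓝 0) (𝓝 0) := by
        have h2 := ((continuousAt_id (x := (0 : ℝ))).mul hwa.deriv.continuousAt).abs.tendsto
        simpa using h2
      filter_upwards [nhdsWithin_le_nhds (h1.eventually (gt_mem_nhds one_pos))] with r hr
        using hr.le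
    have hsm : ∀ᶠ r in 𝓝[>] (0 : ℝ), r < δ₁ ∧ r < δ₂ ∧ M₁ * r ≤ 1 / 32 ∧ M₂ * r ≤ 1 / 64 := by
      have h1 : ∀ c > 0, ∀ᶠ r in 𝓝[>] (0 : ℝ), r < c := fun c hc =>
        nhdsWithin_le_nhds (gt_mem_nhds hc)
      filter_upwards [h1 _ hδ₁, h1 _ hδ₂, h1 (1 / 32 / M₁) (by positivity),
        h1 (1 / 64 / M₂) (by positivity)] with r a1 a2 a3 a4
      rw [lt_div_iff₀ (by positivity)] at a3 a4
      exact ⟨a1, a2, by linarith, by linarith⟩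
    obtain ⟨δ, hδ, hall⟩ := exists_of_eventually_nhdsGT ((hform.and hw).and ((hwc.and hsm).and
      ((eventually_polarPoint (eventually_norm_le_nhds_zero hlam.continuousAt hlam0
        (show (0 : ℝ) < 1 / 4 by norm_num))).and
      (eventually_polarPoint (eventually_norm_le_nhds_zero hkapa.continuousAt hkap0
        (show (0 : ℝ) < 1 / 32 by norm_num))))))
    refine ⟨{w}, finite_singleton w, by simpa using ⟨hwa, hw0⟩, min δ (1 / (2 * k)),
      lt_min hδ (by positivity), fun r u hr hrδ hu hne => ?_⟩
    obtain ⟨⟨hf, hw1, hw2⟩, ⟨hw3, hr1, hr2, hr3, hr4⟩, hl, hkp⟩ :=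
      hall r hr (hrδ.trans_le (min_le_left _ _))
    obtain ⟨R, hR, hFR, hdF⟩ := hf u
    have huw : u ≠ w r := hne w rfl
    set s := polarPoint r (θ + u) with hs
    set sc := polarPoint r (θ + w r) with hsc
    set q := k * u + (lam s).im with hq
    -- The arc satisfies k w + Im λ = 0, so the difference is only the variation of Im λ between two
    -- points at the same radius.
    have hqb : |q - k * (u - w r)| ≤ 1 / 32 * |u - w r| := by
      have e1 : q - k * (u - w r) = (lam s - lam sc).im := by
        rw [Complex.sub_im, hq]; linarith
      rw [e1]
      refine (Complex.abs_im_le_norm _).trans ((hLip₁ r hr.le hr1 _ _).trans ?_)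
      rw [add_sub_add_left_eq_sub]
      exact mul_le_mul_of_nonneg_right hr3 (abs_nonneg _)
    have hq1 : |q| < 1 := by
      have h1 : |k * u| < 1 / 2 := by
        rw [abs_mul, Nat.abs_cast]
        have := hu.trans_le (min_le_right _ _)
        rw [lt_div_iff₀ (by positivity)] at this
        linarith
      have h2 := (Complex.abs_im_le_norm (lam s)).trans (hl _)
      exact (abs_add_le _ _).trans_lt (by linarith)
    have hq0 : q ≠ 0 := by
      intro h
      rw [h, zero_sub, abs_neg, abs_mul, Nat.abs_cast] at hqb
      have : 0 < |u - w r| := abs_pos.2 (sub_ne_zero.2 huw)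
      nlinarith
    have hbi : b = b.im * Complex.I := Complex.ext (by simp [hcrit]) (by simp)
    have hbim : b.im ≠ 0 := by
      intro h
      rw [h] at hbi
      exact hb0 (by simpa using hbi)
    have hexp : Complex.exp (q * Complex.I) = Real.cos q + Real.sin q * Complex.I := by
      rw [Complex.exp_mul_I, Complex.ofReal_cos, Complex.ofReal_sin]
    have hFre : (F s).re = -(R * b.im * Real.sin q) := by
      rw [hFR, hbi, hexp, re_mul_I_mul]
      simp
    have hsin : Real.sin q ≠ 0 := by
      have hpi := Real.pi_gt_three
      have := abs_lt.1 hq1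
      intro h
      exact hq0 ((Real.sin_eq_zero_iff_of_lt_of_lt (by linarith) (by linarith)).1 h)
    refine ⟨by rw [hFre]; exact neg_ne_zero.2 (mul_ne_zero (mul_ne_zero hR.ne' hbim) hsin),
      fun v hv hdir => ?_⟩
    -- One has s F'(s)(1 + iv) = F(s) c and F(s) = R i Im(b) e^{iq} with R > 0; the product of real
    -- parts is a positive multiple of sin q (Re c · sin q + Im c · cos q).
    set c : ℂ := (k + kap s) * (1 + v * Complex.I) with hc
    have hv1 : |v| ≤ 1 := by
      have := hv.trans_le (min_le_right _ _)
      rw [lt_div_iff₀ (by positivity)] at this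
      nlinarith [abs_nonneg v]
    have hks := hkp (θ + u)
    rw [← hs] at hks
    have hre := (Complex.abs_re_le_norm (kap s)).trans hks
    have him := (Complex.abs_im_le_norm (kap s)).trans hks
    have hca : 7 / 8 ≤ c.re := by
      have e1 : c.re = k + (kap s).re - v * (kap s).im := by simp [hc]; ring
      have e2 : |v * (kap s).im| ≤ 1 / 32 := by
        rw [abs_mul]
        calc _ ≤ 1 * |(kap s).im| := mul_le_mul_of_nonneg_right hv1 (abs_nonneg _)
          _ ≤ _ := by linarith
      rw [e1]
      linarith [(abs_le.1 e2).2, (abs_le.1 hre).1]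
    -- The differentiated arc equation is subtracted, leaving the variation of `kap` between s and
    -- the arc and a term of size ‖kap‖ |v - r w'|.
    have hcb : |c.im - k * (v - r * deriv w r)| ≤
        1 / 32 * (2 * |u - w r| + |v - r * deriv w r|) := by
      set vc := r * deriv w r with hvc
      have e1 : c.im - k * (v - vc) = ((kap s - kap sc) * (1 + vc * Complex.I) +
          kap s * ((v - vc : ℝ) * Complex.I)).im := by
        have : c = k * (1 + v * Complex.I) + ((kap s - kap sc) * (1 + vc * Complex.I) +
          kap s * ((v - vc : ℝ) * Complex.I)) + kap sc * (1 + vc * Complex.I) := by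
          rw [hc]; push_cast; ring
        rw [this, Complex.add_im, Complex.add_im]
        have h3 : (kap sc * (1 + vc * Complex.I)).im = -(k * vc) := by
          have : kap sc = sc * deriv lam sc := rfl
          rw [this]; linarith
        have h4 : ((k : ℂ) * (1 + v * Complex.I)).im = k * v := by simp
        rw [h3, h4]; ring
      rw [e1]
      refine (Complex.abs_im_le_norm _).trans ((norm_add_le _ _).trans ?_)
      have h3 : ‖(1 : ℂ) + vc * Complex.I‖ ≤ 2 := by
        refine (norm_add_le _ _).trans ?_
        rw [norm_one, norm_mul, Complex.norm_I, Complex.norm_real, mul_one, Real.norm_eq_abs]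
        linarith
      have h4 := hLip₂ r hr.le hr2 (θ + u) (θ + w r)
      rw [add_sub_add_left_eq_sub] at h4
      have h5 : M₂ * r * |u - w r| ≤ 1 / 64 * |u - w r| :=
        mul_le_mul_of_nonneg_right hr4 (abs_nonneg _)
      have h9 : ‖((v - vc : ℝ) : ℂ) * Complex.I‖ = |v - vc| := by
        rw [norm_mul, Complex.norm_I, Complex.norm_real, mul_one, Real.norm_eq_abs]
      rw [norm_mul (kap s - kap sc), norm_mul (kap s), h9]
      have h6 := mul_le_mul (h4.trans h5) h3 (norm_nonneg _) (by positivity)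
      have h7 := mul_le_mul_of_nonneg_right hks (abs_nonneg (v - vc))
      have h8 := abs_nonneg (u - w r)
      linarith
    have hmain := sin_mul_pos hq0 hq1 hca (direction_estimate hkR (by norm_num) le_rfl hqb hcb
      (hdir w rfl))
    have hfre : (s * deriv F s * (1 + v * Complex.I)).re =
        -(R * b.im * (c.re * Real.sin q + c.im * Real.cos q)) := by
      have : s * deriv F s * (1 + v * Complex.I) = F s * c := by rw [hdF, hc]; ring
      rw [this, hFR, hbi, hexp, re_mul_I_mul_mul]
      simp
    rw [hFre, hfre]
    have h9 : 0 < (R * b.im) ^ 2 := by positivity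
    nlinarith [mul_pos h9 hmain]
  · -- noncritical direction
    have hcont : ∀ᶠ y in 𝓝 ((0, 0, 0) : ℝ × ℂ × ℝ),
        0 < (b * Complex.exp (y.1 * Complex.I)).re *
          (b * Complex.exp (y.1 * Complex.I) * ((k + y.2.1) * (1 + y.2.2 * Complex.I))).re := by
      have hc : Continuous fun y : ℝ × ℂ × ℝ => (b * Complex.exp (y.1 * Complex.I)).re *
          (b * Complex.exp (y.1 * Complex.I) * ((k + y.2.1) * (1 + y.2.2 * Complex.I))).re := by
        fun_prop
      -- At the origin the product equals k (Re b)², which is positive.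
      refine (hc.tendsto _).eventually (lt_mem_nhds ?_)
      have hkR : (0 : ℝ) < k := by exact_mod_cast hk
      have : 0 < b.re ^ 2 := by positivity
      simp
      nlinarith
    obtain ⟨ε, hε, hball⟩ := Metric.eventually_nhds_iff_ball.1 hcont
    have hkR : (1 : ℝ) ≤ k := by exact_mod_cast hk
    obtain ⟨δ, hδ, hall⟩ := exists_of_eventually_nhdsGT (hform.and
      ((eventually_polarPoint (eventually_norm_le_nhds_zero hlam.continuousAt hlam0
        (show (0 : ℝ) < ε / 4 by positivity))).and
      (eventually_polarPoint (eventually_norm_le_nhds_zero hkapa.continuousAt hkap0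
        (show (0 : ℝ) < ε / 4 by positivity)))))
    refine ⟨∅, finite_empty, by simp, min δ (ε / (4 * k)), lt_min hδ (by positivity),
      fun r u hr hrδ hu _ => ?_⟩
    obtain ⟨hf, hl, hkp⟩ := hall r hr (hrδ.trans_le (min_le_left _ _))
    obtain ⟨R, hR, hFR, hdF⟩ := hf u
    set s := polarPoint r (θ + u) with hs
    set q := k * u + (lam s).im with hq
    have hq1 : |q| < ε := by
      have h1 : |k * u| < ε / 4 := by
        rw [abs_mul, Nat.abs_cast]
        have := hu.trans_le (min_le_right _ _)
        rw [lt_div_iff₀ (by positivity)] at this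
        linarith
      have h2 := (Complex.abs_im_le_norm (lam s)).trans (hl _)
      exact (abs_add_le _ _).trans_lt (by linarith)
    have hks : ‖kap s‖ < ε := (hkp (θ + u)).trans_lt (by linarith)
    have key : ∀ v : ℝ, |v| < ε → 0 < (F s).re * (s * deriv F s * (1 + v * Complex.I)).re := by
      intro v hv
      have h1 := hball (q, kap s, v) (by
        rw [Metric.mem_ball, Prod.dist_eq, Prod.dist_eq]
        simp only [dist_zero_right, Real.norm_eq_abs]
        exact max_lt hq1 (max_lt hks hv))
      have h2 : s * deriv F s * (1 + v * Complex.I) = R * (b * Complex.exp (q * Complex.I) *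
          ((k + kap s) * (1 + v * Complex.I))) := by
        rw [hdF, hFR]; ring
      rw [h2, hFR, Complex.re_ofReal_mul, Complex.re_ofReal_mul]
      have h3 : 0 < R * R := by positivity
      nlinarith [mul_pos h3 h1]
    refine ⟨fun h0 => ?_, fun v hv _ => key v ?_⟩
    · have := key 0 (by simpa using hε)
      rw [h0, zero_mul] at this
      exact lt_irrefl _ this
    · have h1 := hv.trans_le (min_le_right _ _)
      refine h1.trans_le ?_
      rw [div_le_iff₀ (by positivity)]
      nlinarith

end CriticalPair

/-! ### Systems of arcs and paths between them -/

section ArcSystem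

/-- The ratio r h'/h tends to n ≥ 0, so it is eventually above -1/8. Thus a gap between two arcs
shrinks, if at all, only slowly as r grows; n = 0 is allowed because some arcs do not pass through u
= 0. -/
theorem germ_pos {h g : ℝ → ℝ} {n : ℕ} (hg : AnalyticAt ℝ g 0) (hg0 : 0 < g 0)
    (hhg : ∀ᶠ r in 𝓝 (0 : ℝ), h r = r ^ n * g r) :
    ∀ᶠ r in 𝓝[>] (0 : ℝ), 0 < h r ∧ -(h r / 8) ≤ r * deriv h r := by
  have h1 : ∀ᶠ r in 𝓝 (0 : ℝ), 0 < g r := hg.continuousAt.eventually (lt_mem_nhds hg0)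
  have h2 : ∀ᶠ r in 𝓝 (0 : ℝ), 0 < g r / 8 + r * deriv g r := by
    have hc : ContinuousAt (fun r => g r / 8 + r * deriv g r) 0 :=
      (hg.continuousAt.div_const 8).add (continuousAt_id.mul hg.deriv.continuousAt)
    refine hc.eventually (lt_mem_nhds ?_)
    simpa using hg0
  filter_upwards [nhdsWithin_le_nhds h1, nhdsWithin_le_nhds h2,
    nhdsWithin_le_nhds hhg.eventually_nhds, nhdsWithin_le_nhds hg.eventually_analyticAt,
    self_mem_nhdsWithin] with r a1 a2 a3 a4 hr
  have hr' : 0 < r := hr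
  have e1 : HasDerivAt (fun r => r ^ n * g r) (n * r ^ (n - 1) * g r + r ^ n * deriv g r) r := by
    have := (hasDerivAt_pow n r).mul a4.differentiableAt.hasDerivAt
    exact this
  have e2 : deriv h r = n * r ^ (n - 1) * g r + r ^ n * deriv g r := by
    rw [EventuallyEq.deriv_eq (show h =ᶠ[𝓝 r] fun r => r ^ n * g r from a3), e1.deriv]
  have hpow : 0 < r ^ n := by positivity
  rw [e2, a3.self_of_nhds]
  refine ⟨by positivity, ?_⟩
  have e3 : 0 ≤ r * (n * r ^ (n - 1) * g r) := by positivity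
  have e4 : 0 < r ^ n * (g r / 8 + r * deriv g r) := by positivity
  nlinarith

theorem germ_trichotomy {h : ℝ → ℝ} (hh : AnalyticAt ℝ h 0) :
    (∀ᶠ r in 𝓝[>] (0 : ℝ), h r = 0) ∨
    (∀ᶠ r in 𝓝[>] (0 : ℝ), 0 < h r ∧ -(h r / 8) ≤ r * deriv h r) ∨
    ∀ᶠ r in 𝓝[>] (0 : ℝ), h r < 0 ∧ r * deriv h r ≤ -(h r / 8) := by
  by_cases h0 : ∀ᶠ r in 𝓝 (0 : ℝ), h r = 0
  · exact Or.inl (nhdsWithin_le_nhds h0)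
  right
  obtain ⟨n, g, hg, hg0, hhg⟩ := hh.exists_eventuallyEq_pow_smul_nonzero_iff.2 h0
  simp only [sub_zero, smul_eq_mul] at hhg
  rcases lt_or_gt_of_ne hg0 with hneg | hpos
  · right
    have := germ_pos (h := fun r => -h r) hg.neg (by simpa using hneg) (n := n) (by
      filter_upwards [hhg] with r hr
      rw [hr, Pi.neg_apply, mul_neg])
    filter_upwards [this] with r hr
    rw [deriv.fun_neg] at hr
    exact ⟨by linarith [hr.1], by linarith [hr.2]⟩
  · exact Or.inl (germ_pos hg hpos hhg)

/-- Finitely many graphs over `(0, ρ)` that pairwise coincide or are disjoint and do not approach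
each other too fast as `r` grows. -/
structure ArcSystem (W : Set (ℝ → ℝ)) (ρ ε : ℝ) : Prop where
  finite : W.Finite
  analyticAt : ∀ w ∈ W, ∀ r ∈ Ioo 0 ρ, AnalyticAt ℝ w r
  bound : ∀ w ∈ W, ∀ r ∈ Ioo 0 ρ, |w r| ≤ ε
  deriv_bound : ∀ w ∈ W, ∀ r ∈ Ioo 0 ρ, |r * deriv w r| ≤ ε
  compare : ∀ w ∈ W, ∀ w' ∈ W, (∀ r ∈ Ioo 0 ρ, w r = w' r) ∨
    (∀ r ∈ Ioo 0 ρ, w r < w' r ∧ -((w' r - w r) / 8) ≤ r * (deriv w' r - deriv w r)) ∨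
    ∀ r ∈ Ioo 0 ρ, w' r < w r ∧ -((w r - w' r) / 8) ≤ r * (deriv w r - deriv w' r)

theorem ArcSystem.mono {W : Set (ℝ → ℝ)} {ρ ρ' ε : ℝ} (h : ArcSystem W ρ ε) (hρ : ρ' ≤ ρ) :
    ArcSystem W ρ' ε := by
  have hs : Ioo 0 ρ' ⊆ Ioo 0 ρ := Ioo_subset_Ioo_right hρ
  refine ⟨h.finite, fun w hw r hr => h.analyticAt w hw r (hs hr),
    fun w hw r hr => h.bound w hw r (hs hr), fun w hw r hr => h.deriv_bound w hw r (hs hr),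
    fun w hw w' hw' => ?_⟩
  rcases h.compare w hw w' hw' with h | h | h
  · exact Or.inl fun r hr => h r (hs hr)
  · exact Or.inr (Or.inl fun r hr => h r (hs hr))
  · exact Or.inr (Or.inr fun r hr => h r (hs hr))

/-- The second alternative in `hWb` admits the constant arcs ±ε, for which the bound |w| ≤ ε is an
equality and does not follow from continuity at 0. -/
theorem exists_arcSystem {W : Set (ℝ → ℝ)} (hW : W.Finite) {ε : ℝ}
    (hWa : ∀ w ∈ W, AnalyticAt ℝ w 0) (hWb : ∀ w ∈ W, |w 0| < ε ∨ ∃ c, |c| ≤ ε ∧ w = fun _ => c)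
    (hε : 0 < ε) : ∃ ρ > 0, ArcSystem W ρ ε := by
  have h1 : ∀ᶠ r in 𝓝[>] (0 : ℝ), ∀ w ∈ W,
      AnalyticAt ℝ w r ∧ |w r| ≤ ε ∧ |r * deriv w r| ≤ ε := by
    refine hW.eventually_all.2 fun w hw => ?_
    have h2 : Tendsto (fun r => |r * deriv w r|) (𝓝 0) (𝓝 0) := by
      have h2 := ((continuousAt_id (x := (0 : ℝ))).mul (hWa w hw).deriv.continuousAt).abs.tendsto
      simpa using h2
    have h3 : ∀ᶠ r in 𝓝 (0 : ℝ), |w r| ≤ ε := by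
      rcases hWb w hw with h | ⟨c, hc, rfl⟩
      · filter_upwards [(hWa w hw).continuousAt.abs.eventually (gt_mem_nhds h)] with r hr
          using hr.le
      · exact Eventually.of_forall fun _ => hc
    filter_upwards [nhdsWithin_le_nhds (hWa w hw).eventually_analyticAt, nhdsWithin_le_nhds h3,
      nhdsWithin_le_nhds (h2.eventually (gt_mem_nhds hε))] with r a1 a2 a3
    exact ⟨a1, a2, a3.le⟩
  -- comparison of two germs, eventually
  have h2 : ∀ v ∈ W ×ˢ W, ∃ T : ℝ → Prop, (∀ᶠ r in 𝓝[>] (0 : ℝ), T r) ∧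
      ∀ ρ, (∀ r ∈ Ioo 0 ρ, T r ∧ AnalyticAt ℝ v.1 r ∧ AnalyticAt ℝ v.2 r) →
        ((∀ r ∈ Ioo 0 ρ, v.1 r = v.2 r) ∨
        (∀ r ∈ Ioo 0 ρ, v.1 r < v.2 r ∧ -((v.2 r - v.1 r) / 8) ≤ r * (deriv v.2 r - deriv v.1 r)) ∨
        ∀ r ∈ Ioo 0 ρ, v.2 r < v.1 r ∧
          -((v.1 r - v.2 r) / 8) ≤ r * (deriv v.1 r - deriv v.2 r)) := by
    rintro ⟨w, w'⟩ ⟨hw, hw'⟩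
    rcases germ_trichotomy ((hWa w' hw').sub (hWa w hw)) with h | h | h
    · refine ⟨_, h, fun ρ H => Or.inl fun r hr => ?_⟩
      have := (H r hr).1
      simp only [Pi.sub_apply] at this
      simp only
      linarith
    · refine ⟨_, h, fun ρ H => Or.inr (Or.inl fun r hr => ?_)⟩
      obtain ⟨⟨a1, a2⟩, a3, a4⟩ := H r hr
      rw [deriv_sub a4.differentiableAt a3.differentiableAt] at a2
      simp only [Pi.sub_apply] at a1 a2
      exact ⟨by simp only; linarith, a2⟩
    · refine ⟨_, h, fun ρ H => Or.inr (Or.inr fun r hr => ?_)⟩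
      obtain ⟨⟨a1, a2⟩, a3, a4⟩ := H r hr
      rw [deriv_sub a4.differentiableAt a3.differentiableAt] at a2
      simp only [Pi.sub_apply] at a1 a2
      exact ⟨by simp only; linarith, by simp only; linarith⟩
  choose! T hT1 hT2 using h2
  have h3 : ∀ᶠ r in 𝓝[>] (0 : ℝ), ∀ v ∈ W ×ˢ W, T v r := (hW.prod hW).eventually_all.2 hT1
  obtain ⟨ρ, hρ, H⟩ := exists_of_eventually_nhdsGT (h1.and h3)
  refine ⟨ρ, hρ, hW, fun w hw r hr => ((H r hr.1 hr.2).1 w hw).1,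
    fun w hw r hr => ((H r hr.1 hr.2).1 w hw).2.1, fun w hw r hr => ((H r hr.1 hr.2).1 w hw).2.2,
    fun w hw w' hw' => hT2 (w, w') ⟨hw, hw'⟩ ρ fun r hr => ⟨(H r hr.1 hr.2).2 _ ⟨hw, hw'⟩,
      ((H r hr.1 hr.2).1 w hw).1, ((H r hr.1 hr.2).1 w' hw').1⟩⟩

/-- The solutions of r ξ' = -(ξ - c)/2 are c + C/√r, with c and C fitted to the two end values. If
r₀ is small compared with r₁, then C/√r₁ is small, so c = x₁ - C/√r₁ stays in [0, 1]. -/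
theorem exists_interpolation {x₁ : ℝ} (hx : x₁ ∈ Ioo (0 : ℝ) 1) :
    ∃ t ∈ Ioo (0 : ℝ) 1, ∀ r₁ > 0, ∀ r₀ ∈ Ioo 0 (t * r₁), ∀ x₀ ∈ Ioo (0 : ℝ) 1,
      ∃ ξ : ℝ → ℝ, ∃ c ∈ Icc (0 : ℝ) 1, ξ r₀ = x₀ ∧ ξ r₁ = x₁ ∧ ∀ r ∈ Icc r₀ r₁,
        HasDerivAt ξ (-(ξ r - c) / (2 * r)) r ∧ ξ r ∈ Ioo (0 : ℝ) 1 := by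
  set η := min x₁ (1 - x₁) with hη
  have hη0 : 0 < η := lt_min hx.1 (by linarith [hx.2])
  have hη1 : η ≤ 1 := (min_le_left _ _).trans hx.2.le
  set T := 1 + 1 / η with hT
  have hT1 : 1 < T := by rw [hT]; linarith [div_pos one_pos hη0]
  -- With r₀ < r₁/T² the quotient √(r₁/r₀) exceeds T = 1 + 1/η, which gives |C/√r₁| ≤ η.
  refine ⟨1 / T ^ 2, ⟨by positivity, ?_⟩, fun r₁ hr₁ r₀ hr₀ x₀ hx₀ => ?_⟩
  · rw [div_lt_one (by positivity)]
    nlinarith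
  have hr₀0 := hr₀.1
  set a := Real.sqrt r₀ with ha
  set b := Real.sqrt r₁ with hb
  have ha0 : 0 < a := Real.sqrt_pos.2 hr₀.1
  have hb0 : 0 < b := Real.sqrt_pos.2 hr₁
  have hTab : T * a < b := by
    rw [ha, hb]
    refine Real.lt_sqrt_of_sq_lt ?_
    rw [mul_pow, Real.sq_sqrt hr₀.1.le]
    have := hr₀.2
    rw [div_mul_eq_mul_div, one_mul, lt_div_iff₀ (by positivity)] at this
    linarith
  have hab : a < b := by nlinarith
  set C := (x₀ - x₁) / (1 / a - 1 / b) with hC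
  have hd : 0 < 1 / a - 1 / b := sub_pos.2 (one_div_lt_one_div_of_lt ha0 hab)
  have hCd : C / a - C / b = x₀ - x₁ := by
    have : C * (1 / a - 1 / b) = x₀ - x₁ := div_mul_cancel₀ _ hd.ne'
    rw [← this]; ring
  have hCb : |C / b| ≤ η := by
    have e1 : C / b * (b / a - 1) = x₀ - x₁ := by rw [← hCd]; field_simp
    have e2 : 1 / η ≤ b / a - 1 := by
      have : T ≤ b / a := by rw [le_div_iff₀ ha0]; exact hTab.le
      rw [hT] at this; linarith
    have e3 : |x₀ - x₁| ≤ 1 := by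
      rw [abs_le]; constructor <;> linarith [hx.1, hx.2, hx₀.1, hx₀.2]
    have e4 : |C / b| * (1 / η) ≤ 1 := by
      calc |C / b| * (1 / η) ≤ |C / b| * (b / a - 1) :=
            mul_le_mul_of_nonneg_left e2 (abs_nonneg _)
        _ = |C / b * (b / a - 1)| := by
            rw [abs_mul, abs_of_nonneg ((div_pos one_pos hη0).le.trans e2)]
        _ ≤ 1 := by rw [e1]; exact e3
    rwa [mul_one_div, div_le_one hη0] at e4
  have hCb' := abs_le.1 hCb
  refine ⟨fun r => (x₁ - C / b) + C / Real.sqrt r, x₁ - C / b,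
    ⟨by linarith [min_le_left x₁ (1 - x₁)], by linarith [min_le_right x₁ (1 - x₁)]⟩, ?_, ?_,
    fun r hr => ?_⟩
  · simp only [← ha]; linarith
  · simp only [← hb]; ring
  have hr0 : 0 < r := hr₀.1.trans_le hr.1
  set s := Real.sqrt r with hs
  have hs0 : 0 < s := Real.sqrt_pos.2 hr0
  have hss : s ^ 2 = r := Real.sq_sqrt hr0.le
  have has : a ≤ s := Real.sqrt_le_sqrt hr.1
  have hsb : s ≤ b := Real.sqrt_le_sqrt hr.2
  constructor
  · have h1 := (((Real.hasDerivAt_sqrt hr0.ne').inv hs0.ne').const_mul C).const_add (x₁ - C / b)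
    refine (h1.congr_of_eventuallyEq (Eventually.of_forall fun y => ?_)).congr_deriv ?_
    · simp [div_eq_mul_inv]
    · rw [← hs, hss, add_sub_cancel_left]
      field_simp
      rw [hs]
  · have i1 : 1 / b ≤ 1 / s := one_div_le_one_div_of_le hs0 hsb
    have i2 : 1 / s ≤ 1 / a := one_div_le_one_div_of_le ha0 has
    simp only [div_eq_mul_one_div C] at hCd ⊢
    rcases le_total 0 C with h | h
    · have j1 := mul_le_mul_of_nonneg_left i1 h
      have j2 := mul_le_mul_of_nonneg_left i2 h
      constructor <;> linarith [hx.1, hx.2, hx₀.1, hx₀.2]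
    · have j1 := mul_le_mul_of_nonpos_left i1 h
      have j2 := mul_le_mul_of_nonpos_left i2 h
      constructor <;> linarith [hx.1, hx.2, hx₀.1, hx₀.2]

/-- The arcs `a < b` are adjacent. -/
structure Adjacent (W : Set (ℝ → ℝ)) (ρ : ℝ) (a b : ℝ → ℝ) : Prop where
  left_mem : a ∈ W
  right_mem : b ∈ W
  lt : ∀ r ∈ Ioo 0 ρ, a r < b r
  le_or_le : ∀ w ∈ W, (∀ r ∈ Ioo 0 ρ, w r ≤ a r) ∨ ∀ r ∈ Ioo 0 ρ, b r ≤ w r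

/-- The path runs at relative height ξ(r) between the two arcs. Its relative rate of approach to
either arc is at most 1/2 from the interpolation plus 1/8 from the shrinking of the gap, which is
the origin of 5/8. -/
theorem ArcSystem.exists_path {W : Set (ℝ → ℝ)} {ρ ε : ℝ} (h : ArcSystem W ρ ε) {a b : ℝ → ℝ}
    (hab : Adjacent W ρ a b) {r₁ u₁ : ℝ} (hr₁ : r₁ ∈ Ioo 0 ρ) (hu₁ : u₁ ∈ Ioo (a r₁) (b r₁)) :
    ∃ t > 0, ∀ r₀ ∈ Ioo 0 t, ∀ u₀ ∈ Ioo (a r₀) (b r₀), r₀ ≤ r₁ ∧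
      ∃ u u' : ℝ → ℝ, u r₀ = u₀ ∧ u r₁ = u₁ ∧ ∀ r ∈ Icc r₀ r₁, HasDerivAt u (u' r) r ∧
        u r ∈ Ioo (a r) (b r) ∧ |r * u' r| ≤ 4 * ε ∧
        ∀ w ∈ W, u r ≠ w r ∧
          -(5 / 8) * (u r - w r) ^ 2 ≤ (u r - w r) * (r * u' r - r * deriv w r) := by
  have hΔ : ∀ r ∈ Ioo 0 ρ, 0 < b r - a r := fun r hr => sub_pos.2 (hab.lt r hr)
  obtain ⟨t, ht, H⟩ := exists_interpolation (x₁ := (u₁ - a r₁) / (b r₁ - a r₁))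
    ⟨div_pos (sub_pos.2 hu₁.1) (hΔ _ hr₁), by
      rw [div_lt_one (hΔ _ hr₁)]; linarith [hu₁.2]⟩
  refine ⟨t * r₁, mul_pos ht.1 hr₁.1, fun r₀ hr₀ u₀ hu₀ => ?_⟩
  have hr₀₁ : r₀ ≤ r₁ := by nlinarith [hr₀.2, ht.2, hr₁.1]
  have hr₀ρ : r₀ ∈ Ioo 0 ρ := ⟨hr₀.1, hr₀₁.trans_lt hr₁.2⟩
  refine ⟨hr₀₁, ?_⟩
  obtain ⟨ξ, c, hc, hξ₀, hξ₁, hξ⟩ := H r₁ hr₁.1 r₀ hr₀ ((u₀ - a r₀) / (b r₀ - a r₀))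
    ⟨div_pos (sub_pos.2 hu₀.1) (hΔ _ hr₀ρ), by
      rw [div_lt_one (hΔ _ hr₀ρ)]; linarith [hu₀.2]⟩
  refine ⟨fun r => a r + ξ r * (b r - a r), fun r => deriv a r +
    (-(ξ r - c) / (2 * r) * (b r - a r) + ξ r * (deriv b r - deriv a r)), ?_, ?_,
    fun r hr => ?_⟩
  · simp only [hξ₀]
    rw [div_mul_cancel₀ _ (hΔ _ hr₀ρ).ne']; ring
  · simp only [hξ₁]
    rw [div_mul_cancel₀ _ (hΔ _ hr₁).ne']; ring
  have hrρ : r ∈ Ioo 0 ρ := ⟨hr₀.1.trans_le hr.1, hr.2.trans_lt hr₁.2⟩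
  have hr0 : 0 < r := hrρ.1
  have hDpos := hΔ r hrρ
  obtain ⟨hξd, hξ0, hξ1⟩ := hξ r hr
  have hda := (h.analyticAt a hab.left_mem r hrρ).differentiableAt.hasDerivAt
  have hdb := (h.analyticAt b hab.right_mem r hrρ).differentiableAt.hasDerivAt
  set D := b r - a r with hD
  set D' := r * (deriv b r - deriv a r) with hD'
  have hD'lb : -(D / 8) ≤ D' := by
    rcases h.compare a hab.left_mem b hab.right_mem with h1 | h1 | h1
    · exact absurd (h1 r hrρ) (hab.lt r hrρ).ne
    · exact (h1 r hrρ).2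
    · exact absurd (h1 r hrρ).1 (hab.lt r hrρ).le.not_gt
  set x := ξ r with hx
  -- the logarithmic velocity of the path
  have hv : r * (deriv a r + (-(x - c) / (2 * r) * D + x * (deriv b r - deriv a r))) =
      r * deriv a r + (-(x - c) / 2 * D + x * D') := by
    rw [hD']; field_simp
  obtain ⟨hc0, hc1⟩ := hc
  have habs_a := abs_le.1 (h.bound a hab.left_mem r hrρ)
  have habs_b := abs_le.1 (h.bound b hab.right_mem r hrρ)
  have habs_da := abs_le.1 (h.deriv_bound a hab.left_mem r hrρ)
  have habs_db := abs_le.1 (h.deriv_bound b hab.right_mem r hrρ)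
  have hxc : |(x - c) / 2| ≤ 1 / 2 := by
    rw [abs_le]; constructor <;> linarith
  refine ⟨hda.add (hξd.mul (hdb.sub hda)), ⟨?_, ?_⟩, ?_, fun w hw => ?_⟩
  · have : 0 < x * D := mul_pos hξ0 hDpos
    simp only; linarith
  · have : x * D < D := by nlinarith
    simp only; linarith
  · rw [hv]
    have e1 : r * deriv a r + (-(x - c) / 2 * D + x * D') =
        (1 - x) * (r * deriv a r) + x * (r * deriv b r) - (x - c) / 2 * D := by
      rw [hD']; ring
    have e2 : |(x - c) / 2 * D| ≤ ε := by
      rw [abs_mul, abs_of_pos hDpos]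
      nlinarith
    have e3 := abs_le.1 e2
    rw [e1, abs_le]
    constructor <;> nlinarith
  · simp only
    rw [hv]
    set y := a r + x * D with hy
    set v := r * deriv a r + (-(x - c) / 2 * D + x * D') with hvdef
    have hya : y - a r = x * D := by rw [hy]; ring
    have hby : b r - y = (1 - x) * D := by rw [hy]; ring
    have hva : -(5 / 8) * (x * D) ≤ v - r * deriv a r := by
      rw [hvdef]; nlinarith [mul_pos hξ0 hDpos]
    have hvb : -(5 / 8) * ((1 - x) * D) ≤ r * deriv b r - v := by
      have : r * deriv b r - v = (1 - x) * D' + (x - c) / 2 * D := by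
        rw [hvdef, hD']; ring
      rw [this]
      nlinarith [mul_pos (sub_pos.2 hξ1) hDpos]
    have hxD := mul_pos hξ0 hDpos
    have hxD' := mul_pos (sub_pos.2 hξ1) hDpos
    rcases hab.le_or_le w hw with hwa | hwb
    · have hwr := hwa r hrρ
      have hdw : -((a r - w r) / 8) ≤ r * deriv a r - r * deriv w r := by
        rw [← mul_sub]
        rcases h.compare w hw a hab.left_mem with h1 | h1 | h1
        · have e : w =ᶠ[𝓝 r] a := by
            filter_upwards [Ioo_mem_nhds hrρ.1 hrρ.2] with r' hr' using h1 r' hr'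
          rw [e.deriv_eq, h1 r hrρ]; simp
        · exact (h1 r hrρ).2
        · exact absurd (h1 r hrρ).1 hwr.not_gt
      -- The distance to a farther arc is the distance to a plus the gap between a and w; the latter
      -- shrinks at relative rate at most 1/8, well within 5/8.
      have hpos : 0 < y - w r := by linarith
      have hvel : -(5 / 8) * (y - w r) ≤ v - r * deriv w r := by linarith
      have := mul_le_mul_of_nonneg_left hvel hpos.le
      exact ⟨(sub_pos.1 hpos).ne', by linarith⟩
    · have hwr := hwb r hrρ
      have hdw : -((w r - b r) / 8) ≤ r * deriv w r - r * deriv b r := by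
        rw [← mul_sub]
        rcases h.compare b hab.right_mem w hw with h1 | h1 | h1
        · have e : w =ᶠ[𝓝 r] b := by
            filter_upwards [Ioo_mem_nhds hrρ.1 hrρ.2] with r' hr' using (h1 r' hr').symm
          rw [e.deriv_eq, h1 r hrρ]; simp
        · exact (h1 r hrρ).2
        · exact absurd (h1 r hrρ).1 hwr.not_gt
      have hpos : 0 < w r - y := by linarith
      have hvel : -(5 / 8) * (w r - y) ≤ r * deriv w r - v := by linarith
      have := mul_le_mul_of_nonneg_left hvel hpos.le
      exact ⟨(sub_pos.1 hpos).ne, by linarith⟩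

end ArcSystem

/-! ### A single branch between adjacent arcs -/

section Sector

/-- The logarithm of `r e^{i(θ+u)}`. -/
noncomputable def logPoint (θ r u : ℝ) : ℂ := ⟨Real.log r, θ + u⟩

theorem exp_logPoint {r : ℝ} (hr : 0 < r) (θ u : ℝ) :
    Complex.exp (logPoint θ r u) = polarPoint r (θ + u) := by
  have : logPoint θ r u = (Real.log r : ℂ) + (θ + u : ℝ) * Complex.I := by
    apply Complex.ext <;> simp [logPoint]
  rw [this, Complex.exp_add, ← Complex.ofReal_exp, Real.exp_log hr, polarPoint]

theorem hasDerivAt_logPoint {θ r u' : ℝ} {u : ℝ → ℝ} (hr : 0 < r) (hu : HasDerivAt u u' r) :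
    HasDerivAt (fun r => logPoint θ r (u r)) ((1 + (r * u' : ℝ) * Complex.I) / r) r := by
  have h1 : (fun r => logPoint θ r (u r)) =
      fun r => ((Real.log r : ℝ) : ℂ) + ((θ + u r : ℝ) : ℂ) * Complex.I := by
    ext r; apply Complex.ext <;> simp [logPoint]
  rw [h1]
  have h2 := ((Real.hasDerivAt_log hr.ne').ofReal_comp).add
    (((hu.const_add θ).ofReal_comp).mul_const Complex.I)
  refine h2.congr_deriv ?_
  have : (r : ℂ) ≠ 0 := by exact_mod_cast hr.ne'
  push_cast
  field_simp

theorem isOpen_logRegion {a b : ℝ → ℝ} {ρ : ℝ} (hρ : 0 < ρ) (ha : ContinuousOn a (Ioo 0 ρ))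
    (hb : ContinuousOn b (Ioo 0 ρ)) (θ : ℝ) :
    IsOpen {ζ : ℂ | ζ.re < Real.log ρ ∧ ζ.im - θ ∈ Ioo (a (Real.exp ζ.re)) (b (Real.exp ζ.re))} := by
  have hm : MapsTo (fun ζ : ℂ => Real.exp ζ.re) {ζ : ℂ | ζ.re < Real.log ρ} (Ioo 0 ρ) :=
    fun ζ hζ => ⟨Real.exp_pos _, (Real.lt_log_iff_exp_lt hρ).1 hζ⟩
  have he : ContinuousOn (fun ζ : ℂ => Real.exp ζ.re) {ζ : ℂ | ζ.re < Real.log ρ} := by fun_prop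
  have hi : ContinuousOn (fun ζ : ℂ => ζ.im - θ) {ζ : ℂ | ζ.re < Real.log ρ} := by fun_prop
  have h1 := (hi.sub (ha.comp he hm)).isOpen_inter_preimage (isOpen_re_lt _) (isOpen_Ioi (a := 0))
  have h2 := ((hb.comp he hm).sub hi).isOpen_inter_preimage (isOpen_re_lt _) (isOpen_Ioi (a := 0))
  convert h1.inter h2 using 1
  ext ζ
  simp only [mem_ofPred_eq, mem_Ioo, mem_inter_iff, mem_preimage, mem_Ioi, Pi.sub_apply,
    Function.comp, sub_pos]
  tauto

theorem logPoint_mem_logRegion {a b : ℝ → ℝ} {ρ θ r u : ℝ} (hr : r ∈ Ioo 0 ρ)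
    (hu : u ∈ Ioo (a r) (b r)) : logPoint θ r u ∈
    {ζ : ℂ | ζ.re < Real.log ρ ∧ ζ.im - θ ∈ Ioo (a (Real.exp ζ.re)) (b (Real.exp ζ.re))} := by
  refine ⟨Real.log_lt_log hr.1 hr.2, ?_⟩
  simpa [logPoint, Real.exp_log hr.1] using hu

theorem eq_logPoint (θ : ℝ) (ζ : ℂ) : ζ = logPoint θ (Real.exp ζ.re) (ζ.im - θ) := by
  apply Complex.ext <;> simp [logPoint]

namespace LogRoots

variable {ι : Type} {μ : Measure ℂ} {p : ℂ} {N : ℕ} {X : ℝ} {g : ι → ℂ → ℂ}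

variable (μ p N g) in
/-- The branch `g l` is taken near the point with polar coordinates `r`, `θ + u`. -/
def BranchAt (θ : ℝ) (l : ι) (r u : ℝ) : Prop :=
  OnBranch μ (logChart p N) (fun ζ => g l (Complex.exp ζ)) (logPoint θ r u)

variable [Finite ι] [IsFiniteMeasure μ]

/-- A path r ↦ (r, u(r)) has velocity (1 + i r u')/r in the logarithmic chart; the positive factor
1/r is dropped from the dominance condition. -/
theorem propagate_polar (h : LogRoots μ p N X fun l ζ => g l (Complex.exp ζ)) {B : ℝ}
    (hB : ∀ᵐ ζ ∂μ, ‖ζ‖ ≤ B) (h0 : volume μ.support = 0) {V : Set ℂ} (hV : IsOpen V)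
    (hVX : ∀ ζ ∈ V, ζ.re < X) {L : Set ι}
    (hL : ∀ ζ ∈ V, ∀ l, OnBranch μ (logChart p N) (fun ζ => g l (Complex.exp ζ)) ζ → l ∈ L)
    {m : ι} {θ r₀ r₁ : ℝ} (hr₀ : 0 < r₀) (hr : r₀ ≤ r₁) {u u' : ℝ → ℝ}
    (hu : ∀ r ∈ Icc r₀ r₁, HasDerivAt u (u' r) r)
    (huV : ∀ r ∈ Icc r₀ r₁, logPoint θ r (u r) ∈ V)
    (hdir : ∀ r ∈ Icc r₀ r₁, ∀ l ∈ L, l ≠ m →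
      0 < ((N * polarPoint r (θ + u r) ^ N * g m (polarPoint r (θ + u r)) -
        N * polarPoint r (θ + u r) ^ N * g l (polarPoint r (θ + u r))) *
          (1 + (r * u' r : ℝ) * Complex.I)).re)
    (hstart : BranchAt μ p N g θ m r₀ (u r₀)) : BranchAt μ p N g θ m r₁ (u r₁) := by
  refine h.propagate hB h0 hV hVX hL (m := m) hr (γ := fun r => logPoint θ r (u r))
    (fun r hr' => hasDerivAt_logPoint (hr₀.trans_le hr'.1) (hu r hr')) huV
    (fun r hr' l hl hlm => ?_) hstart
  have hrpos : 0 < r := hr₀.trans_le hr'.1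
  have h1 := hdir r hr' l hl hlm
  simp only [Complex.exp_nat_mul, exp_logPoint hrpos]
  have h2 : N * polarPoint r (θ + u r) ^ N *
      (g m (polarPoint r (θ + u r)) - g l (polarPoint r (θ + u r))) *
        ((1 + (r * u' r : ℝ) * Complex.I) / r) = ((1 / r : ℝ) : ℂ) *
      ((N * polarPoint r (θ + u r) ^ N * g m (polarPoint r (θ + u r)) -
        N * polarPoint r (θ + u r) ^ N * g l (polarPoint r (θ + u r))) *
          (1 + (r * u' r : ℝ) * Complex.I)) := by
    push_cast; ring
  rw [h2, Complex.re_ofReal_mul]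
  positivity

end LogRoots

end Sector

section Sector

theorem pos_of_isPreconnected {α : Type*} [TopologicalSpace α] {s : Set α} (hs : IsPreconnected s)
    {f : α → ℝ} (hf : ContinuousOn f s) (h0 : ∀ x ∈ s, f x ≠ 0) {x y : α} (hx : x ∈ s)
    (hy : y ∈ s) (hfx : 0 < f x) : 0 < f y := by
  by_contra hn
  obtain ⟨z, hz, hz0⟩ := hs.intermediate_value hy hx hf ⟨not_lt.1 hn, hfx.le⟩
  exact h0 z hz hz0

namespace LogRoots

variable {ι : Type} {μ : Measure ℂ} {p : ℂ} {N : ℕ} {X : ℝ} {g : ι → ℂ → ℂ}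

variable (μ p N X g) in
/-- Near the direction `θ` only the branches in `L` occur, with potentials `F l`, and the arcs in
`W` separate the sector `|u| ≤ ε` into regions on which these potentials are strictly ordered. -/
structure SectorData (L : Set ι) (F : ι → ℂ → ℂ) (W : Set (ℝ → ℝ)) (θ ρ ε : ℝ) : Prop where
  pos : 0 < ρ
  log_le : Real.log ρ ≤ X
  arcs : ArcSystem W ρ ε
  present : ∀ r ∈ Ioo 0 ρ, ∀ u, |u| ≤ ε → ∀ l, BranchAt μ p N g θ l r u → l ∈ L
  continuousAt : ∀ l ∈ L, ∀ s : ℂ, ‖s‖ < ρ → ContinuousAt (F l) s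
  sign : ∀ i ∈ L, ∀ j ∈ L, i ≠ j → ∀ r ∈ Ioo 0 ρ, ∀ u, |u| ≤ ε → (∀ w ∈ W, u ≠ w r) →
    (F i (polarPoint r (θ + u)) - F j (polarPoint r (θ + u))).re ≠ 0 ∧
    ∀ v : ℝ, |v| ≤ 4 * ε →
      (∀ w ∈ W, -(5 / 8) * (u - w r) ^ 2 ≤ (u - w r) * (v - r * deriv w r)) →
      0 < (F i (polarPoint r (θ + u)) - F j (polarPoint r (θ + u))).re *
        ((N * polarPoint r (θ + u) ^ N * g i (polarPoint r (θ + u)) -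
          N * polarPoint r (θ + u) ^ N * g j (polarPoint r (θ + u))) * (1 + v * Complex.I)).re

variable {L : Set ι} {F : ι → ℂ → ℂ} {W : Set (ℝ → ℝ)} {θ ρ ε : ℝ}

theorem SectorData.abs_le (hS : SectorData μ p N X g L F W θ ρ ε) {a b : ℝ → ℝ}
    (hab : Adjacent W ρ a b) {r u : ℝ} (hr : r ∈ Ioo 0 ρ) (hu : u ∈ Ioo (a r) (b r)) : |u| ≤ ε := by
  have h1 := _root_.abs_le.1 (hS.arcs.bound a hab.left_mem r hr)
  have h2 := _root_.abs_le.1 (hS.arcs.bound b hab.right_mem r hr)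
  exact _root_.abs_le.2 ⟨by linarith [hu.1], by linarith [hu.2]⟩

theorem SectorData.ne_arc (_ : SectorData μ p N X g L F W θ ρ ε) {a b : ℝ → ℝ}
    (hab : Adjacent W ρ a b) {r u : ℝ} (hr : r ∈ Ioo 0 ρ) (hu : u ∈ Ioo (a r) (b r)) :
    ∀ w ∈ W, u ≠ w r := by
  rintro w hw rfl
  rcases hab.le_or_le w hw with h | h
  · exact (h r hr).not_gt hu.1
  · exact (h r hr).not_gt hu.2

/-- The potentials are strictly ordered on the sector between adjacent arcs. -/
theorem SectorData.re_pos (hS : SectorData μ p N X g L F W θ ρ ε) {a b : ℝ → ℝ}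
    (hab : Adjacent W ρ a b) {i j : ι} (hi : i ∈ L) (hj : j ∈ L) (hij : i ≠ j) {r u r' u' : ℝ}
    (hr : r ∈ Ioo 0 ρ) (hu : u ∈ Ioo (a r) (b r)) (hr' : r' ∈ Ioo 0 ρ)
    (hu' : u' ∈ Ioo (a r') (b r'))
    (hpos : 0 < (F i (polarPoint r (θ + u)) - F j (polarPoint r (θ + u))).re) :
    0 < (F i (polarPoint r' (θ + u')) - F j (polarPoint r' (θ + u'))).re := by
  have hac : ContinuousOn a (Ioo 0 ρ) := fun r hr =>
    (hS.arcs.analyticAt a hab.left_mem r hr).continuousAt.continuousWithinAt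
  have hbc : ContinuousOn b (Ioo 0 ρ) := fun r hr =>
    (hS.arcs.analyticAt b hab.right_mem r hr).continuousAt.continuousWithinAt
  -- The curved region is the image of a rectangle, hence connected, and the difference of real
  -- parts has no zero on it.
  set u₀ : ℝ × ℝ → ℝ := fun v => a v.1 + v.2 * (b v.1 - a v.1) with hu₀
  have hmem : ∀ v ∈ Ioo 0 ρ ×ˢ Ioo (0 : ℝ) 1, u₀ v ∈ Ioo (a v.1) (b v.1) := by
    rintro ⟨r, x⟩ ⟨hr, hx⟩
    have h1 := sub_pos.2 (hab.lt r hr)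
    simp only [hu₀]
    simp only at hr hx
    exact ⟨by nlinarith [mul_pos hx.1 h1], by nlinarith [mul_pos (sub_pos.2 hx.2) h1]⟩
  have hsurj : ∀ r ∈ Ioo 0 ρ, ∀ u ∈ Ioo (a r) (b r), ∃ v ∈ Ioo 0 ρ ×ˢ Ioo (0 : ℝ) 1,
      v.1 = r ∧ u₀ v = u := by
    intro r hr u hu
    have h1 := sub_pos.2 (hab.lt r hr)
    refine ⟨(r, (u - a r) / (b r - a r)), ⟨hr, div_pos (sub_pos.2 hu.1) h1, ?_⟩, rfl, ?_⟩
    · rw [div_lt_one h1]; linarith [hu.2]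
    · simp only [hu₀]
      rw [div_mul_cancel₀ _ h1.ne']; ring
  have hfst : ContinuousOn (Prod.fst : ℝ × ℝ → ℝ) (Ioo 0 ρ ×ˢ Ioo (0 : ℝ) 1) :=
    continuous_fst.continuousOn
  have hac' := hac.comp hfst fun v hv => hv.1
  have hbc' := hbc.comp hfst fun v hv => hv.1
  have hu₀c : ContinuousOn u₀ (Ioo 0 ρ ×ˢ Ioo (0 : ℝ) 1) :=
    hac'.add (continuous_snd.continuousOn.mul (hbc'.sub hac'))
  have hptc : ContinuousOn (fun v : ℝ × ℝ => polarPoint v.1 (θ + u₀ v))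
      (Ioo 0 ρ ×ˢ Ioo (0 : ℝ) 1) :=
    continuous_polarPoint.comp_continuousOn (hfst.prodMk (continuousOn_const.add hu₀c))
  have hFc : ∀ l ∈ L, ContinuousOn (fun v : ℝ × ℝ => F l (polarPoint v.1 (θ + u₀ v)))
      (Ioo 0 ρ ×ˢ Ioo (0 : ℝ) 1) := fun l hl v hv => by
    have h1 : ContinuousAt (F l) (polarPoint v.1 (θ + u₀ v)) :=
      hS.continuousAt l hl _ (by rw [norm_polarPoint hv.1.1.le]; exact hv.1.2)
    exact ContinuousAt.comp_continuousWithinAt h1 (hptc v hv)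
  have hc : ContinuousOn (fun v : ℝ × ℝ => (F i (polarPoint v.1 (θ + u₀ v)) -
      F j (polarPoint v.1 (θ + u₀ v))).re) (Ioo 0 ρ ×ˢ Ioo (0 : ℝ) 1) :=
    Complex.continuous_re.comp_continuousOn ((hFc i hi).sub (hFc j hj))
  obtain ⟨v, hv, rfl, rfl⟩ := hsurj r hr u hu
  obtain ⟨v', hv', rfl, rfl⟩ := hsurj r' hr' u' hu'
  refine pos_of_isPreconnected ((convex_Ioo 0 ρ).prod (convex_Ioo 0 1)).isPreconnected hc
    (fun x hx => ?_) hv hv' hpos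
  have hxm := hmem x hx
  exact (hS.sign i hi j hj hij x.1 hx.1 _ (hS.abs_le hab hx.1 hxm)
    (hS.ne_arc hab hx.1 hxm)).1

variable [Finite ι] [IsFiniteMeasure μ]

/-- Close to the vertex, a sector between adjacent arcs does not meet the support, and a single
branch is taken on it. -/
theorem SectorData.exists_branch (hS : SectorData μ p N X g L F W θ ρ ε)
    (h : LogRoots μ p N X fun l ζ => g l (Complex.exp ζ)) {B : ℝ}
    (hB : ∀ᵐ ζ ∂μ, ‖ζ‖ ≤ B) (h0 : volume μ.support = 0) {a b : ℝ → ℝ}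
    (hab : Adjacent W ρ a b) :
    ∃ m, ∀ᶠ r in 𝓝[>] (0 : ℝ), ∀ u ∈ Ioo (a r) (b r), BranchAt μ p N g θ m r u := by
  have hac : ContinuousOn a (Ioo 0 ρ) := fun r hr =>
    (hS.arcs.analyticAt a hab.left_mem r hr).continuousAt.continuousWithinAt
  have hbc : ContinuousOn b (Ioo 0 ρ) := fun r hr =>
    (hS.arcs.analyticAt b hab.right_mem r hr).continuousAt.continuousWithinAt
  set L' : Set ι := {l | ∃ᶠ r in 𝓝[>] (0 : ℝ), ∃ u ∈ Ioo (a r) (b r),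
    BranchAt μ p N g θ l r u} with hL'
  have hev : ∀ᶠ r in 𝓝[>] (0 : ℝ), ∀ l, ∀ u ∈ Ioo (a r) (b r),
      BranchAt μ p N g θ l r u → l ∈ L' := by
    refine eventually_all.2 fun l => ?_
    by_cases hl : l ∈ L'
    · exact Eventually.of_forall fun _ _ _ _ => hl
    · filter_upwards [not_frequently.1 hl] with r hr u hu hb
      exact absurd ⟨u, hu, hb⟩ hr
  obtain ⟨ρ₁, hρ₁, hρ₁'⟩ := exists_of_eventually_nhdsGT hev
  set ρ' := min ρ ρ₁ with hρ'
  have hρ'0 : 0 < ρ' := lt_min hS.pos hρ₁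
  have hsub : Ioo 0 ρ' ⊆ Ioo 0 ρ := Ioo_subset_Ioo_right (min_le_left _ _)
  have hregion : ∀ ρ₂ ∈ Ioc 0 ρ', ∃ r ∈ Ioo 0 ρ₂, ∃ u ∈ Ioo (a r) (b r), ∃ l,
      BranchAt μ p N g θ l r u := by
    intro ρ₂ hρ₂
    have hsub₂ : Ioo 0 ρ₂ ⊆ Ioo 0 ρ := (Ioo_subset_Ioo_right hρ₂.2).trans hsub
    have ho := isOpen_logRegion hρ₂.1 (hac.mono hsub₂) (hbc.mono hsub₂) θ
    have hr : ρ₂ / 2 ∈ Ioo 0 ρ₂ := ⟨half_pos hρ₂.1, half_lt_self hρ₂.1⟩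
    have hlt := hab.lt _ (hsub₂ hr)
    obtain ⟨ζ, hζ, hs⟩ := h.exists_notMem h0 ho ⟨_, logPoint_mem_logRegion (θ := θ) hr
      (u := (a (ρ₂ / 2) + b (ρ₂ / 2)) / 2) ⟨by linarith, by linarith⟩⟩
    have hζr : Real.exp ζ.re ∈ Ioo 0 ρ₂ :=
      ⟨Real.exp_pos _, (Real.lt_log_iff_exp_lt hρ₂.1).1 hζ.1⟩
    have hζX : ζ.re < X := hζ.1.trans_le ((Real.log_le_log hρ₂.1
      (hρ₂.2.trans (min_le_left _ _))).trans hS.log_le)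
    obtain ⟨l, hl⟩ := h.exists_onBranch hζX hs
    refine ⟨_, hζr, _, hζ.2, l, ?_⟩
    rw [BranchAt, ← eq_logPoint]
    exact hl
  have hpres : ∀ l ∈ L', l ∈ L := by
    intro l hl
    obtain ⟨r, ⟨u, hu, hb⟩, hr⟩ := (hl.and_eventually (Ioo_mem_nhdsGT hS.pos)).exists
    exact hS.present r hr u (hS.abs_le hab hr hu) l hb
  have hne : L'.Nonempty := by
    obtain ⟨r, hr, u, hu, l, hl⟩ := hregion ρ' ⟨hρ'0, le_rfl⟩
    exact ⟨l, hρ₁' r hr.1 (hr.2.trans_le (min_le_right _ _)) l u hu hl⟩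
  -- the top branch
  have hr₂ : ρ' / 2 ∈ Ioo 0 ρ' := ⟨half_pos hρ'0, half_lt_self hρ'0⟩
  have hlt₂ := hab.lt _ (hsub hr₂)
  have hu₂ : (a (ρ' / 2) + b (ρ' / 2)) / 2 ∈ Ioo (a (ρ' / 2)) (b (ρ' / 2)) :=
    ⟨by linarith, by linarith⟩
  obtain ⟨m, hm, hmax⟩ := (toFinite L').exists_maximalFor
    (fun j => (F j (polarPoint (ρ' / 2) (θ + (a (ρ' / 2) + b (ρ' / 2)) / 2))).re) L' hne
  have htop : ∀ l ∈ L', l ≠ m → ∀ r ∈ Ioo 0 ρ, ∀ u ∈ Ioo (a r) (b r),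
      0 < (F m (polarPoint r (θ + u)) - F l (polarPoint r (θ + u))).re := by
    intro l hl hlm r hr u hu
    refine hS.re_pos hab (hpres m hm) (hpres l hl) hlm.symm (hsub hr₂) hu₂ hr hu ?_
    have h1 := (hS.sign m (hpres m hm) l (hpres l hl) hlm.symm _ (hsub hr₂) _
      (hS.abs_le hab (hsub hr₂) hu₂) (hS.ne_arc hab (hsub hr₂) hu₂)).1
    refine lt_of_le_of_ne ?_ h1.symm
    by_contra hcon
    rw [Complex.sub_re] at hcon
    have h2 := hmax hl (by simp only; linarith)
    simp only at h2
    linarith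
  refine ⟨m, ?_⟩
  filter_upwards [Ioo_mem_nhdsGT hρ'0] with r₁ hr₁ u₁ hu₁
  obtain ⟨t, ht, hpath⟩ := (hS.arcs.mono (min_le_left ρ ρ₁)).exists_path
    (a := a) (b := b) ⟨hab.left_mem, hab.right_mem, fun r hr => hab.lt r (hsub hr), fun w hw =>
      (hab.le_or_le w hw).imp (fun h r hr => h r (hsub hr)) fun h r hr => h r (hsub hr)⟩ hr₁ hu₁
  -- The branch m occurs arbitrarily near the vertex, so it occurs somewhere below t; from there a
  -- path leads to the given point. Outward along it Re(F m - F l) is positive and increasing, which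
  -- is the dominance needed.
  obtain ⟨r₀, ⟨u₀, hu₀, hb₀⟩, hr₀⟩ := (hm.and_eventually (Ioo_mem_nhdsGT ht)).exists
  obtain ⟨hr₀₁, u, u', rfl, rfl, hu⟩ := hpath r₀ hr₀ u₀ hu₀
  have hrmem : ∀ r ∈ Icc r₀ r₁, r ∈ Ioo 0 ρ' := fun r hr =>
    ⟨hr₀.1.trans_le hr.1, hr.2.trans_lt hr₁.2⟩
  refine h.propagate_polar hB h0 (isOpen_logRegion hρ'0 (hac.mono hsub) (hbc.mono hsub) θ)
    (fun ζ hζ => hζ.1.trans_le ((Real.log_le_log hρ'0 (min_le_left _ _)).trans hS.log_le))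
    (L := L') (fun ζ hζ l hl => ?_) hr₀.1 hr₀₁ (fun r hr => (hu r hr).1)
    (fun r hr => logPoint_mem_logRegion (hrmem r hr) (hu r hr).2.1) (fun r hr l hl hlm => ?_) hb₀
  · have hζr : Real.exp ζ.re ∈ Ioo 0 ρ' :=
      ⟨Real.exp_pos _, (Real.lt_log_iff_exp_lt hρ'0).1 hζ.1⟩
    refine hρ₁' _ hζr.1 (hζr.2.trans_le (min_le_right _ _)) l _ hζ.2 ?_
    rw [BranchAt, ← eq_logPoint]
    exact hl
  · have hrρ := hsub (hrmem r hr)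
    obtain ⟨-, hmem, hv, hw⟩ := hu r hr
    have h1 := (hS.sign m (hpres m hm) l (hpres l hl) hlm.symm r hrρ (u r)
      (hS.abs_le hab hrρ hmem) fun w hw' => (hw w hw').1).2 (r * u' r) hv fun w hw' => (hw w hw').2
    exact pos_of_mul_pos_right h1 (htop l hl hlm r hrρ _ hmem).le

end LogRoots

end Sector

/-! ### Analytic potentials and the arcs they determine -/

section Sector

/-- After removal of the singularity, (E - a)/s is analytic and F is its primitive. The
normalisation F 0 = 0 makes differences of potentials vanish at the vertex. -/
theorem exists_mul_deriv_eq {E : ℂ → ℂ} {a : ℂ} (hE : MeromorphicAt E 0)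
    (ht : Tendsto E (𝓝[≠] 0) (𝓝 a)) :
    ∃ F : ℂ → ℂ, AnalyticAt ℂ F 0 ∧ F 0 = 0 ∧ ∀ᶠ s in 𝓝[≠] (0 : ℂ), E s = a + s * deriv F s := by
  set G := Function.update E 0 a with hG
  have hGE : ∀ s ≠ 0, G s = E s := fun s hs => Function.update_of_ne hs _ _
  have hGa : AnalyticAt ℂ G 0 := by
    refine Complex.analyticAt_of_differentiable_on_punctured_nhds_of_continuousAt ?_
      (continuousAt_update_same.2 ht)
    filter_upwards [hE.eventually_analyticAt, self_mem_nhdsWithin] with s hs hs0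
    refine hs.differentiableAt.congr_of_eventuallyEq ?_
    filter_upwards [isOpen_ne.mem_nhds hs0] with s' hs' using hGE s' hs'
  have hd : AnalyticAt ℂ (dslope G 0) 0 := by
    obtain ⟨q, hq⟩ := hGa
    exact ⟨_, hq.has_fpower_series_dslope_fslope⟩
  obtain ⟨r, hr, hr'⟩ := Metric.eventually_nhds_iff_ball.1 hd.eventually_analyticAt
  obtain ⟨F, hF⟩ := (DifferentiableOn.isExactOn_ball (f := dslope G 0) (c := 0) (r := r)
    fun s hs => (hr' s hs).differentiableAt.differentiableWithinAt).with_val_at 0 0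
  refine ⟨F, ?_, hF.1, ?_⟩
  · exact (DifferentiableOn.analyticAt (s := Metric.ball 0 r)
      (fun s hs => (hF.2 s hs).differentiableAt.differentiableWithinAt) (Metric.ball_mem_nhds _ hr))
  · filter_upwards [nhdsWithin_le_nhds (Metric.ball_mem_nhds (0 : ℂ) hr), self_mem_nhdsWithin]
      with s hs hs0
    have h1 := sub_smul_dslope G 0 s
    rw [(hF.2 s hs).deriv, ← hGE s hs0]
    simp only [sub_zero, smul_eq_mul] at h1
    rw [h1]
    simp [hG]

namespace LogRoots

variable {ι : Type} {μ : Measure ℂ} {p : ℂ} {N : ℕ} {X : ℝ} {g : ι → ℂ → ℂ}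
  [Finite ι] [IsFiniteMeasure μ]

/-- All branches occurring near the direction θ share the limit N μ({p}), which cancels in
differences; `exists_arcs` therefore applies to every F i - F j. -/
theorem exists_sectorData (h : LogRoots μ p N X fun l ζ => g l (Complex.exp ζ))
    (hg : ∀ l, MeromorphicAt (g l) 0) {B : ℝ} (hB : ∀ᵐ ζ ∂μ, ‖ζ‖ ≤ B)
    (h0 : volume μ.support = 0) (θ : ℝ) :
    ∃ (L : Set ι) (F : ι → ℂ → ℂ) (W : Set (ℝ → ℝ)) (ρ ε : ℝ), 0 < ε ∧
      (fun _ => ε) ∈ W ∧ (fun _ => -ε) ∈ W ∧ (∀ w ∈ W, AnalyticAt ℝ w 0) ∧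
      SectorData μ p N X g L F W θ ρ ε := by
  set L : Set ι := {l | ∃ᶠ ζ in angleFilter θ,
    OnBranch μ (logChart p N) (fun ζ => g l (Complex.exp ζ)) ζ} with hL
  set E : ι → ℂ → ℂ := fun l s => N * s ^ N * g l s with hE
  have hEm : ∀ l, MeromorphicAt (E l) 0 := fun l => by
    have := hg l
    fun_prop
  have h1 : ∀ l, ∃ F : ℂ → ℂ, l ∈ L → AnalyticAt ℂ F 0 ∧ F 0 = 0 ∧
      ∀ᶠ s in 𝓝[≠] (0 : ℂ), E l s = N * μ.real {p} + s * deriv F s := by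
    intro l
    by_cases hl : l ∈ L
    · obtain ⟨F, hF⟩ := exists_mul_deriv_eq (hEm l) (h.tendsto_of_frequently hg hB h0 hl)
      exact ⟨F, fun _ => hF⟩
    · exact ⟨0, fun h => absurd h hl⟩
  choose F hF using h1
  have h2 : ∀ i j, ∃ W : Set (ℝ → ℝ), W.Finite ∧ (∀ w ∈ W, AnalyticAt ℝ w 0 ∧ w 0 = 0) ∧
      ∃ δ > 0, i ∈ L → j ∈ L → i ≠ j → ∀ r u : ℝ, 0 < r → r < δ → |u| < δ →
        (∀ w ∈ W, u ≠ w r) →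
        ((F i - F j) (polarPoint r (θ + u))).re ≠ 0 ∧ ∀ v : ℝ, |v| < δ →
        (∀ w ∈ W, -(5 / 8) * (u - w r) ^ 2 ≤ (u - w r) * (v - r * deriv w r)) →
        0 < ((F i - F j) (polarPoint r (θ + u))).re * (polarPoint r (θ + u) *
          deriv (F i - F j) (polarPoint r (θ + u)) * (1 + v * Complex.I)).re := by
    intro i j
    by_cases hij : i ∈ L ∧ j ∈ L ∧ i ≠ j
    · obtain ⟨hi, hj, hij⟩ := hij
      obtain ⟨hFi, hFi0, hEi⟩ := hF i hi
      obtain ⟨hFj, hFj0, hEj⟩ := hF j hj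
      -- If F i - F j vanished identically, the branches i and j would coincide near 0.
      obtain ⟨W, hW, hW', δ, hδ, H⟩ := exists_arcs (hFi.sub hFj) (by simp [hFi0, hFj0]) (by
        intro hev
        refine h.meromorphicOrderAt_sub_ne_top hg hij (meromorphicOrderAt_eq_top_iff.2 ?_)
        have hev' : ∀ᶠ s in 𝓝 (0 : ℂ), deriv (F i - F j) s = 0 := by
          have : (F i - F j) =ᶠ[𝓝 0] fun _ => 0 := hev
          filter_upwards [this.deriv] with s hs
          simpa using hs
        filter_upwards [hEi, hEj, nhdsWithin_le_nhds hev',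
          nhdsWithin_le_nhds hFi.eventually_analyticAt,
          nhdsWithin_le_nhds hFj.eventually_analyticAt] with s h1 h2 h3 h4 h5
        rw [deriv_sub h4.differentiableAt h5.differentiableAt] at h3
        simp only [hE] at h1 h2
        rw [h1, h2]
        linear_combination s * h3) θ
      exact ⟨W, hW, hW', δ, hδ, fun _ _ _ => H⟩
    · exact ⟨∅, finite_empty, by simp, 1, one_pos, fun h1 h2 h3 => absurd ⟨h1, h2, h3⟩ hij⟩
  choose W hW hW' δ hδ hsign using h2
  have h3 : ∀ᶠ ζ in angleFilter θ, ∀ l,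
      OnBranch μ (logChart p N) (fun ζ => g l (Complex.exp ζ)) ζ → l ∈ L := by
    refine eventually_all.2 fun l => ?_
    by_cases hl : l ∈ L
    · exact Eventually.of_forall fun _ _ => hl
    · filter_upwards [not_frequently.1 hl] with ζ hζ hb using absurd hb hζ
  obtain ⟨X₀, δ₀, hδ₀, hpres⟩ := eventually_angleFilter.1 h3
  have h4 : ∀ᶠ s in 𝓝 (0 : ℂ), ∀ l, l ∈ L → AnalyticAt ℂ (F l) s ∧
      (s ≠ 0 → E l s = N * μ.real {p} + s * deriv (F l) s) := by
    refine eventually_all.2 fun l => ?_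
    by_cases hl : l ∈ L
    · obtain ⟨h5, -, h6⟩ := hF l hl
      filter_upwards [h5.eventually_analyticAt, eventually_nhdsWithin_iff.1 h6] with s h7 h8 _
      exact ⟨h7, h8⟩
    · exact Eventually.of_forall fun _ h => absurd h hl
  obtain ⟨η, hη, hη'⟩ := Metric.eventually_nhds_iff_ball.1 h4
  -- The paths between arcs have angular velocity up to 4ε, which must stay below each δ i j.
  have h5 : ∀ᶠ e in 𝓝[>] (0 : ℝ), ∀ i j, e < δ i j / 4 :=
    eventually_all.2 fun i => eventually_all.2 fun j =>
      nhdsWithin_le_nhds (gt_mem_nhds (by linarith [hδ i j]))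
  obtain ⟨ε, ⟨hεδ, hε₀⟩, hε⟩ := ((h5.and (nhdsWithin_le_nhds (gt_mem_nhds hδ₀))).and
    self_mem_nhdsWithin).exists
  have hε : 0 < ε := hε
  -- The constants ±ε serve as the sides of the sector, so that each point strictly inside lies on
  -- an arc or between two adjacent ones.
  set W' : Set (ℝ → ℝ) := (⋃ i, ⋃ j, W i j) ∪ {fun _ => ε, fun _ => -ε} with hW'def
  have hsub : ∀ i j, ∀ w ∈ W i j, w ∈ W' := fun i j w hw =>
    Or.inl (mem_iUnion.2 ⟨i, mem_iUnion.2 ⟨j, hw⟩⟩)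
  have hWan : ∀ w ∈ W', AnalyticAt ℝ w 0 ∧ (|w 0| < ε ∨ ∃ c, |c| ≤ ε ∧ w = fun _ => c) := by
    rintro w (hw | hw)
    · obtain ⟨i, hw⟩ := mem_iUnion.1 hw
      obtain ⟨j, hw⟩ := mem_iUnion.1 hw
      obtain ⟨h6, h7⟩ := hW' i j w hw
      exact ⟨h6, Or.inl (by simpa [h7] using hε)⟩
    · rcases hw with rfl | rfl
      · exact ⟨analyticAt_const, Or.inr ⟨ε, (abs_of_pos hε).le, rfl⟩⟩
      · exact ⟨analyticAt_const, Or.inr ⟨-ε, by rw [abs_neg, abs_of_pos hε], rfl⟩⟩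
  have hfin : W'.Finite := (finite_iUnion fun i => finite_iUnion fun j => hW i j).union (by simp)
  obtain ⟨ρ₀, hρ₀, hA⟩ := exists_arcSystem hfin (fun w hw => (hWan w hw).1)
    (fun w hw => (hWan w hw).2) hε
  have h6 : ∀ᶠ r in 𝓝[>] (0 : ℝ), (∀ i j, r < δ i j) ∧ r < ρ₀ ∧ r < η ∧ r < Real.exp X ∧
      r < Real.exp X₀ := by
    have hlt : ∀ c > (0 : ℝ), ∀ᶠ r in 𝓝[>] (0 : ℝ), r < c := fun c hc =>
      nhdsWithin_le_nhds (gt_mem_nhds hc)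
    exact (eventually_all.2 fun i => eventually_all.2 fun j => hlt _ (hδ i j)).and
      ((hlt _ hρ₀).and ((hlt _ hη).and ((hlt _ (Real.exp_pos X)).and (hlt _ (Real.exp_pos X₀)))))
  obtain ⟨ρ, ⟨hρδ, hρρ₀, hρη, hρX, hρX₀⟩, hρ⟩ := (h6.and self_mem_nhdsWithin).exists
  have hρ : 0 < ρ := hρ
  refine ⟨L, F, W', ρ, ε, hε, Or.inr (Or.inl rfl), Or.inr (Or.inr rfl), fun w hw => (hWan w hw).1,
    hρ, ?_, hA.mono hρρ₀.le, ?_, ?_, ?_⟩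
  · exact ((Real.log_lt_iff_lt_exp hρ).2 hρX).le
  · intro r hr u hu l hl
    refine hpres _ ?_ ?_ l hl
    · exact (Real.log_lt_iff_lt_exp hr.1).2 (hr.2.trans hρX₀)
    · simpa [logPoint] using hu.trans_lt hε₀
  · intro l hl s hs
    exact ((hη' s (by simpa using hs.trans hρη)) l hl).1.continuousAt
  · intro i hi j hj hij r hr u hu hne
    have hεij := hεδ i j
    have hs : polarPoint r (θ + u) ∈ Metric.ball (0 : ℂ) η := by
      simpa [norm_polarPoint hr.1.le] using hr.2.trans hρη
    have hs0 : polarPoint r (θ + u) ≠ 0 := by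
      rw [← norm_ne_zero_iff, norm_polarPoint hr.1.le]; exact hr.1.ne'
    obtain ⟨h7, h8⟩ := hsign i j hi hj hij r u hr.1 (hr.2.trans (hρδ i j)) (by linarith)
      fun w hw => hne w (hsub i j w hw)
    refine ⟨h7, fun v hv hw => ?_⟩
    have h9 := h8 v (by linarith) fun w hw' => hw w (hsub i j w hw')
    obtain ⟨hi1, hi2⟩ := hη' _ hs i hi
    obtain ⟨hj1, hj2⟩ := hη' _ hs j hj
    rw [deriv_sub hi1.differentiableAt hj1.differentiableAt, mul_sub] at h9
    have h10 := hi2 hs0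
    have h11 := hj2 hs0
    simp only [hE] at h10 h11
    rw [h10, h11, add_sub_add_left_eq_sub]
    exact h9

end LogRoots

end Sector

/-! ### The support inside a sector -/

section Sector

theorem ArcSystem.le_of_le {W : Set (ℝ → ℝ)} {ρ ε : ℝ} (h : ArcSystem W ρ ε) {w w' : ℝ → ℝ}
    (hw : w ∈ W) (hw' : w' ∈ W) {r r' : ℝ} (hr : r ∈ Ioo 0 ρ) (hle : w r ≤ w' r)
    (hr' : r' ∈ Ioo 0 ρ) : w r' ≤ w' r' := by
  rcases h.compare w hw w' hw' with h1 | h1 | h1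
  · exact (h1 r' hr').le
  · exact (h1 r' hr').1.le
  · exact absurd hle (h1 r hr).1.not_ge

theorem ArcSystem.lt_of_lt {W : Set (ℝ → ℝ)} {ρ ε : ℝ} (h : ArcSystem W ρ ε) {w w' : ℝ → ℝ}
    (hw : w ∈ W) (hw' : w' ∈ W) {r r' : ℝ} (hr : r ∈ Ioo 0 ρ) (hlt : w r < w' r)
    (hr' : r' ∈ Ioo 0 ρ) : w r' < w' r' := by
  by_contra! hcon
  exact (h.le_of_le hw' hw hr' hcon hr).not_gt hlt

theorem ArcSystem.exists_adjacent {W : Set (ℝ → ℝ)} {ρ ε : ℝ} (h : ArcSystem W ρ ε) {r u : ℝ}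
    (hr : r ∈ Ioo 0 ρ) (hlo : ∃ w ∈ W, w r < u) (hhi : ∃ w ∈ W, u < w r) (hne : ∀ w ∈ W, u ≠ w r) :
    ∃ a b, Adjacent W ρ a b ∧ u ∈ Ioo (a r) (b r) := by
  obtain ⟨a, ⟨haW, hau⟩, ha⟩ := (h.finite.subset (sep_subset W fun w => w r < u)).exists_maximalFor
    (fun w => w r) _ hlo
  obtain ⟨b, ⟨hbW, hbu⟩, hb⟩ := (h.finite.subset (sep_subset W fun w => u < w r)).exists_minimalFor
    (fun w => w r) _ hhi
  refine ⟨a, b, ⟨haW, hbW, fun r' hr' => h.lt_of_lt haW hbW hr (hau.trans hbu) hr',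
    fun w hw => ?_⟩, hau, hbu⟩
  rcases (hne w hw).lt_or_gt with hlt | hlt
  · exact Or.inr fun r' hr' => h.le_of_le hbW hw hr
      ((le_total (b r) (w r)).elim id fun hle => hb ⟨hw, hlt⟩ hle) hr'
  · exact Or.inl fun r' hr' => h.le_of_le hw haW hr
      ((le_total (w r) (a r)).elim id fun hle => ha ⟨hw, hlt⟩ hle) hr'

theorem ArcSystem.exists_adjacent_left {W : Set (ℝ → ℝ)} {ρ ε : ℝ} (h : ArcSystem W ρ ε) {r : ℝ}
    {w : ℝ → ℝ} (hw : w ∈ W) (hr : r ∈ Ioo 0 ρ) (hlo : ∃ w' ∈ W, w' r < w r) :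
    ∃ a, Adjacent W ρ a w := by
  obtain ⟨a, ⟨haW, hau⟩, ha⟩ :=
    (h.finite.subset (sep_subset W fun w' => w' r < w r)).exists_maximalFor (fun w => w r) _ hlo
  refine ⟨a, haW, hw, fun r' hr' => h.lt_of_lt haW hw hr hau hr', fun w' hw' => ?_⟩
  rcases le_or_gt (w r) (w' r) with hle | hlt
  · exact Or.inr fun r' hr' => h.le_of_le hw hw' hr hle hr'
  · exact Or.inl fun r' hr' => h.le_of_le hw' haW hr
      ((le_total (w' r) (a r)).elim id fun hle => ha ⟨hw', hlt⟩ hle) hr'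

theorem ArcSystem.exists_adjacent_right {W : Set (ℝ → ℝ)} {ρ ε : ℝ} (h : ArcSystem W ρ ε) {r : ℝ}
    {w : ℝ → ℝ} (hw : w ∈ W) (hr : r ∈ Ioo 0 ρ) (hhi : ∃ w' ∈ W, w r < w' r) :
    ∃ b, Adjacent W ρ w b := by
  obtain ⟨b, ⟨hbW, hbu⟩, hb⟩ :=
    (h.finite.subset (sep_subset W fun w' => w r < w' r)).exists_minimalFor (fun w => w r) _ hhi
  refine ⟨b, hw, hbW, fun r' hr' => h.lt_of_lt hw hbW hr hbu hr', fun w' hw' => ?_⟩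
  rcases le_or_gt (w' r) (w r) with hle | hlt
  · exact Or.inl fun r' hr' => h.le_of_le hw' hw hr hle hr'
  · exact Or.inr fun r' hr' => h.le_of_le hbW hw' hr
      ((le_total (b r) (w' r)).elim id fun hle => hb ⟨hw', hlt⟩ hle) hr'

theorem continuous_logPoint_snd (θ r : ℝ) : Continuous fun u => logPoint θ r u := by
  have : (fun u => logPoint θ r u) =
      fun u => ((Real.log r : ℝ) : ℂ) + ((θ + u : ℝ) : ℂ) * Complex.I := by
    ext u; apply Complex.ext <;> simp [logPoint]
  rw [this]; fun_prop

namespace LogRoots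

variable {ι : Type} {μ : Measure ℂ} {p : ℂ} {N : ℕ} {X : ℝ} {g : ι → ℂ → ℂ}

theorem BranchAt.eventually {θ r u : ℝ} {l : ι} (h : BranchAt μ p N g θ l r u) :
    ∀ᶠ u' in 𝓝 u, BranchAt μ p N g θ l r u' :=
  (continuous_logPoint_snd θ r).continuousAt.eventually (eventually_eventually_nhds.2 h)

theorem BranchAt.unique (h : LogRoots μ p N X fun l ζ => g l (Complex.exp ζ)) {θ r u : ℝ}
    (hr : Real.log r < X) {i j : ι} (hi : BranchAt μ p N g θ i r u)
    (hj : BranchAt μ p N g θ j r u) : i = j :=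
  h.onBranch_unique (ζ := logPoint θ r u) hr hi hj

variable [Finite ι] [IsFiniteMeasure μ]

/-- An arc separating two sectors, on each of which a single branch is taken, lies in the support
or is disjoint from it. -/
theorem SectorData.arc_dichotomy {L : Set ι} {F : ι → ℂ → ℂ} {W : Set (ℝ → ℝ)} {θ ρ ε : ℝ}
    (hS : SectorData μ p N X g L F W θ ρ ε)
    (h : LogRoots μ p N X fun l ζ => g l (Complex.exp ζ)) {B : ℝ}
    (hB : ∀ᵐ ζ ∂μ, ‖ζ‖ ≤ B) (h0 : volume μ.support = 0) {a w b : ℝ → ℝ}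
    (haw : Adjacent W ρ a w) (hwb : Adjacent W ρ w b) {ρ' : ℝ} (hρ'0 : 0 < ρ') (hρ' : ρ' ≤ ρ)
    {i j : ι} (hi : ∀ r ∈ Ioo 0 ρ', ∀ u ∈ Ioo (a r) (w r), BranchAt μ p N g θ i r u)
    (hj : ∀ r ∈ Ioo 0 ρ', ∀ u ∈ Ioo (w r) (b r), BranchAt μ p N g θ j r u) :
    (∀ r ∈ Ioo 0 ρ', logChart p N (logPoint θ r (w r)) ∈ μ.support) ∨
      ∀ r ∈ Ioo 0 ρ', logChart p N (logPoint θ r (w r)) ∉ μ.support := by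
  have hsub : Ioo 0 ρ' ⊆ Ioo 0 ρ := Ioo_subset_Ioo_right hρ'
  have hX : ∀ r ∈ Ioo 0 ρ', Real.log r < X := fun r hr =>
    (Real.log_lt_log hr.1 (hsub hr).2).trans_le hS.log_le
  have hleft : ∀ r ∈ Ioo 0 ρ', ∀ l, BranchAt μ p N g θ l r (w r) → l = i := by
    intro r hr l hl
    obtain ⟨u, hu, hul⟩ := ((hl.eventually.filter_mono nhdsWithin_le_nhds).and
      (Ioo_mem_nhdsLT (haw.lt r (hsub hr)))).exists
    exact BranchAt.unique h (hX r hr) hu (hi r hr u hul)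
  have hright : ∀ r ∈ Ioo 0 ρ', ∀ l, BranchAt μ p N g θ l r (w r) → l = j := by
    intro r hr l hl
    obtain ⟨u, hu, hul⟩ := ((hl.eventually.filter_mono nhdsWithin_le_nhds).and
      (Ioo_mem_nhdsGT (hwb.lt r (hsub hr)))).exists
    exact BranchAt.unique h (hX r hr) hu (hj r hr u hul)
  by_cases hij : i = j
  · subst hij
    right
    intro r hr
    have hac : ContinuousOn a (Ioo 0 ρ') := fun r hr =>
      (hS.arcs.analyticAt a haw.left_mem r (hsub hr)).continuousAt.continuousWithinAt
    have hbc : ContinuousOn b (Ioo 0 ρ') := fun r hr =>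
      (hS.arcs.analyticAt b hwb.right_mem r (hsub hr)).continuousAt.continuousWithinAt
    have haw' := haw.lt r (hsub hr)
    have hwb' := hwb.lt r (hsub hr)
    set u₀ := (a r + w r) / 2 with hu₀
    have hγ : ∀ t : ℝ, logPoint θ r u₀ + (t : ℂ) * (((w r - u₀ : ℝ) : ℂ) * Complex.I) =
        logPoint θ r (u₀ + t * (w r - u₀)) := fun t => by
      apply Complex.ext <;> simp [logPoint]
      ring
    -- On the region bounded by a and b only the branch i can occur, even on the middle arc, since a
    -- branch there extends to both sides. With no competitors, it propagates across at constant
    -- radius.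
    have key : OnBranch μ (logChart p N) (fun ζ => g i (Complex.exp ζ))
        (logPoint θ r u₀ + ((1 : ℝ) : ℂ) * (((w r - u₀ : ℝ) : ℂ) * Complex.I)) := by
      refine h.propagate hB h0 (isOpen_logRegion hρ'0 hac hbc θ)
        (fun ζ hζ => hζ.1.trans_le ((Real.log_le_log hρ'0 hρ').trans hS.log_le))
        (L := {i}) (m := i) (fun ζ hζ l hl => ?_) zero_le_one
        (γ := fun t => logPoint θ r u₀ + (t : ℂ) * (((w r - u₀ : ℝ) : ℂ) * Complex.I))
        (γ' := fun _ => ((w r - u₀ : ℝ) : ℂ) * Complex.I) (fun t _ => ?_) (fun t ht => ?_)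
        (fun t _ l hl hne => absurd hl hne) ?_
      · have hζr : Real.exp ζ.re ∈ Ioo 0 ρ' :=
          ⟨Real.exp_pos _, (Real.lt_log_iff_exp_lt hρ'0).1 hζ.1⟩
        rw [eq_logPoint θ ζ] at hl
        change BranchAt μ p N g θ l _ _ at hl
        rcases lt_trichotomy (ζ.im - θ) (w (Real.exp ζ.re)) with hlt | heq | hlt
        · exact BranchAt.unique h (hX _ hζr) hl (hi _ hζr _ ⟨hζ.2.1, hlt⟩)
        · exact hleft _ hζr l (heq ▸ hl)
        · exact BranchAt.unique h (hX _ hζr) hl (hj _ hζr _ ⟨hlt, hζ.2.2⟩)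
      · simpa using ((Complex.ofRealCLM.hasDerivAt (x := t)).mul_const
          (((w r - u₀ : ℝ) : ℂ) * Complex.I)).const_add (logPoint θ r u₀)
      · simp only [hγ]
        exact logPoint_mem_logRegion hr ⟨by nlinarith [ht.1], by nlinarith [ht.2]⟩
      · simp only [hγ]
        rw [zero_mul, add_zero]
        exact hi r hr _ ⟨by rw [hu₀]; linarith, by rw [hu₀]; linarith⟩
    rw [hγ, one_mul, add_sub_cancel] at key
    exact key.notMem
  · left
    intro r hr
    by_contra hn
    -- At a point of the arc off the support, the branch taken would extend to both sides and
    -- identify i with j.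
    obtain ⟨l, hl⟩ := h.exists_onBranch (ζ := logPoint θ r (w r)) (hX r hr) hn
    exact hij ((hleft r hr l hl).symm.trans (hright r hr l hl))

/-- In a small sector around any direction, the support consists of finitely many arcs. -/
theorem exists_sector_arcs (h : LogRoots μ p N X fun l ζ => g l (Complex.exp ζ))
    (hg : ∀ l, MeromorphicAt (g l) 0) {B : ℝ} (hB : ∀ᵐ ζ ∂μ, ‖ζ‖ ≤ B)
    (h0 : volume μ.support = 0) (θ : ℝ) :
    ∃ W : Set (ℝ → ℝ), W.Finite ∧ (∀ w ∈ W, AnalyticAt ℝ w 0) ∧ ∃ ε > 0, ∀ᶠ r in 𝓝[>] (0 : ℝ),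
      (∀ w ∈ W, logChart p N (logPoint θ r (w r)) ∈ μ.support) ∧
      ∀ u, |u| < ε → logChart p N (logPoint θ r u) ∈ μ.support → ∃ w ∈ W, u = w r := by
  obtain ⟨L, F, W, ρ, ε, hε, hεW, hεW', hWa, hS⟩ := h.exists_sectorData hg hB h0 θ
  have h1 : ∀ a b, ∃ m, Adjacent W ρ a b →
      ∀ᶠ r in 𝓝[>] (0 : ℝ), ∀ u ∈ Ioo (a r) (b r), BranchAt μ p N g θ m r u := by
    intro a b
    by_cases hab : Adjacent W ρ a b
    · obtain ⟨m, hm⟩ := hS.exists_branch h hB h0 hab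
      exact ⟨m, fun _ => hm⟩
    -- For non-adjacent pairs any index will do; one exists because some point of the chart lies off
    -- the support.
    · obtain ⟨ζ, hζ, hs⟩ := h.exists_notMem h0 (isOpen_re_lt X) ⟨(X - 1 : ℝ), by simp⟩
      exact ⟨(h.root ζ hζ hs).choose, fun h => absurd h hab⟩
  choose m hm using h1
  have h2 : ∀ᶠ r in 𝓝[>] (0 : ℝ), ∀ a ∈ W, ∀ b ∈ W, Adjacent W ρ a b →
      ∀ u ∈ Ioo (a r) (b r), BranchAt μ p N g θ (m a b) r u := by
    refine hS.arcs.finite.eventually_all.2 fun a _ => hS.arcs.finite.eventually_all.2 fun b _ => ?_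
    by_cases hab : Adjacent W ρ a b
    · filter_upwards [hm a b hab] with r hr _ using hr
    · exact Eventually.of_forall fun _ h => absurd h hab
  obtain ⟨ρ₁, hρ₁, hρ₁'⟩ := exists_of_eventually_nhdsGT h2
  set ρ' := min ρ ρ₁ with hρ'
  have hρ'0 : 0 < ρ' := lt_min hS.pos hρ₁
  have hsub : Ioo 0 ρ' ⊆ Ioo 0 ρ := Ioo_subset_Ioo_right (min_le_left _ _)
  have hbr : ∀ a b, Adjacent W ρ a b → ∀ r ∈ Ioo 0 ρ', ∀ u ∈ Ioo (a r) (b r),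
      BranchAt μ p N g θ (m a b) r u := fun a b hab r hr =>
    hρ₁' r hr.1 (hr.2.trans_le (min_le_right _ _)) a hab.left_mem b hab.right_mem hab
  set W' : Set (ℝ → ℝ) := {w ∈ W | ∀ᶠ r in 𝓝[>] (0 : ℝ),
    logChart p N (logPoint θ r (w r)) ∈ μ.support} with hW'
  have hfin : W'.Finite := hS.arcs.finite.subset (sep_subset _ _)
  refine ⟨W', hfin, fun w hw => hWa w hw.1, ε, hε, ?_⟩
  filter_upwards [hfin.eventually_all.2 fun w hw => hw.2, Ioo_mem_nhdsGT hρ'0] with r hr1 hr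
  refine ⟨hr1, fun u hu hK => ?_⟩
  obtain ⟨hu1, hu2⟩ := abs_lt.1 hu
  by_cases hne : ∀ w ∈ W, u ≠ w r
  · obtain ⟨a, b, hab, hmem⟩ := hS.arcs.exists_adjacent (hsub hr) ⟨_, hεW', hu1⟩ ⟨_, hεW, hu2⟩ hne
    exact absurd hK (hbr a b hab r hr u hmem).notMem
  push Not at hne
  obtain ⟨w, hw, rfl⟩ := hne
  obtain ⟨a, ha⟩ := hS.arcs.exists_adjacent_left hw (hsub hr) ⟨_, hεW', hu1⟩
  obtain ⟨b, hb⟩ := hS.arcs.exists_adjacent_right hw (hsub hr) ⟨_, hεW, hu2⟩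
  refine ⟨w, ⟨hw, ?_⟩, rfl⟩
  rcases hS.arc_dichotomy h hB h0 ha hb hρ'0 (min_le_left _ _) (hbr a w ha) (hbr w b hb) with
    hd | hd
  · filter_upwards [Ioo_mem_nhdsGT hρ'0] with r hr using hd r hr
  · exact absurd hK (hd r hr)

end LogRoots

end Sector

/-! ### From sectors to analytic half-arcs -/

section HalfArcs

theorem logChart_logPoint {r : ℝ} (hr : 0 < r) (p : ℂ) (N : ℕ) (θ u : ℝ) :
    logChart p N (logPoint θ r u) = p + polarPoint r (θ + u) ^ N := by
  rw [logChart, Complex.exp_nat_mul, exp_logPoint hr]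

theorem exists_polarPoint (s : ℂ) :
    ∃ φ ∈ Icc (0 : ℝ) (2 * Real.pi), s = polarPoint ‖s‖ φ := by
  obtain ⟨φ, hφ⟩ : ∃ φ : ℝ, s = polarPoint ‖s‖ φ := ⟨s.arg, (Complex.norm_mul_exp_arg_mul_I s).symm⟩
  have hper : Function.Periodic (polarPoint ‖s‖) (2 * Real.pi) := fun x => by
    simp only [polarPoint]
    push_cast
    rw [add_mul, Complex.exp_periodic]
  obtain ⟨ψ, hψ, h⟩ := hper.exists_mem_Ico₀ Real.two_pi_pos φ
  exact ⟨ψ, Ico_subset_Icc_self hψ, hφ.trans h⟩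

theorem analyticAt_polarPoint {w : ℝ → ℝ} {r : ℝ} (hw : AnalyticAt ℝ w r) :
    AnalyticAt ℝ (fun r => polarPoint r (w r)) r := by
  have h1 : AnalyticAt ℝ (fun r : ℝ => (r : ℂ)) r := Complex.ofRealCLM.analyticAt r
  have h2 : AnalyticAt ℝ (fun r : ℝ => ((w r : ℝ) : ℂ)) r :=
    (Complex.ofRealCLM.analyticAt (w r)).comp hw
  have h3 : AnalyticAt ℝ Complex.exp ((w r : ℂ) * Complex.I) :=
    (analyticAt_cexp (z := (w r : ℂ) * Complex.I)).restrictScalars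
  exact h1.mul (h3.comp_of_eq (h2.mul analyticAt_const) rfl)

/-- Near a point where the Cauchy transform is algebraic, the support consists of finitely many
analytic curves, each parametrized by a root of the distance to the point. -/
theorem LogRoots.exists_curves {ι : Type} {μ : Measure ℂ} {p : ℂ} {N : ℕ} {X : ℝ} {g : ι → ℂ → ℂ}
    [Finite ι] [IsFiniteMeasure μ] (h : LogRoots μ p N X fun l ζ => g l (Complex.exp ζ))
    (hg : ∀ l, MeromorphicAt (g l) 0) {B : ℝ} (hB : ∀ᵐ ζ ∂μ, ‖ζ‖ ≤ B)
    (h0 : volume μ.support = 0) :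
    ∃ C : Set (ℝ → ℂ), C.Finite ∧ (∀ c ∈ C, AnalyticAt ℝ c 0) ∧
      (∀ c ∈ C, ∀ r : ℝ, 0 ≤ r → ‖c r - p‖ = r ^ N) ∧
      ∀ᶠ r in 𝓝[>] (0 : ℝ), ∀ z, ‖z - p‖ = r ^ N → (z ∈ μ.support ↔ ∃ c ∈ C, z = c r) := by
  choose W hW hWa ε hε hev using fun θ => h.exists_sector_arcs hg hB h0 θ
  -- Compactness of the circle of directions in the s-plane: finitely many sectors cover it.
  obtain ⟨t, -, ht⟩ := isCompact_Icc.elim_nhds_subcover (X := ℝ)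
    (fun θ => Metric.ball θ (ε θ)) (fun θ _ => Metric.ball_mem_nhds θ (hε θ))
    (s := Icc 0 (2 * Real.pi))
  set C : Set (ℝ → ℂ) := ⋃ θ ∈ t, (fun w r => p + polarPoint r (θ + w r) ^ N) '' W θ with hC
  refine ⟨C, t.finite_toSet.biUnion fun θ _ => (hW θ).image _, ?_, ?_, ?_⟩
  · simp only [hC, mem_iUnion]
    rintro _ ⟨θ, hθ, w, hw, rfl⟩
    exact analyticAt_const.add ((analyticAt_polarPoint (analyticAt_const.add (hWa θ w hw))).pow N)
  · simp only [hC, mem_iUnion]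
    rintro _ ⟨θ, hθ, w, hw, rfl⟩ r hr
    simp [norm_polarPoint hr]
  · filter_upwards [t.finite_toSet.eventually_all.2 fun θ _ => hev θ, self_mem_nhdsWithin]
      with r hr hr0 z hz
    have hr0 : 0 < r := hr0
    constructor
    · intro hzK
      obtain ⟨s, hs⟩ := IsAlgClosed.exists_pow_nat_eq (z - p) h.pos
      obtain ⟨φ, hφ, hsφ⟩ := exists_polarPoint s
      have hsr : ‖s‖ = r := by
        rw [← hs, norm_pow] at hz
        exact (pow_left_inj₀ (norm_nonneg _) hr0.le h.pos.ne').1 hz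
      rw [hsr] at hsφ
      obtain ⟨θ, hθ, hφθ⟩ := mem_iUnion₂.1 (ht hφ)
      have hz' : z = p + polarPoint r (θ + (φ - θ)) ^ N := by
        rw [add_sub_cancel, ← hsφ, hs, add_sub_cancel]
      obtain ⟨w, hw, hu⟩ := (hr θ hθ).2 (φ - θ) (by simpa [Real.dist_eq] using hφθ)
        (by rw [logChart_logPoint hr0, ← hz']; exact hzK)
      exact ⟨_, mem_iUnion₂.2 ⟨θ, hθ, w, hw, rfl⟩, by simp only; rw [← hu]; exact hz'⟩
    · simp only [hC, mem_iUnion]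
      rintro ⟨_, ⟨θ, hθ, w, hw, rfl⟩, rfl⟩
      have := (hr θ hθ).1 w hw
      rwa [logChart_logPoint hr0] at this

/-- The squared distance to p along c is r^(2N), whose derivative is nonzero for r > 0. -/
theorem deriv_ne_zero_of_norm_sub_eq {c : ℝ → ℂ} {p : ℂ} {N : ℕ} (hN : 0 < N) {r : ℝ} (hr : 0 < r)
    (hc : DifferentiableAt ℝ c r) (hnorm : ∀ r, 0 ≤ r → ‖c r - p‖ = r ^ N) : deriv c r ≠ 0 := by
  intro h0
  have h1 := (hc.hasDerivAt.sub_const p).norm_sq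
  rw [h0, inner_zero_right, mul_zero] at h1
  have h2 : HasDerivAt (fun x : ℝ => x ^ (N * 2)) (((N * 2 : ℕ) : ℝ) * r ^ (N * 2 - 1)) r :=
    hasDerivAt_pow _ _
  have h3 : (fun x : ℝ => x ^ (N * 2)) =ᶠ[𝓝 r] fun x => ‖c x - p‖ ^ 2 := by
    filter_upwards [lt_mem_nhds hr] with x hx
    rw [hnorm x (le_of_lt hx), ← pow_mul]
  have h4 := (h2.congr_of_eventuallyEq h3.symm).unique h1
  have h5 : (0 : ℝ) < ((N * 2 : ℕ) : ℝ) * r ^ (N * 2 - 1) := by positivity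
  exact h5.ne' h4

/-- The distance to p determines the parameter, so curves can meet only at equal parameters. By
analyticity two of them agree for all small r > 0 or for none, and one representative is kept from
each class. -/
theorem exists_halfArcs {K : Set ℂ} {p : ℂ} (hp : p ∈ K) {N : ℕ} (hN : 0 < N)
    {C : Set (ℝ → ℂ)} (hfin : C.Finite) (ha : ∀ c ∈ C, AnalyticAt ℝ c 0)
    (hnorm : ∀ c ∈ C, ∀ r : ℝ, 0 ≤ r → ‖c r - p‖ = r ^ N)
    (hK : ∀ᶠ r in 𝓝[>] (0 : ℝ), ∀ z, ‖z - p‖ = r ^ N → (z ∈ K ↔ ∃ c ∈ C, z = c r)) :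
    ∃ (m : ℕ) (γ : Fin m → ℝ → ℂ), (∀ i, IsAnalyticHalfArc p (γ i)) ∧
      (∀ i j, i ≠ j → γ i '' Icc 0 1 ∩ γ j '' Icc 0 1 = {p}) ∧
      ∀ᶠ z in 𝓝 p, z ∈ K ↔ z = p ∨ ∃ i, z ∈ γ i '' Icc 0 1 := by
  have h1 : ∀ᶠ r in 𝓝[>] (0 : ℝ), ∀ c ∈ C, AnalyticAt ℝ c r :=
    hfin.eventually_all.2 fun c hc => nhdsWithin_le_nhds (ha c hc).eventually_analyticAt
  have h2 : ∀ c ∈ C, ∀ c' ∈ C, ∃ q : Prop, ∀ᶠ r in 𝓝[>] (0 : ℝ), (c r = c' r ↔ q) := by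
    intro c hc c' hc'
    rcases ((ha c hc).sub (ha c' hc')).eventually_eq_zero_or_eventually_ne_zero with h | h
    · exact ⟨True, by
        filter_upwards [nhdsWithin_le_nhds h] with r hr
        simpa [sub_eq_zero] using hr⟩
    · exact ⟨False, by
        filter_upwards [nhdsWithin_mono _ (fun x (hx : 0 < x) => hx.ne') h] with r hr
        simpa [sub_eq_zero] using hr⟩
  choose! q hq using h2
  have h3 : ∀ᶠ r in 𝓝[>] (0 : ℝ), ∀ c ∈ C, ∀ c' ∈ C, (c r = c' r ↔ q c c') :=
    hfin.eventually_all.2 fun c hc => hfin.eventually_all.2 fun c' hc' => hq c hc c' hc'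
  obtain ⟨δ, hδ, H⟩ := exists_of_eventually_nhdsGT (h1.and (h3.and hK))
  obtain ⟨ρ, hρ, hρδ⟩ := exists_between hδ
  have hc0 : ∀ c ∈ C, c 0 = p := fun c hc => by
    have := hnorm c hc 0 le_rfl
    rwa [zero_pow hN.ne', norm_eq_zero, sub_eq_zero] at this
  -- Coincidence no longer depends on r below δ, so representatives may be chosen by their value at
  -- the single radius ρ.
  obtain ⟨C', hC'C, hbij⟩ := C.exists_subset_bijOn fun c => c ρ
  have hfin' : Finite C' := hfin.subset hC'C
  obtain ⟨m, ⟨e⟩⟩ := Finite.exists_equiv_fin C'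
  have hmem : ∀ i, (e.symm i : ℝ → ℂ) ∈ C := fun i => hC'C (e.symm i).2
  have hρt : ∀ t ∈ Ioc (0 : ℝ) 1, 0 < ρ * t ∧ ρ * t < δ := fun t ht =>
    ⟨mul_pos hρ ht.1, (mul_le_of_le_one_right hρ.le ht.2).trans_lt hρδ⟩
  have han : ∀ i, ∀ t ∈ Icc (0 : ℝ) 1, AnalyticAt ℝ (e.symm i : ℝ → ℂ) (ρ * t) := by
    intro i t ht
    rcases ht.1.eq_or_lt with rfl | ht0
    · rw [mul_zero]; exact ha _ (hmem i)
    · obtain ⟨h4, h5⟩ := hρt t ⟨ht0, ht.2⟩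
      exact (H _ h4 h5).1 _ (hmem i)
  have hinj : ∀ i j, ∀ t ∈ Icc (0 : ℝ) 1, ∀ t' ∈ Icc (0 : ℝ) 1,
      (e.symm i : ℝ → ℂ) (ρ * t) = (e.symm j : ℝ → ℂ) (ρ * t') → t = t' := by
    intro i j t ht t' ht' heq
    have h4 := hnorm _ (hmem i) (ρ * t) (mul_nonneg hρ.le ht.1)
    rw [heq, hnorm _ (hmem j) (ρ * t') (mul_nonneg hρ.le ht'.1)] at h4
    have h5 := (pow_left_inj₀ (mul_nonneg hρ.le ht'.1) (mul_nonneg hρ.le ht.1) hN.ne').1 h4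
    exact (mul_left_cancel₀ hρ.ne' h5).symm
  refine ⟨m, fun i t => (e.symm i : ℝ → ℂ) (ρ * t), fun i => ⟨?_, ?_, ?_, ?_⟩, ?_, ?_⟩
  · intro t ht
    exact (han i t ht).comp_of_eq (analyticAt_const.mul analyticAt_id) rfl
  · simp only [mul_zero]; exact hc0 _ (hmem i)
  · intro t ht t' ht' heq
    exact hinj i i t ht t' ht' heq
  · intro t ht
    have h4 := (han i t ⟨ht.1.le, ht.2⟩).differentiableAt
    rw [deriv_comp_mul_left]
    exact smul_ne_zero hρ.ne'
      (deriv_ne_zero_of_norm_sub_eq hN (hρt t ht).1 h4 (hnorm _ (hmem i)))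
  · intro i j hij
    refine Subset.antisymm ?_ ?_
    · rintro _ ⟨⟨t, ht, rfl⟩, t', ht', heq⟩
      simp only at heq
      obtain rfl := hinj j i t' ht' t ht heq
      rcases ht.1.eq_or_lt with rfl | ht0
      · simp [hc0 _ (hmem i)]
      · exfalso
        obtain ⟨h4, h5⟩ := hρt t' ⟨ht0, ht.2⟩
        have h6 := ((H _ h4 h5).2.1 _ (hmem j) _ (hmem i)).1 heq
        have h7 := ((H ρ hρ hρδ).2.1 _ (hmem j) _ (hmem i)).2 h6
        have h8 := hbij.injOn (e.symm j).2 (e.symm i).2 h7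
        exact hij (e.symm.injective (Subtype.ext h8)).symm
    · rintro _ rfl
      exact ⟨⟨0, by simp, by simp [hc0 _ (hmem i)]⟩, ⟨0, by simp, by simp [hc0 _ (hmem j)]⟩⟩
  · filter_upwards [Metric.ball_mem_nhds p (pow_pos hρ N)] with z hz
    rw [mem_ball_iff_norm] at hz
    rcases eq_or_ne z p with rfl | hzp
    · simp [hp]
    have hz0 : 0 < ‖z - p‖ := norm_pos_iff.2 (sub_ne_zero.2 hzp)
    set r : ℝ := ‖z - p‖ ^ ((N : ℝ)⁻¹) with hr
    have hr0 : 0 < r := Real.rpow_pos_of_pos hz0 _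
    have hrN : r ^ N = ‖z - p‖ := Real.rpow_inv_natCast_pow hz0.le hN.ne'
    have hrρ : r < ρ := by
      rw [← hrN] at hz
      exact lt_of_pow_lt_pow_left₀ N hρ.le hz
    obtain ⟨-, h5, h6⟩ := H r hr0 (hrρ.trans hρδ)
    rw [h6 z hrN.symm]
    constructor
    · rintro ⟨c, hc, hzc⟩
      obtain ⟨c', hc', hcc'⟩ := hbij.surjOn ⟨c, hc, rfl⟩
      have h7 := ((H ρ hρ hρδ).2.1 _ (hC'C hc') _ hc).1 hcc'
      have h8 := (h5 _ (hC'C hc') _ hc).2 h7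
      refine Or.inr ⟨e ⟨c', hc'⟩, r / ρ, ⟨by positivity, (div_le_one hρ).2 hrρ.le⟩, ?_⟩
      simp only [Equiv.symm_apply_apply]
      rw [mul_div_cancel₀ _ hρ.ne', h8, hzc]
    · rintro (rfl | ⟨i, t, ht, htz⟩)
      · exact absurd rfl hzp
      · simp only at htz
        refine ⟨_, hmem i, ?_⟩
        have h7 := hnorm _ (hmem i) (ρ * t) (mul_nonneg hρ.le ht.1)
        rw [htz, ← hrN] at h7
        rw [(pow_left_inj₀ hr0.le (mul_nonneg hρ.le ht.1) hN.ne').1 h7, htz]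

end HalfArcs

/-! ### The algebraic equation as Puiseux data, and the conclusion -/

section Algebraic

open scoped Polynomial.Bivariate in
theorem HasAlgebraicCauchyTransform.exists_evalEval_eq_zero {μ : Measure ℂ}
    (h : HasAlgebraicCauchyTransform μ) : ∃ P : Polynomial (Polynomial ℂ), P ≠ 0 ∧
      ∀ z, z ∉ μ.support → P.evalEval z (cauchyTransform μ z) = 0 := by
  obtain ⟨k, -, q, ⟨i, hi⟩, hq⟩ := h
  refine ⟨∑ i : Fin (k + 1), Polynomial.monomial (i : ℕ) (q i), fun h0 => hi ?_, fun z hz => ?_⟩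
  · have h1 := congrArg (fun P => P.coeff (i : ℕ)) h0
    simpa [Polynomial.finsetSum_coeff, Polynomial.coeff_monomial, Fin.val_inj] using h1
  · rw [← hq z hz]
    simp [Polynomial.evalEval, Polynomial.eval_finsetSum, Polynomial.eval_monomial]

open scoped Polynomial.Bivariate in
theorem exists_logRoots {μ : Measure ℂ} {P : Polynomial (Polynomial ℂ)} (hP : P ≠ 0)
    (hroot : ∀ z, z ∉ μ.support → P.evalEval z (cauchyTransform μ z) = 0) (p : ℂ) :
    ∃ (N : ℕ) (ι : Type) (_ : Finite ι) (g : ι → ℂ → ℂ) (X : ℝ),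
      (∀ l, MeromorphicAt (g l) 0) ∧ LogRoots μ p N X fun l ζ => g l (Complex.exp ζ) := by
  obtain ⟨N, ι, hι, g, hN, hg, h1, h2⟩ := exists_puiseux hP p
  have h3 : ∀ᶠ s in 𝓝[≠] (0 : ℂ), ∀ l, AnalyticAt ℂ (g l) s :=
    eventually_all.2 fun l => (hg l).eventually_analyticAt
  obtain ⟨η, hη, H⟩ := Metric.eventually_nhds_iff_ball.1
    (eventually_nhdsWithin_iff.1 (h1.and (h2.and h3)))
  have hball : ∀ ζ : ℂ, ζ.re < Real.log η → Complex.exp ζ ∈ Metric.ball (0 : ℂ) η := by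
    intro ζ hζ
    rw [mem_ball_zero_iff, Complex.norm_exp]
    exact (Real.lt_log_iff_exp_lt hη).1 hζ
  refine ⟨N, ι, hι, g, Real.log η, hg, hN, fun l ζ hζ => ?_, fun ζ hζ hs => ?_, fun ζ hζ => ?_⟩
  · have h4 := (H _ (hball ζ hζ) (Complex.exp_ne_zero ζ)).2.2 l
    exact (h4.differentiableAt.comp ζ Complex.differentiableAt_exp).differentiableWithinAt
  · refine (H _ (hball ζ hζ) (Complex.exp_ne_zero ζ)).1 _ ?_
    have h4 : logChart p N ζ = p + Complex.exp ζ ^ N := by rw [logChart, Complex.exp_nat_mul]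
    rw [← h4]
    exact hroot _ hs
  · exact (H _ (hball ζ hζ) (Complex.exp_ne_zero ζ)).2.1

end Algebraic

theorem theorem2 (μ : Measure ℂ) [IsLocallyFiniteMeasure μ]
    (hcompact : IsCompact μ.support) (hnull : volume μ.support = 0)
    (halg : HasAlgebraicCauchyTransform μ) :
    IsRealAnalyticSetOfDimLEOne μ.support := by
  obtain ⟨P, hP, hroot⟩ := halg.exists_evalEval_eq_zero
  -- The complement of the support is null, and a locally finite measure is finite on the compact
  -- support.
  have hfin : IsFiniteMeasure μ := ⟨by
    rw [← measure_add_measure_compl μ.isClosed_support.measurableSet,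
      Measure.measure_compl_support, add_zero]
    exact hcompact.measure_lt_top⟩
  obtain ⟨B, hB⟩ := hcompact.isBounded.exists_norm_le
  have hB' : ∀ᵐ ζ ∂μ, ‖ζ‖ ≤ B := by
    filter_upwards [Measure.support_mem_ae] with ζ hζ using hB ζ hζ
  refine ⟨μ.isClosed_support, fun p hp => ?_⟩
  obtain ⟨N, ι, hι, g, X, hg, h⟩ := exists_logRoots hP hroot p
  obtain ⟨C, hC, hCa, hCn, hCK⟩ := h.exists_curves hg hB' hnull
  exact exists_halfArcs hp h.pos hC hCa hCn hCK
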